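/- Let $\mathcal A=(Q,E,\Sigma,s,F)$ be a finite automaton with a finite set $Q$ of states, a finite totally ordered alphabet $\Sigma$, edges $E\subseteq Q\times Q\times\Sigma$, initial state $s$ and set $F$ of final states. Assume, as always below, that every character labels an edge, all edges reaching the same state have the same label, every state is reachable from $s$, $s$ has no incoming edges, and from every state a final state can be reached. $\mathcal A$ is a DFA if every state has at most one outgoing edge with a given label. Let $\lambda(v)$ be the label of the edges reaching $v\neq s$, and let $\lambda(s)=\#$ be smaller than every character. A co-lexicographic order of $\mathcal A$ is a partial order $\le$ on $Q$ such that (1) $\lambda(u)<\lambda(v)$ implies $u<v$, and (2) if there are edges from $u'$ to $u$ and from $v'$ to $v$, $\lambda(u)=\lambda(v)$ and $u<v$, then $u'\le v'$. It is maximal if no other co-lexicographic order contains it. A $\le$-chain decomposition is a partition of $Q$ into $\le$-chains. The co-lexicographic width $\bar p$ of $\mathcal A$ is the smallest $p$ for which some co-lexicographic order $\le$ of $\mathcal A$ has a $\le$-chain decomposition $\{Q_i\}_{i=1}^p$. Every DFA has a unique maximal co-lexicographic order $\le$. In the word RAM model with words of at least $\kappa\,(\lfloor\log_2|Q|\rfloor+1)$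 bits, for a suitable constant $\kappa$, there is an algorithm that on input a DFA $\mathcal A$ computes this order $\le$ (as a $|Q|\times|Q|$ Boolean matrix) together with a smallest $\le$-chain decomposition $\{Q_i\}_{i=1}^{\bar p}$, which has exactly $\bar p$ chains, in time $O(|E|^2+|Q|^{5/2})$. Hence DFAs can be indexed with optimal width in polynomial time: there is an algorithm in the same model that on input a DFA $\mathcal A$ computes, in time polynomial in $|Q|+|E|$, the Burrows-Wheeler transform of $(\mathcal A,\le,\{Q_i\}_{i=1}^{\bar p})$, where $\le$ is the maximal co-lexicographic order and $\{Q_i\}_{i=1}^{\bar p}$ is a smallest $\le$-chain decomposition with $s\in Q_1$. Here, with $\pi(v)=i$ for $v\in Q_i$ and with the states listed as $v_1,\dots,v_n$ by increasing $\pi$ and, within a chain, by $\le$, the Burrows-Wheeler transform is the triple of sequences $(\mathtt{OUT},\mathtt{IN},\mathtt{FINAL})$ in which $\mathtt{OUT}[i]$ lists the pairs $(\pi(u),c)$ for all edges $(v_i,u,c)\in E$, $\mathtt{IN}[i]$ lists $\pi(w)$ for all edges $(w,v_i,c)\in E$, and $\mathtt{FINAL}[i]$ says whether $v_i\in F$.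 -/

import Mathlib

namespace CoLex

/- ## The word RAM

A word is an element of `BitVec w`.  A program has finitely many registers (those it mentions) and
a random access memory whose addresses are words.  Arithmetic is modulo `2 ^ w`.  Control flow is
written in structured form; every instruction and every evaluation of a test costs one step. -/

/-- The binary operations on words that cost one step (all unsigned, modulo `2 ^ w`). -/
inductive Op
  | add | sub | mul | div | mod | and | or | xor | shl | shr

def Op.eval {w : ℕ} : Op → BitVec w → BitVec w → BitVec w
  | .add, x, y => x + y
  | .sub, x, y => x - y
  | .mul, x, y => x * y
  | .div, x, y => x / y
  | .mod, x, y => x % y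
  | .and, x, y => x &&& y
  | .or, x, y => x ||| y
  | .xor, x, y => x ^^^ y
  | .shl, x, y => x <<< y
  | .shr, x, y => x >>> y

/-- The instructions.  Natural numbers name registers, except for the constant `k`. -/
inductive Instr
  /-- register `d` gets the constant `k` -/
  | const (d k : ℕ)
  /-- register `d` gets the result of `o` on the registers `a` and `b` -/
  | bin (o : Op) (d a b : ℕ)
  /-- register `d` gets the memory cell whose address is in register `a` -/
  | load (d a : ℕ)
  /-- the memory cell whose address is in register `a` gets the value of register `b` -/
  | store (a b : ℕ)

/-- Comparisons of two registers, as unsigned numbers. -/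
inductive Test
  | lt (a b : ℕ)
  | le (a b : ℕ)
  | eq (a b : ℕ)
  | ne (a b : ℕ)

/-- Programs.  They do not depend on the word size. -/
inductive Prog
  | skip
  | instr (i : Instr)
  | seq (P R : Prog)
  | ite (b : Test) (P R : Prog)
  | while (b : Test) (P : Prog)

/-- A state of the machine with word size `w`. -/
structure State (w : ℕ) where
  reg : ℕ → BitVec w
  mem : BitVec w → BitVec w

def Instr.exec {w : ℕ} : Instr → State w → State w
  | .const d k, c => { c with reg := Function.update c.reg d (BitVec.ofNat w k) }
  | .bin o d a b, c => { c with reg := Function.update c.reg d (o.eval (c.reg a) (c.reg b)) }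
  | .load d a, c => { c with reg := Function.update c.reg d (c.mem (c.reg a)) }
  | .store a b, c => { c with mem := Function.update c.mem (c.reg a) (c.reg b) }

def Test.Holds {w : ℕ} : Test → State w → Prop
  | .lt a b, c => (c.reg a).toNat < (c.reg b).toNat
  | .le a b, c => (c.reg a).toNat ≤ (c.reg b).toNat
  | .eq a b, c => c.reg a = c.reg b
  | .ne a b, c => c.reg a ≠ c.reg b

/-- `Exec P c t d`: started in the state `c`, the program `P` terminates in the state `d` after
exactly `t` steps. -/
inductive Exec {w : ℕ} : Prog → State w → ℕ → State w → Prop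
  | skip (c : State w) : Exec .skip c 1 c
  | instr (i : Instr) (c : State w) : Exec (.instr i) c 1 (i.exec c)
  | seq {P R : Prog} {c d e : State w} {t r : ℕ} :
      Exec P c t d → Exec R d r e → Exec (.seq P R) c (t + r) e
  | ite_true {b : Test} {P R : Prog} {c d : State w} {t : ℕ} :
      b.Holds c → Exec P c t d → Exec (.ite b P R) c (t + 1) d
  | ite_false {b : Test} {P R : Prog} {c d : State w} {t : ℕ} :
      ¬ b.Holds c → Exec R c t d → Exec (.ite b P R) c (t + 1) d
  | while_true {b : Test} {P : Prog} {c d e : State w} {t r : ℕ} :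
      b.Holds c → Exec P c t d → Exec (.while b P) d r e → Exec (.while b P) c (t + r + 1) e
  | while_false {b : Test} {P : Prog} {c : State w} :
      ¬ b.Holds c → Exec (.while b P) c 1 c

/-- The initial state: the input is in the memory from address `0` on, and all other cells and all
registers are `0`. -/
def State.init (w : ℕ) (input : List ℕ) : State w where
  reg := fun _ => 0
  mem := fun a => BitVec.ofNat w (input.getD a.toNat 0)

/-- The list `output` is in the memory from the address in register `0` on. -/
def State.Outputs {w : ℕ} (c : State w) (output : List ℕ) : Prop :=
  (c.reg 0).toNat + output.length ≤ 2 ^ w ∧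
    ∀ (i : ℕ) (h : i < output.length),
      (c.mem (BitVec.ofNat w ((c.reg 0).toNat + i))).toNat = output[i]

/-- On the machine with word size `w` and on the given input, `P` terminates after exactly `t`
steps with the given output. -/
def Prog.Computes (P : Prog) (w : ℕ) (input : List ℕ) (t : ℕ) (output : List ℕ) : Prop :=
  ∃ c : State w, Exec P (State.init w input) t c ∧ c.Outputs output

/- ## Finite automata -/

/-- A finite automaton; `(u, v, a) ∈ E` is an edge from `u` to `v` with label `a`. -/
structure Automaton (Q α : Type*) where
  E : Finset (Q × Q × α)
  s : Q
  F : Finset Q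

namespace Automaton

variable {Q α : Type*} (M : Automaton Q α)

/-- There is an edge from `u` to `v`. -/
def Edge (u v : Q) : Prop := ∃ a, (u, v, a) ∈ M.E

/-- The standing assumptions on an NFA. -/
structure IsStandard : Prop where
  /-- the alphabet is effective -/
  effective : ∀ a : α, ∃ u v, (u, v, a) ∈ M.E
  /-- all edges reaching the same state have the same label -/
  input_consistent : ∀ u u₁ v a a₁, (u, v, a) ∈ M.E → (u₁, v, a₁) ∈ M.E → a = a₁
  /-- every state is reachable from the initial state -/
  reachable : ∀ u, Relation.ReflTransGen M.Edge M.s u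
  /-- the initial state has no incoming edges -/
  no_incoming : ∀ u, ¬ M.Edge u M.s
  /-- every state is final or allows to reach a final state -/
  coreachable : ∀ u, ∃ f ∈ M.F, Relation.ReflTransGen M.Edge u f

/-- Every state has at most one outgoing edge with a given label. -/
def IsDeterministic : Prop :=
  ∀ u v v₁ a, (u, v, a) ∈ M.E → (u, v₁, a) ∈ M.E → v = v₁

open Classical in
/-- The label `λ(v)` of the edges reaching `v`; it is `⊥`, smaller than every character, if there
are none (that is, for the initial state). -/
noncomputable def lam (v : Q) : WithBot α :=
  if h : ∃ a u, (u, v, a) ∈ M.E then (h.choose : WithBot α) else ⊥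

section Order

variable [LinearOrder α]

/-- Co-lexicographic orders. -/
structure IsCoLex (le : Q → Q → Prop) : Prop where
  refl : ∀ u, le u u
  antisymm : ∀ u v, le u v → le v u → u = v
  trans : ∀ u v z, le u v → le v z → le u z
  axiom_one : ∀ u v, M.lam u < M.lam v → le u v ∧ u ≠ v
  axiom_two : ∀ u₁ u v₁ v, M.Edge u₁ u → M.Edge v₁ v → M.lam u = M.lam v →
    le u v → u ≠ v → le u₁ v₁

/-- Co-lexicographic orders whose only refinement (by a co-lexicographic order) is the order
itself. -/
def IsMaximalCoLex (le : Q → Q → Prop) : Prop :=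
  M.IsCoLex le ∧
    ∀ le₁ : Q → Q → Prop, M.IsCoLex le₁ → (∀ u v, le u v → le₁ u v) → le₁ = le

end Order

end Automaton

/-- A partition of `Q` into `p` (nonempty) chains, given by the function that maps a state to the
index of its chain. -/
def IsChainDecomposition {Q : Type*} (le : Q → Q → Prop) {p : ℕ} (chain : Q → Fin p) : Prop :=
  Function.Surjective chain ∧ ∀ i, IsChain le {v | chain v = i}

/-- A chain decomposition with the smallest number of chains. -/
def IsSmallestChainDecomposition {Q : Type*} (le : Q → Q → Prop) {p : ℕ} (chain : Q → Fin p) :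
    Prop :=
  IsChainDecomposition le chain ∧
    ∀ (r : ℕ) (chain₁ : Q → Fin r), IsChainDecomposition le chain₁ → p ≤ r

namespace Automaton

section Width

variable {Q α : Type*} [LinearOrder α] (M : Automaton Q α)

/-- `M` is `p`-sortable. -/
def Sortable (p : ℕ) : Prop :=
  ∃ le : Q → Q → Prop, M.IsCoLex le ∧ ∃ chain : Q → Fin p, IsChainDecomposition le chain

/-- The co-lexicographic width. -/
noncomputable def width : ℕ := sInf {p | M.Sortable p}

end Width

end Automaton

/- ## Inputs and outputs -/

section Coding

variable {Q α : Type*} [Fintype Q] [Fintype α] [LinearOrder α]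

/-- A character is represented by its rank in the alphabet, so by a number below `|α|`. -/
def rank (a : α) : ℕ := (Finset.univ.filter fun b : α => b < a).card

/-- The choices made when an automaton is written down: a numbering of the states and a list of the
edges, in an arbitrary order and without repetitions. -/
structure Presentation (M : Automaton Q α) where
  idx : Q ≃ Fin (Fintype.card Q)
  edges : List (Q × Q × α)
  nodup : edges.Nodup
  mem_edges : ∀ e, e ∈ edges ↔ e ∈ M.E

open Classical in
/-- The input: `|Q|`, `|E|`, `|α|`, the initial state; the edges, as triples; for every state a
bit that says whether it is final. -/
noncomputable def Presentation.code {M : Automaton Q α} (D : Presentation M) : List ℕ :=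
  [Fintype.card Q, M.E.card, Fintype.card α, (D.idx M.s : ℕ)]
    ++ D.edges.flatMap (fun e => [(D.idx e.1 : ℕ), (D.idx e.2.1 : ℕ), rank e.2.2])
    ++ List.ofFn (fun i => if D.idx.symm i ∈ M.F then 1 else 0)

open Classical in
/-- A relation on the states as a list of `|Q| ^ 2` bits, in row-major order. -/
noncomputable def Presentation.codeRel {M : Automaton Q α} (D : Presentation M)
    (le : Q → Q → Prop) : List ℕ :=
  (List.ofFn fun i => List.ofFn fun j =>
    if le (D.idx.symm i) (D.idx.symm j) then 1 else 0).flatten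

/-- A chain decomposition as the number of chains and, for every state, the index of its chain. -/
def Presentation.codeChain {M : Automaton Q α} (D : Presentation M) {p : ℕ}
    (chain : Q → Fin p) : List ℕ :=
  p :: List.ofFn (fun i => (chain (D.idx.symm i) : ℕ))

end Coding

/- ## The index -/

/-- Three sequences of length `n`: lists of pairs (chain, character), lists of chains, bits. -/
structure BWT (n p : ℕ) (α : Type*) where
  outs : Fin n → List (Fin p × α)
  ins : Fin n → List (Fin p)
  final : Fin n → Bool

open Classical in
/-- `B` is the Burrows-Wheeler transform of `M`, the order `le` and the chain decomposition `chain`.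
The states are listed as `v 0, v 1, …` by chain, and by `le` within a chain.  Entry `i` holds one
pair (chain of the target, label) for every edge leaving `v i`, the chain of the source of every
edge reaching `v i`, and whether `v i` is final. -/
def BWT.IsOf {Q α : Type*} [Fintype Q] {p : ℕ} (B : BWT (Fintype.card Q) p α)
    (M : Automaton Q α) (le : Q → Q → Prop) (chain : Q → Fin p) : Prop :=
  ∃ v : Fin (Fintype.card Q) ≃ Q,
    (∀ i j, i < j → chain (v i) < chain (v j) ∨
      (chain (v i) = chain (v j) ∧ le (v i) (v j) ∧ v i ≠ v j)) ∧
    ∀ i,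
      (B.outs i : Multiset (Fin p × α)) =
        (M.E.filter fun e => e.1 = v i).val.map (fun e => (chain e.2.1, e.2.2)) ∧
      (B.ins i : Multiset (Fin p)) =
        (M.E.filter fun e => e.2.1 = v i).val.map (fun e => chain e.1) ∧
      (B.final i = true ↔ v i ∈ M.F)

/-- The three sequences one after the other, every list preceded by its length. -/
def BWT.code {n p : ℕ} {α : Type*} [Fintype α] [LinearOrder α] (B : BWT n p α) : List ℕ :=
  p :: ((List.ofFn B.outs).flatMap
      (fun l => l.length :: l.flatMap (fun x => [(x.1 : ℕ), rank x.2]))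
    ++ (List.ofFn B.ins).flatMap (fun l => l.length :: l.map (fun j => (j : ℕ)))
    ++ List.ofFn (fun i => (B.final i).toNat))

end CoLex

set_option linter.constructorNameAsVariable false

/-! Say that a pair (u, v) is bad (`NotBelow`) if u = v, or λ(v) < λ(u), or u and v have equal
labels and are entered by edges from a bad pair (u', v'). In terms of words, (u, v) is bad exactly
when some word reaching u is co-lexicographically at least as large as some word reaching v. Let u <
v when (u, v) is not bad. This is the maximal order: `maxOrder_isCoLex` checks the axioms, and
`IsCoLex.le_maxOrder` shows by induction on badness that no co-lexicographic order of a DFA puts u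
strictly below v for a bad pair. Determinism enters only there.

The words reaching a state behave like an interval on a line, and u < v says that the interval of u
lies entirely to the left of that of v. Hence < is an interval order: u < v and x < y imply u < y or
x < v. The formal proof, `NotBelow.interval`, avoids words and inducts on badness.

In an interval order the sets of predecessors are nested, so they can be compared by their
cardinalities (`IntervalOrder.lt_of_numPreds_le`). Take the states by increasing number of
predecessors, append each to any chain whose last element lies below it, and open a new chain if
there is none. Whenever a chain is opened, the last elements of all chains form an antichain
(`Chains.new`). So the p chains come with an antichain of size p, and no decomposition is smaller.
Every co-lexicographic order is contained in the maximal one, so its chains are also chains of the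
maximal order and p is the width (`Automaton.width_eq`). No matching algorithm is needed, and the
cost is O(|E|² + |Q|²).

Bad pairs are found by searching the graph on pairs of states, with one arrow for every two edges
whose targets have equal labels. This takes O(|E|² + |Q|²) steps. The transform is then obtained by
listing the states chain by chain and scanning the list of edges for every state.

The programs are written in a small language with variables and arrays. `Tri` combines partial
specification, termination, a time bound and a frame condition for the compiled code. `Tri.of_wp`
handles loop-free code, `Tri.while_variant` and `Tri.forLoop` handle loops. `Input.tri_solve`,
`Input.tri_emitOrder` and `Input.tri_emitIndex` assemble the phases, and `Presentation` translates
between automata and numbers. -/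

namespace CoLex

/- ## A small language with arrays, compiled to the word RAM -/

/-- The variables of the source language. -/
inductive Var
  | out | n | m | e | f | k | x | h | y | qi | ql | u | v | d | i | c | r | p | o
  deriving DecidableEq

/-- The arrays of the source language; `io` holds the input and the output. -/
inductive Arr
  | io | src | dst | lab | lam | node | tgt | prev | head | mark | queue | cnt | ord | chain
  | top | lst
  deriving DecidableEq

/-- A variable lives in the register with twice its index. So `out` has index 0, because the machine
looks for the address of the output in register 0. Likewise the array `io` gets index 0, which
places it at address 0, where the input is. -/
def Var.idx : Var → ℕ
  | out => 0 | n => 1 | m => 2 | e => 3 | f => 4 | k => 5 | x => 6 | h => 7 | y => 8 | qi => 9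
  | ql => 10 | u => 11 | v => 12 | d => 13 | i => 14 | c => 15 | r => 16 | p => 17 | o => 18

def Arr.idx : Arr → ℕ
  | io => 0 | src => 1 | dst => 2 | lab => 3 | lam => 4 | node => 5 | tgt => 6 | prev => 7
  | head => 8 | mark => 9 | queue => 10 | cnt => 11 | ord => 12 | chain => 13 | top => 14
  | lst => 15

theorem Var.idx_injective : Function.Injective Var.idx := by
  intro a b h
  cases a <;> cases b <;> first | rfl | cases h

theorem Arr.idx_injective : Function.Injective Arr.idx := by
  intro a b h
  cases a <;> cases b <;> first | rfl | cases h

theorem Arr.idx_lt (A : Arr) : A.idx < 17 := by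
  cases A <;> decide

/-- States of the source language. -/
structure St where
  v : Var → ℕ
  a : Arr → ℕ → ℕ

def St.setV (σ : St) (x : Var) (b : ℕ) : St where
  v := Function.update σ.v x b
  a := σ.a

def St.setA (σ : St) (A : Arr) (i b : ℕ) : St where
  v := σ.v
  a := Function.update σ.a A (Function.update (σ.a A) i b)

@[simp] theorem St.setV_v (σ : St) (x y : Var) (b : ℕ) :
    (σ.setV x b).v y = if y = x then b else σ.v y := by
  simp [St.setV, Function.update_apply]

@[simp] theorem St.setV_a (σ : St) (x : Var) (b : ℕ) : (σ.setV x b).a = σ.a := rfl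

@[simp] theorem St.setA_v (σ : St) (A : Arr) (i b : ℕ) : (σ.setA A i b).v = σ.v := rfl

@[simp] theorem St.setA_a (σ : St) (A A' : Arr) (i b : ℕ) :
    (σ.setA A i b).a A' = if A' = A then Function.update (σ.a A) i b else σ.a A' := by
  by_cases h : A' = A
  · subst h; simp [St.setA]
  · simp [St.setA, h]

/-- Expressions. -/
inductive Ex
  | lit (k : ℕ)
  | var (x : Var)
  | ld (A : Arr) (e : Ex)
  | add (a b : Ex)
  | mul (a b : Ex)

namespace Ex

instance : Add Ex := ⟨Ex.add⟩
instance : Mul Ex := ⟨Ex.mul⟩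
instance : Coe Var Ex := ⟨Ex.var⟩
instance (k : ℕ) : OfNat Ex k := ⟨Ex.lit k⟩

def val (σ : St) : Ex → ℕ
  | lit k => k
  | var x => σ.v x
  | ld A e => σ.a A (e.val σ)
  | add a b => a.val σ + b.val σ
  | mul a b => a.val σ * b.val σ

/-- All array accesses are within the bounds. -/
def Ok (B : ℕ) (σ : St) : Ex → Prop
  | lit _ => True
  | var _ => True
  | ld _ e => e.Ok B σ ∧ e.val σ < B
  | add a b => a.Ok B σ ∧ b.Ok B σ
  | mul a b => a.Ok B σ ∧ b.Ok B σ

/-- The value is below `B` (which is automatic for variables and array cells). -/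
def Small (B : ℕ) (σ : St) : Ex → Prop
  | var _ => True
  | ld _ _ => True
  | lit k => k < B
  | add a b => a.val σ + b.val σ < B
  | mul a b => a.val σ * b.val σ < B

/-- Values are below `B ^ size`. -/
def size : Ex → ℕ
  | lit k => k + 1
  | var _ => 1
  | ld _ e => e.size
  | add a b => a.size + b.size
  | mul a b => a.size + b.size

def cost : Ex → ℕ
  | lit _ => 1
  | var _ => 1
  | ld _ e => e.cost + 4
  | add a b => a.cost + (b.cost + 1)
  | mul a b => a.cost + (b.cost + 1)

section
variable (B : ℕ) (σ : St) (a b : Ex) (k : ℕ) (x : Var) (A : Arr)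

@[simp] theorem val_ofNat : (no_index (OfNat.ofNat k) : Ex).val σ = OfNat.ofNat k := rfl
@[simp] theorem val_lit : (lit k).val σ = k := rfl
@[simp] theorem val_var : (var x).val σ = σ.v x := rfl
@[simp] theorem val_ld : (ld A a).val σ = σ.a A (a.val σ) := rfl
@[simp] theorem val_add : (a + b).val σ = a.val σ + b.val σ := rfl
@[simp] theorem val_mul : (a * b).val σ = a.val σ * b.val σ := rfl

@[simp] theorem ok_ofNat : (no_index (OfNat.ofNat k) : Ex).Ok B σ ↔ True := Iff.rfl
@[simp] theorem ok_var : (var x).Ok B σ ↔ True := Iff.rfl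
@[simp] theorem ok_ld : (ld A a).Ok B σ ↔ a.Ok B σ ∧ a.val σ < B := Iff.rfl
@[simp] theorem ok_add : (a + b).Ok B σ ↔ a.Ok B σ ∧ b.Ok B σ := Iff.rfl
@[simp] theorem ok_mul : (a * b).Ok B σ ↔ a.Ok B σ ∧ b.Ok B σ := Iff.rfl

@[simp] theorem small_ofNat :
    (no_index (OfNat.ofNat k) : Ex).Small B σ ↔ OfNat.ofNat k < B := Iff.rfl
@[simp] theorem small_var : (var x).Small B σ ↔ True := Iff.rfl
@[simp] theorem small_ld : (ld A a).Small B σ ↔ True := Iff.rfl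
@[simp] theorem small_add : (a + b).Small B σ ↔ a.val σ + b.val σ < B := Iff.rfl
end

/-- The code that puts the value into register `2 * d + 3`. -/
def code (d : ℕ) : Ex → Prog
  | lit k => .instr (.const (2 * d + 3) k)
  | var x => .instr (.bin .or (2 * d + 3) (2 * x.idx) (2 * x.idx))
  | ld A e => .seq (e.code d) (.seq (.instr (.const (2 * d + 5) A.idx))
      (.seq (.instr (.bin .mul (2 * d + 5) (2 * d + 5) 1))
        (.seq (.instr (.bin .add (2 * d + 3) (2 * d + 3) (2 * d + 5)))
          (.instr (.load (2 * d + 3) (2 * d + 3))))))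
  | add a b => .seq (a.code d) (.seq (b.code (d + 1))
      (.instr (.bin .add (2 * d + 3) (2 * d + 3) (2 * d + 5))))
  | mul a b => .seq (a.code d) (.seq (b.code (d + 1))
      (.instr (.bin .mul (2 * d + 3) (2 * d + 3) (2 * d + 5))))

end Ex

/-- The state `c` of the machine represents the state `σ`, all of whose values are below `B`. -/
structure Abs {w : ℕ} (B : ℕ) (c : State w) (σ : St) : Prop where
  v : ∀ x : Var, (c.reg (2 * x.idx)).toNat = σ.v x
  base : (c.reg 1).toNat = B
  a : ∀ (A : Arr) (i : ℕ), i < B → (c.mem (BitVec.ofNat w (A.idx * B + i))).toNat = σ.a A i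
  v_lt : ∀ x, σ.v x < B
  a_lt : ∀ A i, σ.a A i < B

/-- Variables occupy even registers and the length `B` of the arrays is kept in register 1; the odd
registers from 3 on form a stack for evaluating expressions. -/
theorem Abs.update_scratch {w B : ℕ} {c : State w} {σ : St} (h : Abs B c σ) (d : ℕ)
    (b : BitVec w) : Abs B { c with reg := Function.update c.reg (2 * d + 3) b } σ where
  v x := by
    rw [← h.v x]
    simp only
    rw [Function.update_of_ne (by omega)]
  base := by
    rw [← h.base]
    simp only
    rw [Function.update_of_ne (by omega)]
  a := h.a
  v_lt := h.v_lt
  a_lt := h.a_lt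

/-- Sums are as harmless as products, since x + y ≤ xy for x, y ≥ 2. The bound 1 ≤ `size` makes both
powers of `B` at least 2. -/
theorem Ex.val_lt {B : ℕ} (hB : 2 ≤ B) {σ : St} (hv : ∀ x, σ.v x < B) (ha : ∀ A i, σ.a A i < B) :
    ∀ e : Ex, e.val σ < B ^ e.size ∧ 1 ≤ e.size := by
  intro e
  have key : ∀ {X Y a b : ℕ}, X < B ^ a → Y < B ^ b → 1 ≤ a → 1 ≤ b →
      X + Y < B ^ (a + b) ∧ X * Y < B ^ (a + b) := by
    intro X Y a b hX hY h1 h2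
    rw [pow_add]
    have h3 : 2 ≤ B ^ a := hB.trans (Nat.le_self_pow (by omega) B)
    have h4 : 2 ≤ B ^ b := hB.trans (Nat.le_self_pow (by omega) B)
    constructor
    · nlinarith
    · exact Nat.mul_lt_mul'' hX hY
  induction e with
  | lit k =>
    refine ⟨?_, by simp [size]⟩
    exact lt_of_lt_of_le (Nat.lt_pow_self hB) (Nat.pow_le_pow_right (by omega) (by simp [size]))
  | var x => simpa [size, val] using hv x
  | ld A e ih =>
    refine ⟨?_, ih.2⟩
    exact lt_of_lt_of_le (ha _ _) (Nat.le_self_pow (by have := ih.2; simp only [size]; omega) B)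
  | add a b iha ihb =>
    exact ⟨(key iha.1 ihb.1 iha.2 ihb.2).1, by simp only [size]; omega⟩
  | mul a b iha ihb =>
    exact ⟨(key iha.1 ihb.1 iha.2 ihb.2).2, by simp only [size]; omega⟩

/-- Each array is a block of `B` cells, and at most 17 blocks fit into `B ^ 2` cells because 17 ≤
`B`. -/
theorem Arr.address_lt {B w : ℕ} (hB : 17 ≤ B) (hw : B ^ 16 ≤ 2 ^ w) (A : Arr) {i : ℕ}
    (hi : i < B) : A.idx * B + i < 2 ^ w := by
  have h1 := A.idx_lt
  have h2 : B ^ 2 ≤ B ^ 16 := Nat.pow_le_pow_right (by omega) (by omega)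
  nlinarith

/-- All intermediate values are below `B ^ 16`, so arithmetic modulo `2 ^ w` is exact. The last
clause protects the left operand of a binary operation while the right one is evaluated one level
higher on the stack. -/
theorem Ex.exec {B w : ℕ} (hB : 17 ≤ B) (hw : B ^ 16 ≤ 2 ^ w) {σ : St} :
    ∀ (e : Ex) (d : ℕ) (c : State w), Abs B c σ → e.Ok B σ → e.size ≤ 16 →
      ∃ c', Exec (e.code d) c e.cost c' ∧ Abs B c' σ ∧ (c'.reg (2 * d + 3)).toNat = e.val σ ∧
        ∀ j < d, c'.reg (2 * j + 3) = c.reg (2 * j + 3) := by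
  have bound : ∀ (e : Ex) (c : State w), Abs B c σ → e.size ≤ 16 → e.val σ < 2 ^ w := by
    intro e c h hs
    exact ((Ex.val_lt (by omega) h.v_lt h.a_lt e).1.trans_le
      (Nat.pow_le_pow_right (by omega) hs)).trans_le hw
  intro e
  induction e with
  | lit k =>
    intro d c h _ hs
    refine ⟨_, Exec.instr _ _, h.update_scratch d _, ?_, ?_⟩
    · simpa [Instr.exec, val] using Nat.mod_eq_of_lt (bound _ c h hs)
    · intro j hj
      simp only [Instr.exec]
      rw [Function.update_of_ne (by omega)]
  | var x =>
    intro d c h _ hs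
    refine ⟨_, Exec.instr _ _, h.update_scratch d _, ?_, ?_⟩
    · simpa [Instr.exec, val, Op.eval] using h.v x
    · intro j hj
      simp only [Instr.exec]
      rw [Function.update_of_ne (by omega)]
  | ld A e ih =>
    intro d c h hok hs
    obtain ⟨c1, hx, h1, hval, hj⟩ := ih d c h hok.1 hs
    have hlt := Arr.address_lt hB hw A hok.2
    have e1 := h1.update_scratch (d + 1) (BitVec.ofNat w A.idx)
    have e2 := e1.update_scratch (d + 1) (BitVec.ofNat w A.idx * c1.reg 1)
    have e3 := e2.update_scratch d (c1.reg (2 * d + 3) + BitVec.ofNat w A.idx * c1.reg 1)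
    have e4 := e3.update_scratch d
      (c1.mem (c1.reg (2 * d + 3) + BitVec.ofNat w A.idx * c1.reg 1))
    have hadr : c1.reg (2 * d + 3) + BitVec.ofNat w A.idx * c1.reg 1
        = BitVec.ofNat w (A.idx * B + e.val σ) := by
      apply BitVec.eq_of_toNat_eq
      have hb := h1.base
      rw [BitVec.toNat_add, BitVec.toNat_mul, hval, hb]
      simp [Nat.add_comm]
    refine ⟨_, Exec.seq hx (Exec.seq (Exec.instr _ _) (Exec.seq (Exec.instr _ _)
      (Exec.seq (Exec.instr _ _) (Exec.instr _ _)))), ?_, ?_, ?_⟩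
    · have n1 : 2 * (d + 1) + 3 = 2 * d + 5 := by ring
      rw [n1] at e4
      simp only [Instr.exec, Op.eval, Function.update_self]
      have n2 : 2 * d + 3 ≠ 2 * d + 5 := by omega
      have n3 : 1 ≠ 2 * d + 5 := by omega
      simp only [ne_eq, n2, n3, not_false_eq_true, Function.update_of_ne]
      exact e4
    · simp only [Instr.exec, Op.eval, Function.update_self]
      rw [Function.update_of_ne (by omega), Function.update_of_ne (by omega),
        Function.update_of_ne (by omega), hadr, h1.a A _ hok.2]
      rfl
    · intro j hjd
      simp only [Instr.exec]
      rw [Function.update_of_ne (by omega), Function.update_of_ne (by omega),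
        Function.update_of_ne (by omega), Function.update_of_ne (by omega), hj j hjd]
  | add a b iha ihb =>
    intro d c h hok hs
    have hs' : a.size + b.size ≤ 16 := hs
    obtain ⟨c1, hx1, h1, hval1, hj1⟩ := iha d c h hok.1 (by omega)
    obtain ⟨c2, hx2, h2, hval2, hj2⟩ := ihb (d + 1) c1 h1 hok.2 (by omega)
    refine ⟨_, Exec.seq hx1 (Exec.seq hx2 (Exec.instr _ _)), h2.update_scratch d _, ?_, ?_⟩
    · have := bound _ c h hs
      simp only [Instr.exec, Op.eval, Function.update_self, val] at this ⊢
      rw [BitVec.toNat_add, hj2 d (by omega), hval1,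
        show 2 * d + 5 = 2 * (d + 1) + 3 by ring, hval2, Nat.mod_eq_of_lt this]
    · intro j hj
      simp only [Instr.exec]
      rw [Function.update_of_ne (by omega), hj2 j (by omega), hj1 j hj]
  | mul a b iha ihb =>
    intro d c h hok hs
    have hs' : a.size + b.size ≤ 16 := hs
    obtain ⟨c1, hx1, h1, hval1, hj1⟩ := iha d c h hok.1 (by omega)
    obtain ⟨c2, hx2, h2, hval2, hj2⟩ := ihb (d + 1) c1 h1 hok.2 (by omega)
    refine ⟨_, Exec.seq hx1 (Exec.seq hx2 (Exec.instr _ _)), h2.update_scratch d _, ?_, ?_⟩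
    · have := bound _ c h hs
      simp only [Instr.exec, Op.eval, Function.update_self, val] at this ⊢
      rw [BitVec.toNat_mul, hj2 d (by omega), hval1,
        show 2 * d + 5 = 2 * (d + 1) + 3 by ring, hval2, Nat.mod_eq_of_lt this]
    · intro j hj
      simp only [Instr.exec]
      rw [Function.update_of_ne (by omega), hj2 j (by omega), hj1 j hj]

/-- Conditions. -/
inductive Cond
  | lt (a b : Ex)
  | eq (a b : Ex)

namespace Cond

def Holds (σ : St) : Cond → Prop
  | lt a b => a.val σ < b.val σ
  | eq a b => a.val σ = b.val σ

def left : Cond → Ex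
  | lt a _ => a
  | eq a _ => a

def right : Cond → Ex
  | lt _ b => b
  | eq _ b => b

def test : Cond → Test
  | lt _ _ => .lt 3 5
  | eq _ _ => .eq 3 5

/-- The code that puts both sides into the registers `3` and `5`. -/
def code (b : Cond) : Prog := .seq (b.left.code 0) (b.right.code 1)

def cost (b : Cond) : ℕ := b.left.cost + b.right.cost

def Ok (B : ℕ) (σ : St) (b : Cond) : Prop := b.left.Ok B σ ∧ b.right.Ok B σ

def fits (b : Cond) : Bool := decide (b.left.size ≤ 16) && decide (b.right.size ≤ 16)

theorem exec {B w : ℕ} (hB : 17 ≤ B) (hw : B ^ 16 ≤ 2 ^ w) {σ : St} (b : Cond) (c : State w)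
    (h : Abs B c σ) (hok : b.Ok B σ) (hf : b.fits) :
    ∃ c', Exec b.code c b.cost c' ∧ Abs B c' σ ∧ (b.test.Holds c' ↔ b.Holds σ) := by
  simp only [fits, Bool.and_eq_true, decide_eq_true_eq] at hf
  obtain ⟨c1, hx1, h1, hval1, -⟩ := Ex.exec hB hw b.left 0 c h hok.1 hf.1
  obtain ⟨c2, hx2, h2, hval2, hj2⟩ := Ex.exec hB hw b.right 1 c1 h1 hok.2 hf.2
  refine ⟨c2, Exec.seq hx1 hx2, h2, ?_⟩
  have h3 := hj2 0 (by omega)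
  simp only [mul_zero, zero_add, mul_one, Nat.reduceAdd] at h3 hval1 hval2
  cases b with
  | lt a b => simp only [test, Test.Holds, Holds, h3, hval1, hval2, left, right]
  | eq a b =>
    simp only [test, Test.Holds, Holds]
    rw [← BitVec.toNat_inj, h3, hval1, hval2]
    rfl

end Cond

/-- Statements. -/
inductive Stm
  | skip
  | set (x : Var) (e : Ex)
  | put (A : Arr) (i e : Ex)
  | seq (S R : Stm)
  | ite (b : Cond) (S R : Stm)
  | while (b : Cond) (S : Stm)

namespace Stm

def block : List Stm → Stm
  | [] => skip
  | S :: l => seq S (block l)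

/-- `x` runs from `0` to `N - 1`. -/
def forLoop (x N : Var) (S : Stm) : Stm :=
  seq (set x 0) (.while (.lt x N) (seq S (set x (x + 1))))

def code : Stm → Prog
  | skip => .skip
  | set x e => .seq (e.code 0) (.instr (.bin .or (2 * x.idx) 3 3))
  | put A i e => .seq (i.code 0) (.seq (e.code 1) (.seq (.instr (.const 7 A.idx))
      (.seq (.instr (.bin .mul 7 7 1)) (.seq (.instr (.bin .add 3 3 7)) (.instr (.store 3 5))))))
  | seq S R => .seq S.code R.code
  | ite b S R => .seq b.code (.ite b.test S.code R.code)
  | .while b S => .seq b.code (.while b.test (.seq S.code b.code))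

/-- An upper bound for the time of a statement without loops. -/
def cost : Stm → ℕ
  | skip => 1
  | set _ e => e.cost + 1
  | put _ i e => i.cost + e.cost + 4
  | seq S R => S.cost + R.cost
  | ite b S R => b.cost + S.cost + R.cost + 1
  | .while _ _ => 0

/-- All expressions have size at most `16`. -/
def fits : Stm → Bool
  | skip => true
  | set _ e => decide (e.size ≤ 16)
  | put _ i e => decide (i.size ≤ 16) && decide (e.size ≤ 16)
  | seq S R => S.fits && R.fits
  | ite b S R => b.fits && S.fits && R.fits
  | .while b S => b.fits && S.fits

/-- The statement may change the variable `x`. -/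
def writesV (x : Var) : Stm → Bool
  | skip => false
  | set y _ => decide (x = y)
  | put _ _ _ => false
  | seq S R => S.writesV x || R.writesV x
  | ite _ S R => S.writesV x || R.writesV x
  | .while _ S => S.writesV x

/-- The statement may change the array `A`. -/
def writesA (A : Arr) : Stm → Bool
  | skip => false
  | set _ _ => false
  | put A' _ _ => decide (A = A')
  | seq S R => S.writesA A || R.writesA A
  | ite _ S R => S.writesA A || R.writesA A
  | .while _ S => S.writesA A

end Stm

/-- The states differ only in what `S` may change. -/
structure Frame (S : Stm) (σ τ : St) : Prop where
  v : ∀ x, S.writesV x = false → τ.v x = σ.v x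
  a : ∀ A, S.writesA A = false → τ.a A = σ.a A

namespace Frame

theorem refl (S : Stm) (σ : St) : Frame S σ σ := ⟨fun _ _ => rfl, fun _ _ => rfl⟩

theorem trans {S : Stm} {σ τ ρ : St} (h : Frame S σ τ) (h' : Frame S τ ρ) : Frame S σ ρ :=
  ⟨fun x hx => (h'.v x hx).trans (h.v x hx), fun x hx => (h'.a x hx).trans (h.a x hx)⟩

theorem mono {S R : Stm} {σ τ : St} (h : Frame S σ τ)
    (hv : ∀ x, R.writesV x = false → S.writesV x = false)
    (ha : ∀ x, R.writesA x = false → S.writesA x = false) : Frame R σ τ :=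
  ⟨fun x hx => h.v x (hv x hx), fun x hx => h.a x (ha x hx)⟩

end Frame

/-- Timed triples: from a representation of `σ` the code of `S` reaches, in at most `T` steps, a
representation of a state with the property `Post`. -/
def Tri (w B : ℕ) (S : Stm) (σ : St) (T : ℕ) (Post : St → Prop) : Prop :=
  ∀ c : State w, Abs B c σ → ∃ (t : ℕ) (c' : State w) (σ' : St),
    Exec S.code c t c' ∧ t ≤ T ∧ Abs B c' σ' ∧ Frame S σ σ' ∧ Post σ'

namespace Tri

variable {w B : ℕ} {S R : Stm} {σ : St} {T T' : ℕ} {Post Post' : St → Prop}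

theorem mono (h : Tri w B S σ T Post) (hT : T ≤ T')
    (hP : ∀ σ', Frame S σ σ' → Post σ' → Post' σ') : Tri w B S σ T' Post' := by
  intro c hc
  obtain ⟨t, c', σ', h1, h2, h3, h4, h5⟩ := h c hc
  exact ⟨t, c', σ', h1, h2.trans hT, h3, h4, hP σ' h4 h5⟩

theorem skip (h : Post σ) : Tri w B .skip σ 1 Post :=
  fun c hc => ⟨1, c, σ, Exec.skip c, le_rfl, hc, .refl _ _, h⟩

theorem seq (h : Tri w B S σ T Post)
    (h' : ∀ σ', Frame S σ σ' → Post σ' → Tri w B R σ' T' Post') :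
    Tri w B (.seq S R) σ (T + T') Post' := by
  intro c hc
  obtain ⟨t, c1, σ1, hx, ht, ha, hF, hP⟩ := h c hc
  obtain ⟨t', c2, σ2, hx', ht', ha', hF', hP'⟩ := h' σ1 hF hP c1 ha
  refine ⟨t + t', c2, σ2, Exec.seq hx hx', by omega, ha', ?_, hP'⟩
  refine (hF.mono ?_ ?_).trans (hF'.mono ?_ ?_) <;> intro x hx <;>
    simp only [Stm.writesV, Stm.writesA, Bool.or_eq_false_iff] at hx <;> simp [hx]

theorem set (hB : 17 ≤ B) (hw : B ^ 16 ≤ 2 ^ w) {x : Var} {e : Ex} (hf : e.size ≤ 16)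
    (hok : e.Ok B σ) (hs : e.Small B σ) (h : Post (σ.setV x (e.val σ))) :
    Tri w B (.set x e) σ (e.cost + 1) Post := by
  intro c hc
  obtain ⟨c1, hx, h1, hval, -⟩ := Ex.exec hB hw e 0 c hc hok hf
  have hlt : e.val σ < B := by
    cases e with
    | lit k => exact hs
    | var x => exact hc.v_lt _
    | ld A e => exact hc.a_lt _ _
    | add a b => exact hs
    | mul a b => exact hs
  refine ⟨_, _, _, Exec.seq hx (Exec.instr _ _), le_rfl, ?_, ?_, h⟩
  · constructor
    · intro y
      by_cases hy : y = x
      · subst hy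
        simpa [Instr.exec, Op.eval] using hval
      · have : y.idx ≠ x.idx := fun h => hy (Var.idx_injective h)
        simp only [Instr.exec, St.setV_v, hy, if_false]
        rw [Function.update_of_ne (by omega), h1.v]
    · simp only [Instr.exec]
      rw [Function.update_of_ne (by omega), h1.base]
    · exact h1.a
    · intro y
      rw [St.setV_v]
      split
      · exact hlt
      · exact h1.v_lt y
    · exact h1.a_lt
  · constructor
    · intro y hy
      simp only [Stm.writesV, decide_eq_false_iff_not] at hy
      simp [hy]
    · intro A _
      rfl

theorem put (hB : 17 ≤ B) (hw : B ^ 16 ≤ 2 ^ w) {A : Arr} {i e : Ex} (hf : i.size ≤ 16)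
    (hf' : e.size ≤ 16) (hok : i.Ok B σ) (hi : i.val σ < B)
    (hok' : e.Ok B σ) (hs : e.Small B σ) (h : Post (σ.setA A (i.val σ) (e.val σ))) :
    Tri w B (.put A i e) σ (i.cost + e.cost + 4) Post := by
  intro c hc
  obtain ⟨c1, hx1, h1, hval1, -⟩ := Ex.exec hB hw i 0 c hc hok hf
  obtain ⟨c2, hx2, h2, hval2, hj⟩ := Ex.exec hB hw e 1 c1 h1 hok' hf'
  have hlt : e.val σ < B := by
    cases e with
    | lit k => exact hs
    | var x => exact hc.v_lt _
    | ld A e => exact hc.a_lt _ _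
    | add a b => exact hs
    | mul a b => exact hs
  have h3 := hj 0 (by omega)
  simp only [mul_zero, zero_add, mul_one, Nat.reduceAdd] at h3 hval1 hval2
  rw [← h3] at hval1
  have hadr : c2.reg 3 + BitVec.ofNat w A.idx * c2.reg 1
      = BitVec.ofNat w (A.idx * B + i.val σ) := by
    apply BitVec.eq_of_toNat_eq
    rw [BitVec.toNat_add, BitVec.toNat_mul, hval1, h2.base]
    simp [Nat.add_comm]
  have e1 := h2.update_scratch 2 (BitVec.ofNat w A.idx)
  have e2 := e1.update_scratch 2 (BitVec.ofNat w A.idx * c2.reg 1)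
  have e3 := e2.update_scratch 0 (c2.reg 3 + BitVec.ofNat w A.idx * c2.reg 1)
  refine ⟨_, _, _, Exec.seq hx1 (Exec.seq hx2 (Exec.seq (Exec.instr _ _) (Exec.seq (Exec.instr _ _)
    (Exec.seq (Exec.instr _ _) (Exec.instr _ _))))), by omega, ?_, ?_, h⟩
  · simp only [Instr.exec, Op.eval, Function.update_self]
    simp only [mul_zero, zero_add, Nat.reduceAdd, Nat.reduceMul] at e3
    simp only [ne_eq, not_false_eq_true, Function.update_of_ne,
      Nat.reduceEqDiff, OfNat.one_ne_ofNat, hadr] at e3 ⊢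
    constructor
    · exact e3.v
    · exact e3.base
    · intro A' j hjB
      -- Division by `B` recovers the array from an address, so a write touches no other represented
      -- cell.
      have hne : A'.idx * B + j = A.idx * B + i.val σ ↔ A' = A ∧ j = i.val σ := by
        constructor
        · intro h
          have h5 : A'.idx = A.idx := by
            have := congrArg (· / B) h
            simpa [Nat.add_div_of_dvd_right, Nat.mul_add_div, mul_comm _ B,
              show 0 < B by omega, Nat.div_eq_of_lt hjB, Nat.div_eq_of_lt hi] using this
          refine ⟨Arr.idx_injective h5, ?_⟩
          rw [h5] at h
          omega
        · rintro ⟨rfl, rfl⟩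
          rfl
      by_cases h6 : A' = A ∧ j = i.val σ
      · obtain ⟨rfl, rfl⟩ := h6
        simp [hval2]
      · simp only
        rw [Function.update_of_ne, h2.a A' j hjB]
        · rw [St.setA_a]
          split_ifs with h7
          · subst h7
            rw [Function.update_of_ne]
            tauto
          · rfl
        · intro h7
          have := congrArg BitVec.toNat h7
          rw [BitVec.toNat_ofNat, BitVec.toNat_ofNat,
            Nat.mod_eq_of_lt (Arr.address_lt hB hw A' hjB),
            Nat.mod_eq_of_lt (Arr.address_lt hB hw A hi)] at this
          exact h6 (hne.1 this)
    · exact h2.v_lt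
    · intro A' j
      rw [St.setA_a]
      split_ifs with h7
      · rw [Function.update_apply]
        split_ifs
        · exact hlt
        · exact h2.a_lt _ _
      · exact h2.a_lt _ _
  · constructor
    · intro y hy
      rfl
    · intro A' hA'
      simp only [Stm.writesA, decide_eq_false_iff_not] at hA'
      simp [hA']

theorem ite (hB : 17 ≤ B) (hw : B ^ 16 ≤ 2 ^ w) {b : Cond} (hf : b.fits) (hok : b.Ok B σ)
    (h : b.Holds σ → Tri w B S σ T Post) (h' : ¬ b.Holds σ → Tri w B R σ T' Post) :
    Tri w B (.ite b S R) σ (b.cost + T + T' + 1) Post := by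
  intro c hc
  obtain ⟨c1, hx, h1, htest⟩ := Cond.exec hB hw b c hc hok hf
  by_cases hb : b.Holds σ
  · obtain ⟨t, c2, σ2, hx', ht, ha, hF, hP⟩ := h hb c1 h1
    refine ⟨_, c2, σ2, Exec.seq hx (Exec.ite_true (htest.2 hb) hx'), by omega, ha, ?_, hP⟩
    refine hF.mono ?_ ?_ <;> intro x hx <;>
      simp only [Stm.writesV, Stm.writesA, Bool.or_eq_false_iff] at hx <;> simp [hx]
  · obtain ⟨t, c2, σ2, hx', ht, ha, hF, hP⟩ := h' hb c1 h1
    refine ⟨_, c2, σ2, Exec.seq hx (Exec.ite_false (mt htest.1 hb) hx'), by omega, ha, ?_, hP⟩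
    refine hF.mono ?_ ?_ <;> intro x hx <;>
      simp only [Stm.writesV, Stm.writesA, Bool.or_eq_false_iff] at hx <;> simp [hx]

/-- Loops with an invariant and a variant. -/
theorem while_variant (hB : 17 ≤ B) (hw : B ^ 16 ≤ 2 ^ w) {b : Cond} (hf : b.fits)
    (Inv : St → Prop) (Φ : St → ℕ) (hok : ∀ σ', Inv σ' → b.Ok B σ')
    (hS : ∀ σ', Frame (.while b S) σ σ' → Inv σ' → b.Holds σ' →
      Tri w B S σ' T (fun τ => Inv τ ∧ Φ τ < Φ σ')) (h0 : Inv σ) :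
    Tri w B (.while b S) σ (Φ σ * (T + b.cost + 1) + b.cost + 1)
      (fun τ => Inv τ ∧ ¬ b.Holds τ) := by
  -- The compiled loop evaluates its condition once before the loop and again at the end of every
  -- round. The induction therefore concerns the inner machine loop, entered when the test registers
  -- already agree with the condition.
  suffices H : ∀ (N : ℕ) (σ' : St), Φ σ' = N → Frame (.while b S) σ σ' → Inv σ' →
      ∀ c : State w, Abs B c σ' → (b.test.Holds c ↔ b.Holds σ') →
      ∃ (t : ℕ) (c' : State w) (τ : St), Exec (.while b.test (.seq S.code b.code)) c t c' ∧
        t ≤ N * (T + b.cost + 1) + 1 ∧ Abs B c' τ ∧ Frame (.while b S) σ τ ∧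
          (Inv τ ∧ ¬ b.Holds τ) by
    intro c hc
    obtain ⟨c1, hx, h1, htest⟩ := Cond.exec hB hw b c hc (hok σ h0) hf
    obtain ⟨t, c2, τ, h2, h3, h4, h5, h6⟩ := H _ σ rfl (.refl _ _) h0 c1 h1 htest
    exact ⟨_, c2, τ, Exec.seq hx h2, by omega, h4, h5, h6⟩
  intro N
  induction N using Nat.strong_induction_on with
  | _ N ih =>
    intro σ' hN hF hI c hc htest
    by_cases hb : b.Holds σ'
    · obtain ⟨t1, c1, σ1, hx1, ht1, ha1, hF1, hI1, hΦ⟩ := hS σ' hF hI hb c hc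
      obtain ⟨c2, hx2, ha2, htest2⟩ := Cond.exec hB hw b c1 ha1 (hok σ1 hI1) hf
      rw [hN] at hΦ
      obtain ⟨t3, c3, τ, hx3, ht3, ha3, hF3, hP⟩ := ih _ hΦ σ1 rfl
        (hF.trans (hF1.mono (fun _ h => h) (fun _ h => h))) hI1 c2 ha2 htest2
      refine ⟨_, c3, τ, Exec.while_true (htest.2 hb) (Exec.seq hx1 hx2) hx3, ?_, ha3, hF3, hP⟩
      have : (Φ σ1 + 1) * (T + b.cost + 1) ≤ N * (T + b.cost + 1) := Nat.mul_le_mul_right _ hΦ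
      rw [add_mul] at this
      omega
    · exact ⟨1, c, σ', Exec.while_false (mt htest.1 hb), by omega, hc, hF, hI, hb⟩

/-- Counting loops. -/
theorem forLoop (hB : 17 ≤ B) (hw : B ^ 16 ≤ 2 ^ w) {x N : Var} (hxN : N ≠ x)
    (hxS : S.writesV x = false) (hNS : S.writesV N = false) (Inv : ℕ → St → Prop)
    (h0 : Inv 0 (σ.setV x 0))
    (hS : ∀ σ', Frame (.forLoop x N S) σ σ' → σ'.v x < σ.v N → Inv (σ'.v x) σ' →
      Tri w B S σ' T (fun τ => Inv (σ'.v x + 1) (τ.setV x (σ'.v x + 1)))) :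
    Tri w B (.forLoop x N S) σ (σ.v N * (T + 10) + 10) (fun τ => Inv (σ.v N) τ) := by
  intro c hc
  have hNB := hc.v_lt N
  revert c
  change Tri w B _ _ _ _
  have hNfor : (Stm.forLoop x N S).writesV N = false := by
    simp [Stm.forLoop, Stm.writesV, hNS, hxN]
  have := @seq w B (.set x 0) (.while (.lt x N) (.seq S (.set x (x + 1)))) σ 2
    (σ.v N * (T + 4 + 2 + 1) + 2 + 1) (fun τ => τ = σ.setV x 0) (fun τ => Inv (σ.v N) τ)
    (set hB hw (Nat.le_of_ble_eq_true rfl) trivial (show 0 < B by omega) rfl) ?_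
  · refine this.mono ?_ (fun _ _ h => h)
    have : σ.v N * (T + 4 + 2 + 1) ≤ σ.v N * (T + 10) := Nat.mul_le_mul_left _ (by omega)
    omega
  · rintro σ1 hF1 rfl
    have hw := @while_variant w B (.seq S (.set x (x + 1))) (σ.setV x 0) (T + 4) hB hw
      (.lt x N) rfl (fun τ => τ.v N = σ.v N ∧ τ.v x ≤ σ.v N ∧ Inv (τ.v x) τ)
      (fun τ => σ.v N - τ.v x) (fun _ _ => ⟨trivial, trivial⟩) ?_ ?_
    · simp only [St.setV_v, if_true] at hw
      refine hw.mono le_rfl ?_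
      rintro τ - ⟨⟨h1, h2, h3⟩, h4⟩
      have : τ.v x = σ.v N := by
        simp only [Cond.Holds, Ex.val_var] at h4
        omega
      rwa [this] at h3
    · rintro σ2 hF2 ⟨h1, h2, h3⟩ h4
      simp only [Cond.Holds, Ex.val_var, h1] at h4
      have hF : Frame (.forLoop x N S) σ σ2 := by
        refine (hF1.mono ?_ ?_).trans (hF2.mono ?_ ?_) <;> intro y hy <;>
          simp only [Stm.forLoop, Stm.writesV, Stm.writesA, Bool.or_eq_false_iff,
            Bool.false_or] at hy ⊢ <;> simp [hy]
      refine seq (hS σ2 hF h4 h3) ?_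
      intro σ3 hF3 h5
      have hx3 : σ3.v x = σ2.v x := hF3.v x hxS
      refine set hB hw (Nat.le_of_ble_eq_true rfl) ⟨trivial, trivial⟩
        (show σ3.v x + 1 < B by omega) ?_
      have hN3 : σ3.v N = σ.v N := (hF3.v N hNS).trans h1
      simp only [Ex.val_add, Ex.val_var, Ex.val_ofNat, St.setV_v, if_true, hxN, if_false, hN3, hx3]
      exact ⟨⟨trivial, by omega, h5⟩, by omega⟩
    · simp [hxN, h0]

theorem seq_le {T'' : ℕ} (T T' : ℕ) (Post : St → Prop) (hT : T + T' ≤ T'')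
    (h : Tri w B S σ T Post)
    (h' : ∀ σ', Frame S σ σ' → Post σ' → Tri w B R σ' T' Post') :
    Tri w B (.seq S R) σ T'' Post' :=
  (seq h h').mono hT (fun _ _ h => h)

theorem forLoop_le (hB : 17 ≤ B) (hw : B ^ 16 ≤ 2 ^ w) {x N : Var} (K T : ℕ)
    (Inv : ℕ → St → Prop) (hN : σ.v N = K) (hT : K * (T + 10) + 10 ≤ T')
    (hxN : N ≠ x) (hxS : S.writesV x = false) (hNS : S.writesV N = false)
    (h0 : Inv 0 (σ.setV x 0))
    (hS : ∀ σ' j, Frame (.forLoop x N S) σ σ' → σ'.v x = j → j < K → Inv j σ' →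
      Tri w B S σ' T (fun τ => Inv (j + 1) (τ.setV x (j + 1))))
    (h : ∀ τ, Frame (.forLoop x N S) σ τ → Inv K τ → Post τ) :
    Tri w B (.forLoop x N S) σ T' Post := by
  subst hN
  exact (forLoop hB hw hxN hxS hNS Inv h0 (fun σ' hF hj hI => hS σ' _ hF rfl hj hI)).mono hT h

end Tri

/-- The weakest precondition of a statement without loops. -/
def Stm.wp (B : ℕ) : Stm → St → (St → Prop) → Prop
  | skip, σ, Post => Post σ
  | set x e, σ, Post => e.Ok B σ ∧ e.Small B σ ∧ Post (σ.setV x (e.val σ))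
  | put A i e, σ, Post => i.Ok B σ ∧ i.val σ < B ∧ e.Ok B σ ∧ e.Small B σ ∧
      Post (σ.setA A (i.val σ) (e.val σ))
  | seq S R, σ, Post => S.wp B σ (fun τ => R.wp B τ Post)
  | ite b S R, σ, Post => b.Ok B σ ∧ (b.Holds σ → S.wp B σ Post) ∧ (¬ b.Holds σ → R.wp B σ Post)
  | .while _ _, _, _ => False

/-- For loop-free code the time bound is a closed numeral comparison, and correctness becomes a
proposition that `simp` can unfold. -/
theorem Tri.of_wp {w B : ℕ} (hB : 17 ≤ B) (hw : B ^ 16 ≤ 2 ^ w) :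
    ∀ {S : Stm} {σ : St} {T : ℕ} {Post : St → Prop}, S.fits → S.cost ≤ T → S.wp B σ Post →
      Tri w B S σ T Post := by
  intro S
  induction S with
  | skip => exact fun _ hT h => (Tri.skip h).mono hT (fun _ _ h => h)
  | set x e =>
    intro σ T Post hf hT h
    simp only [Stm.fits, decide_eq_true_eq] at hf
    exact (Tri.set hB hw hf h.1 h.2.1 h.2.2).mono hT (fun _ _ h => h)
  | put A i e =>
    intro σ T Post hf hT h
    simp only [Stm.fits, Bool.and_eq_true, decide_eq_true_eq] at hf
    obtain ⟨h1, h2, h3, h4, h5⟩ := h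
    exact (Tri.put hB hw hf.1 hf.2 h1 h2 h3 h4 h5).mono hT (fun _ _ h => h)
  | seq S R ihS ihR =>
    intro σ T Post hf hT h
    simp only [Stm.fits, Bool.and_eq_true] at hf
    exact (Tri.seq (ihS hf.1 le_rfl h) (fun σ' _ h' => ihR hf.2 le_rfl h')).mono hT
      (fun _ _ h => h)
  | ite b S R ihS ihR =>
    intro σ T Post hf hT h
    simp only [Stm.fits, Bool.and_eq_true] at hf
    exact (Tri.ite hB hw hf.1.1 h.1 (fun hb => ihS hf.1.2 le_rfl (h.2.1 hb))
      (fun hb => ihR hf.2 le_rfl (h.2.2 hb))).mono hT (fun _ _ h => h)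
  | _ => exact fun _ _ h => h.elim

/- ## The programs -/

section Programs
open Stm Var Arr

/-- Copy the input into arrays. -/
def loadEdges : Stm :=
  forLoop e m (block [
    put src e (.ld io (4 + 3 * e)),
    put dst e (.ld io (5 + 3 * e)),
    put lab e (.ld io (6 + 3 * e)),
    put lam (.ld dst e) (.ld lab e + 1)])

def load : Stm :=
  seq (block [set n (.ld io 0), set m (.ld io 1), set out (4 + 3 * m + n)]) loadEdges

/-- List the arrows between pairs of states. -/
def arrows : Stm :=
  forLoop e m (forLoop f m
    (ite (.eq (.ld lam (.ld dst e)) (.ld lam (.ld dst f)))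
      (block [set k (k + 1),
        put node k (.ld src e * n + .ld src f),
        put tgt k (.ld dst e * n + .ld dst f)])
      skip))

/-- Make linked lists of the arrows that leave the same node. -/
def link : Stm :=
  forLoop i k (block [
    put prev (i + 1) (.ld head (.ld node (i + 1))),
    put head (.ld node (i + 1)) (i + 1)])

/-- Mark a node and put it into the queue. -/
def push (a : Ex) : Stm :=
  block [put mark a 1, put queue ql a, set ql (ql + 1)]

/-- Mark the nodes from which the search starts. -/
def seed : Stm :=
  forLoop u n (forLoop v n
    (ite (.lt (.ld lam v) (.ld lam u)) (push (u * n + v))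
      (ite (.eq u v) (push (u * n + v)) skip)))

/-- Search of the graph. -/
def search : Stm :=
  .while (.lt qi ql) (block [
    set x (.ld queue qi),
    set h (.ld head x),
    ite (.eq h 0) (set qi (qi + 1))
      (block [
        put head x (.ld prev h),
        set y (.ld tgt h),
        ite (.eq (.ld mark y) 0) (push y) skip])])

/-- Count the predecessors of every state. -/
def count : Stm :=
  forLoop v n (seq (put cnt v 0)
    (forLoop u n (ite (.eq (.ld mark (u * n + v)) 0) (put cnt v (.ld cnt v + 1)) skip)))

/-- Sort the states by the number of predecessors. -/
def sort : Stm :=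
  seq (set k 0) (forLoop d n (forLoop v n
    (ite (.eq (.ld cnt v) d) (block [put ord k v, set k (k + 1)]) skip)))

/-- Distribute the states to chains. -/
def greedy : Stm :=
  forLoop i n (seq (block [set v (.ld ord i), set r p])
    (seq (forLoop c p (ite (.eq (.ld mark (.ld top c * n + v)) 0) (set r c) skip))
      (block [put chain v r, put top r v, ite (.eq r p) (set p (p + 1)) skip])))

/-- Append a value to the output. -/
def emit (a : Ex) : Stm := block [put io o a, set o (o + 1)]

/-- Output the order and the chains. -/
def emitOrder : Stm :=
  seq (set o out) (seq
    (forLoop u n (forLoop v n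
      (ite (.eq u v) (emit 1) (ite (.eq (.ld mark (u * n + v)) 0) (emit 1) (emit 0)))))
    (seq (emit p) (forLoop v n (emit (.ld chain v)))))

/-- List the states by chain. -/
def listStates : Stm :=
  seq (set k 0) (forLoop c p (forLoop i n
    (ite (.eq (.ld chain (.ld ord i)) c) (block [put lst k (.ld ord i), set k (k + 1)]) skip)))

/-- For every state output its list of edges: those with the state as their entry in `A`. -/
def emitLists (A : Arr) (a : Stm) : Stm :=
  forLoop i n (seq (block [set v (.ld lst i), set k 0])
    (seq (forLoop e m (ite (.eq (.ld A e) v) (set k (k + 1)) skip))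
      (seq (emit k) (forLoop e m (ite (.eq (.ld A e) v) a skip)))))

/-- Output the Burrows-Wheeler transform. -/
def emitIndex : Stm :=
  seq (set o out) (seq (emit p)
    (seq (emitLists src (seq (emit (.ld chain (.ld dst e))) (emit (.ld lab e))))
      (seq (emitLists dst (emit (.ld chain (.ld src e))))
        (forLoop i n (emit (.ld io (4 + 3 * m + .ld lst i)))))))

/-- Compute the maximal order and a smallest chain decomposition. -/
def solve : Stm :=
  seq load (seq arrows (seq link (seq seed (seq search (seq count (seq sort greedy))))))

end Programs

/- ## Correctness of the phases -/

attribute [simp] Stm.block Stm.wp Cond.Ok Cond.Holds Cond.left Cond.right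

/-- The numbers in the input. -/
structure Input where
  n : ℕ
  m : ℕ
  src : ℕ → ℕ
  dst : ℕ → ℕ
  lab : ℕ → ℕ
  lam : ℕ → ℕ
  fin : ℕ → ℕ
  n_pos : 0 < n
  src_lt : ∀ e < m, src e < n
  dst_lt : ∀ e < m, dst e < n
  lab_lt : ∀ e < m, lab e < m
  lam_dst : ∀ e < m, lam (dst e) = lab e + 1
  lam_eq_zero : ∀ v < n, (∀ e < m, dst e ≠ v) → lam v = 0

namespace Input

variable (G : Input)

/-- This number serves as the length of every array and as the bound on all stored values. It
exceeds the number of pairs of states, the number of pairs of edges and the end of either output,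
and it is a square so that a few instructions can compute it. -/
def size : ℕ := (2 * (G.n + G.m + 4)) ^ 2

theorem size_eq : G.size =
    4 * (G.n * G.n) + 8 * (G.n * G.m) + 4 * (G.m * G.m) + 32 * G.n + 32 * G.m + 64 := by
  unfold size; ring

theorem le_size : 17 ≤ G.size := by
  have := G.size_eq
  have := G.n_pos
  omega

theorem pair_lt {u v n : ℕ} (hu : u < n) (hv : v < n) : u * n + v < n * n := by
  have : (u + 1) * n ≤ n * n := Nat.mul_le_mul_right _ hu
  rw [add_mul] at this
  omega

theorem pair_inj {u v u' v' n : ℕ} (hv : v < n) (hv' : v' < n)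
    (h : u * n + v = u' * n + v') : u = u' ∧ v = v' := by
  have hn : 0 < n := by omega
  have h1 := congrArg (· / n) h
  have h2 : u = u' := by
    simpa [mul_comm _ n, Nat.mul_add_div hn, Nat.div_eq_of_lt hv, Nat.div_eq_of_lt hv'] using h1
  subst h2
  omega

/-- The state after the input has been read. -/
structure Loaded (σ : St) : Prop where
  n : σ.v .n = G.n
  m : σ.v .m = G.m
  out : σ.v .out = 4 + 3 * G.m + G.n
  src : ∀ e < G.m, σ.a .src e = G.src e
  dst : ∀ e < G.m, σ.a .dst e = G.dst e
  lab : ∀ e < G.m, σ.a .lab e = G.lab e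
  lam : ∀ v < G.n, σ.a .lam v = G.lam v
  fin : ∀ v < G.n, σ.a .io (4 + 3 * G.m + v) = G.fin v

/-- The initial state. -/
structure Start (σ : St) : Prop where
  n : σ.a .io 0 = G.n
  m : σ.a .io 1 = G.m
  src : ∀ e < G.m, σ.a .io (4 + 3 * e) = G.src e
  dst : ∀ e < G.m, σ.a .io (5 + 3 * e) = G.dst e
  lab : ∀ e < G.m, σ.a .io (6 + 3 * e) = G.lab e
  fin : ∀ v < G.n, σ.a .io (4 + 3 * G.m + v) = G.fin v
  v : ∀ x, σ.v x = 0
  a : ∀ A, A ≠ .io → ∀ i, σ.a A i = 0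

variable {G} {w : ℕ} {σ : St}

theorem tri_loadEdges (hw : G.size ^ 16 ≤ 2 ^ w) (hσ : G.Start σ) {τ : St} (ha : τ.a = σ.a)
    (hn : τ.v .n = G.n) (hm : τ.v .m = G.m) (ho : τ.v .out = 4 + 3 * G.m + G.n) :
    Tri w G.size loadEdges τ (G.m * 210 + 10) G.Loaded := by
  have hB := G.le_size
  have hs := G.size_eq
  have h1 : G.m ≤ G.n * G.m := Nat.le_mul_of_pos_left _ G.n_pos
  have h2 : G.n ≤ G.n * G.n := Nat.le_mul_of_pos_left _ G.n_pos
  -- By the last clause, a state that no edge reaches keeps the initial entry 0 in `lam`. This is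
  -- the code of the smallest label, since characters are stored as their rank plus one.
  refine Tri.forLoop_le hB hw G.m 200 (fun j τ =>
    (∀ e < j, τ.a .src e = G.src e) ∧ (∀ e < j, τ.a .dst e = G.dst e) ∧
    (∀ e < j, τ.a .lab e = G.lab e) ∧ (∀ e < j, τ.a .lam (G.dst e) = G.lam (G.dst e)) ∧
    ∀ v, (∀ e < j, G.dst e ≠ v) → τ.a .lam v = 0) hm (by omega) (by decide) rfl rfl ?_ ?_ ?_
  · simp [ha, hσ.a]
  · rintro ρ j hF hj hjm ⟨hsrc, hdst, hlab, hlam, hlam0⟩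
    have hio : ρ.a .io = σ.a .io := (hF.a .io rfl).trans (by rw [ha])
    refine Tri.of_wp hB hw rfl (by decide) ?_
    have := G.dst_lt j hjm
    have := G.lab_lt j hjm
    simp [hio, hj, hσ.src j hjm, hσ.dst j hjm, hσ.lab j hjm, Function.update_apply]
    have := G.lam_dst j hjm
    refine ⟨?_, ?_, ?_, ?_, ?_, ?_, ?_, ?_, ?_, ?_, ?_⟩ <;> first | omega | grind
  · rintro ρ hF ⟨hsrc, hdst, hlab, hlam, hlam0⟩
    have hio : ρ.a .io = σ.a .io := (hF.a .io rfl).trans (by rw [ha])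
    refine ⟨(hF.v _ rfl).trans hn, (hF.v _ rfl).trans hm, (hF.v _ rfl).trans ho, hsrc, hdst, hlab,
      fun v hv => ?_, fun v hv => by rw [hio, hσ.fin v hv]⟩
    by_cases h : ∀ e < G.m, G.dst e ≠ v
    · rw [hlam0 v h, G.lam_eq_zero v hv h]
    · push Not at h
      obtain ⟨e, he, rfl⟩ := h
      exact hlam e he

theorem tri_load (hw : G.size ^ 16 ≤ 2 ^ w) (hσ : G.Start σ) :
    Tri w G.size load σ (300 * (G.m + 1)) G.Loaded := by
  have hB := G.le_size
  have hs := G.size_eq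
  refine Tri.seq_le 150 (G.m * 210 + 10) (fun τ => τ.a = σ.a ∧ τ.v .n = G.n ∧ τ.v .m = G.m ∧
    τ.v .out = 4 + 3 * G.m + G.n) (by omega) (Tri.of_wp hB hw rfl (by decide) ?_) ?_
  · simp [hσ.n, hσ.m]
    omega
  · rintro τ - ⟨ha, hn, hm, ho⟩
    exact tri_loadEdges hw hσ ha hn hm ho

end Input
end CoLex

/-! ### Arrows between pairs of states and their adjacency lists -/

namespace CoLex
namespace Input

variable {G : Input} {w : ℕ} {σ : St}

theorem Loaded.of_frame {S : Stm} {τ : St} (h : G.Loaded σ) (hF : Frame S σ τ)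
    (hv : ∀ x ∈ [Var.n, .m, .out], S.writesV x = false)
    (ha : ∀ A ∈ [Arr.src, .dst, .lab, .lam, .io], S.writesA A = false) : G.Loaded τ := by
  simp only [List.forall_mem_cons, List.not_mem_nil, IsEmpty.forall_iff, implies_true,
    and_true] at hv ha
  obtain ⟨h1, h2, h3⟩ := hv
  obtain ⟨h4, h5, h6, h7, h8⟩ := ha
  constructor
  · rw [hF.v _ h1, h.n]
  · rw [hF.v _ h2, h.m]
  · rw [hF.v _ h3, h.out]
  · rw [hF.a _ h4]; exact h.src
  · rw [hF.a _ h5]; exact h.dst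
  · rw [hF.a _ h6]; exact h.lab
  · rw [hF.a _ h7]; exact h.lam
  · rw [hF.a _ h8]; exact h.fin

/-- The first `σ.v .k` arrows are those from the pairs of edges in `P`. -/
structure ArrowsOf (G : Input) (P : ℕ → ℕ → Prop) (σ : St) : Prop where
  sound : ∀ a, 0 < a → a ≤ σ.v .k → ∃ e < G.m, ∃ f < G.m, G.lam (G.dst e) = G.lam (G.dst f) ∧
    σ.a .node a = G.src e * G.n + G.src f ∧ σ.a .tgt a = G.dst e * G.n + G.dst f
  complete : ∀ e < G.m, ∀ f < G.m, P e f → G.lam (G.dst e) = G.lam (G.dst f) →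
    ∃ a, 0 < a ∧ a ≤ σ.v .k ∧
      σ.a .node a = G.src e * G.n + G.src f ∧ σ.a .tgt a = G.dst e * G.n + G.dst f

theorem ArrowsOf.congr {P P' : ℕ → ℕ → Prop} {τ : St} (h : G.ArrowsOf P σ)
    (hP : ∀ e < G.m, ∀ f < G.m, P' e f → P e f) (hk : τ.v .k = σ.v .k)
    (hn : τ.a .node = σ.a .node)
    (ht : τ.a .tgt = σ.a .tgt) : G.ArrowsOf P' τ := by
  constructor
  · rw [hk, hn, ht]; exact h.sound
  · rw [hk, hn, ht]; exact fun e he f hf hp => h.complete e he f hf (hP e he f hf hp)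

/-- The graph to be searched has the pairs of states, coded as u * n + v, as its nodes. Arrows are
numbered from 1, which leaves 0 free to mark the end of a list. -/
theorem tri_arrows (hw : G.size ^ 16 ≤ 2 ^ w) (hσ : G.Loaded σ) (hk : σ.v .k = 0) :
    Tri w G.size arrows σ (G.m * (G.m * 210 + 20) + 10)
      (fun τ => G.ArrowsOf (fun _ _ => True) τ ∧ τ.v .k ≤ G.m * G.m) := by
  have hB := G.le_size
  have hs := G.size_eq
  have h1 : G.m ≤ G.n * G.m := Nat.le_mul_of_pos_left _ G.n_pos
  have h2 : G.n ≤ G.n * G.n := Nat.le_mul_of_pos_left _ G.n_pos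
  refine Tri.forLoop_le hB hw G.m (G.m * 210 + 10) (fun j τ =>
    G.ArrowsOf (fun e _ => e < j) τ ∧ τ.v .k ≤ j * G.m) hσ.m (by rw [add_assoc])
    (by decide) rfl rfl ?_ ?_ ?_
  · refine ⟨⟨?_, ?_⟩, ?_⟩ <;> simp [hk]; omega
  · rintro ρ j hF hj hjm ⟨hA, hkj⟩
    have hL := hσ.of_frame hF (by decide) (by decide)
    refine Tri.forLoop_le hB hw G.m 200 (fun i τ =>
      G.ArrowsOf (fun e f => e < j ∨ e = j ∧ f < i) τ ∧ τ.v .k ≤ j * G.m + i) hL.m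
      (by omega) (by decide) rfl rfl ?_ ?_ ?_
    · refine ⟨hA.congr ?_ rfl rfl rfl, ?_⟩
      · simp
      · simpa using hkj
    · rintro ρ' i hF' hi him ⟨hA', hki⟩
      have hL' := hL.of_frame hF' (by decide) (by decide)
      have hj' : ρ'.v .e = j := (hF'.v _ rfl).trans hj
      refine Tri.of_wp hB hw rfl (by decide) ?_
      have d1 := G.dst_lt j hjm
      have d2 := G.dst_lt i him
      have s1 := G.src_lt j hjm
      have s2 := G.src_lt i him
      have p1 := pair_lt d1 d2
      have p2 := pair_lt s1 s2
      have p3 : (j + 1) * G.m ≤ G.m * G.m := Nat.mul_le_mul_right _ hjm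
      rw [add_mul] at p3
      simp [hL'.n, hL'.src, hL'.dst, hL'.lam, hj', hi, hjm, him, d1, d2]
      refine ⟨by omega, ?_, ?_⟩
      · intro he
        and_intros
        all_goals try omega
        constructor
        · intro a ha hak
          simp at hak
          rcases Nat.lt_or_ge (ρ'.v .k) a with h | h
          · obtain rfl : a = ρ'.v .k + 1 := by omega
            exact ⟨j, hjm, i, him, by simp [he]⟩
          · obtain ⟨e, he, f, hf, h1, h2, h3⟩ := hA'.sound a ha h
            exact ⟨e, he, f, hf, h1, by simp [Function.update_apply, h2, h3]; omega⟩
        · intro e he' f hf hp hl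
          by_cases hef : e = j ∧ f = i
          · obtain ⟨rfl, rfl⟩ := hef
            exact ⟨ρ'.v .k + 1, by simp⟩
          · obtain ⟨a, ha, hak, h1, h2⟩ := hA'.complete e he' f hf (by omega) hl
            exact ⟨a, ha, by simp; omega, by simp [Function.update_apply, h1, h2]; omega⟩
      · intro he
        refine ⟨⟨?_, ?_⟩, by omega⟩
        · exact hA'.sound
        · intro e he' f hf hp hl
          refine hA'.complete e he' f hf ?_ hl
          by_contra h
          obtain ⟨rfl, rfl⟩ : e = j ∧ f = i := by omega
          exact he hl
    · rintro τ hF' ⟨hA', hki⟩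
      refine ⟨hA'.congr ?_ ?_ rfl rfl, ?_⟩
      · intro e _ f hf he; omega
      · simp
      · simp [add_mul]; omega
  · rintro τ hF ⟨hA, hk⟩
    exact ⟨hA.congr (fun e he _ _ _ => he) rfl rfl rfl, hk⟩

/-- `head` and `prev` are linked lists, in decreasing order, of the arrows up to `K` that leave the
same node. -/
structure Lists (K : ℕ) (node prev : ℕ → ℕ) : Prop where
  prev_lt : ∀ a, 0 < a → a ≤ K → prev a < a
  prev_node : ∀ a, 0 < a → a ≤ K → prev a ≠ 0 → node (prev a) = node a
  prev_max : ∀ a, 0 < a → a ≤ K → ∀ b, prev a < b → b < a → node b ≠ node a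

/-- Lists are decreasing, so `a ≤ head (node a)` expresses that the arrow `a` is still in the list
of its source. The last two clauses say that at first every arrow is present and that every list
starts with an arrow of its own node. -/
theorem tri_link (hw : G.size ^ 16 ≤ 2 ^ w) (K : ℕ) (hk : σ.v .k = K) (hK : K ≤ G.m * G.m)
    (hnode : ∀ a, 0 < a → a ≤ K → σ.a .node a < G.n * G.n) (h0 : ∀ x, σ.a .head x = 0) :
    Tri w G.size link σ (K * 210 + 10)
      (fun τ => Lists K (σ.a .node) (τ.a .prev) ∧
        (∀ a, 0 < a → a ≤ K → a ≤ τ.a .head (σ.a .node a)) ∧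
        (∀ x, τ.a .head x ≠ 0 → τ.a .head x ≤ K ∧ σ.a .node (τ.a .head x) = x)) := by
  have hB := G.le_size
  have hs := G.size_eq
  refine Tri.forLoop_le hB hw K 200 (fun j τ => Lists j (σ.a .node) (τ.a .prev) ∧
        (∀ a, 0 < a → a ≤ j → a ≤ τ.a .head (σ.a .node a)) ∧
        (∀ x, τ.a .head x ≠ 0 → τ.a .head x ≤ j ∧ σ.a .node (τ.a .head x) = x)) hk (by omega)
    (by decide) rfl rfl ?_ ?_ ?_
  · refine ⟨⟨?_, ?_, ?_⟩, ?_, ?_⟩ <;> simp [h0] <;> omega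
  · rintro ρ j hF hj hjK ⟨⟨hp1, hp2, hp3⟩, hh1, hh2⟩
    have hn : ρ.a .node = σ.a .node := hF.a _ rfl
    have hnj := hnode (j + 1) (by omega) (by omega)
    have hhj := hh2 (σ.a .node (j + 1))
    refine Tri.of_wp hB hw rfl (by decide) ?_
    simp [hj, hn, Function.update_apply]
    and_intros
    all_goals try omega
    · constructor
      · intro a ha haj
        simp only [Function.update_apply]
        split_ifs with h
        · subst h; omega
        · exact hp1 a ha (by omega)
      · intro a ha haj
        simp only [Function.update_apply]
        split_ifs with h
        · subst h; intro h; exact (hhj h).2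
        · exact hp2 a ha (by omega)
      · intro a ha haj b
        simp only [Function.update_apply]
        split_ifs with h
        · subst h; intro h1 h2 h3
          have := hh1 b (by omega) (by omega)
          rw [h3] at this
          omega
        · exact hp3 a ha (by omega) b
    · intro a ha haj
      by_cases h : a = j + 1
      · simp [h]
      · have := hh1 a ha (by omega)
        split_ifs <;> omega
    · intro x
      split_ifs with h
      · intro _; exact ⟨le_rfl, h.symm⟩
      · intro h3
        have := hh2 x h3
        omega
  · exact fun τ _ h => h

end Input
-- Searching the graph of pairs
/-- The queue holds the marked nodes, without repetitions. -/
structure Queue (N : ℕ) (σ : St) : Prop where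
  lt : ∀ i < σ.v .ql, σ.a .queue i < N
  marked : ∀ i < σ.v .ql, σ.a .mark (σ.a .queue i) ≠ 0
  inj : ∀ i < σ.v .ql, ∀ j < σ.v .ql, σ.a .queue i = σ.a .queue j → i = j
  mem : ∀ y, σ.a .mark y ≠ 0 → ∃ i < σ.v .ql, σ.a .queue i = y

namespace Queue

variable {N : ℕ} {σ τ : St}

theorem push (h : Queue N σ) {a : ℕ} (haN : a < N) (ha : σ.a .mark a = 0)
    (hql : τ.v .ql = σ.v .ql + 1) (hm : τ.a .mark = Function.update (σ.a .mark) a 1)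
    (hq : τ.a .queue = Function.update (σ.a .queue) (σ.v .ql) a) : Queue N τ := by
  obtain ⟨h1, h2, h3, h4⟩ := h
  constructor
  · rw [hql, hq]
    intro i hi
    rw [Function.update_apply]
    split_ifs with h
    · exact haN
    · exact h1 i (by omega)
  · rw [hql, hq, hm]
    intro i hi
    simp only [Function.update_apply]
    split_ifs with h h' h'
    · omega
    · exact absurd rfl h'
    · omega
    · exact h2 i (by omega)
  · rw [hql, hq]
    intro i hi j hj
    simp only [Function.update_apply]
    split_ifs with h h' h'
    · omega
    · intro h5
      exact absurd ha (h5 ▸ h2 j (by omega))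
    · intro h5
      exact absurd ha (h5 ▸ h2 i (by omega))
    · exact h3 i (by omega) j (by omega)
  · rw [hql, hq, hm]
    intro y
    simp only [Function.update_apply]
    split_ifs with h
    · exact fun _ => ⟨σ.v .ql, by omega, by simp [h]⟩
    · intro hy
      obtain ⟨i, hi, h5⟩ := h4 y hy
      exact ⟨i, by omega, by rw [if_neg (by omega), h5]⟩

/-- Pigeonhole: the queue has no repetitions, so it never runs past the end of its array. -/
theorem ql_le (h : Queue N σ) : σ.v .ql ≤ N := by
  have := Finset.card_le_card_of_injOn (s := Finset.range (σ.v .ql)) (t := Finset.range N)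
    (σ.a .queue) (fun i hi => by simpa using h.lt i (by simpa using hi))
    (fun i hi j hj hij => h.inj i (by simpa using hi) j (by simpa using hj) hij)
  simpa using this

end Queue

namespace Input

variable {G : Input} {w : ℕ} {σ : St}

theorem tri_seed (hw : G.size ^ 16 ≤ 2 ^ w) (hσ : G.Loaded σ) (hql : σ.v .ql = 0)
    (hm : ∀ y, σ.a .mark y = 0) :
    Tri w G.size seed σ (G.n * (G.n * 210 + 20) + 10)
      (fun τ => Queue (G.n * G.n) τ ∧ ∀ y, τ.a .mark y ≠ 0 ↔
        ∃ u < G.n, ∃ v < G.n, (G.lam v < G.lam u ∨ u = v) ∧ y = u * G.n + v) := by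
  have hB := G.le_size
  have hs := G.size_eq
  have h2 : G.n ≤ G.n * G.n := Nat.le_mul_of_pos_left _ G.n_pos
  refine Tri.forLoop_le hB hw G.n (G.n * 210 + 10) (fun j τ =>
    Queue (G.n * G.n) τ ∧ ∀ y, τ.a .mark y ≠ 0 ↔ ∃ u < G.n, ∃ v < G.n, u < j ∧
      (G.lam v < G.lam u ∨ u = v) ∧ y = u * G.n + v) hσ.n (by rw [add_assoc])
    (by decide) rfl rfl ?_ ?_ ?_
  · refine ⟨⟨?_, ?_, ?_, ?_⟩, ?_⟩ <;> simp [hql, hm]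
  · rintro ρ j hF hj hjn ⟨hQ, hM⟩
    have hL := hσ.of_frame hF (by decide) (by decide)
    refine Tri.forLoop_le hB hw G.n 200 (fun i τ =>
      Queue (G.n * G.n) τ ∧ ∀ y, τ.a .mark y ≠ 0 ↔ ∃ u < G.n, ∃ v < G.n, (u < j ∨ u = j ∧ v < i) ∧
      (G.lam v < G.lam u ∨ u = v) ∧ y = u * G.n + v) hL.n le_rfl
      (by decide) rfl rfl ?_ ?_ ?_
    · refine ⟨⟨hQ.1, hQ.2, hQ.3, hQ.4⟩, ?_⟩
      simpa using hM
    · rintro ρ' i hF' hi hin ⟨hQ', hM'⟩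
      have hL' := hL.of_frame hF' (by decide) (by decide)
      have hj' : ρ'.v .u = j := (hF'.v _ rfl).trans hj
      have hql := hQ'.ql_le
      have hp := pair_lt hjn hin
      -- Only pairs visited earlier are marked, and the code of a pair is injective. So the push
      -- below meets an unmarked node.
      have h0 : ρ'.a .mark (j * G.n + i) = 0 := by
        by_contra h
        obtain ⟨u, hu, v, hv, h1, -, h3⟩ := (hM' _).1 h
        have := pair_inj hin hv h3
        omega
      have key : ∀ τ : St, (G.lam i < G.lam j ∨ j = i) →
          τ.a .mark = Function.update (ρ'.a .mark) (j * G.n + i) 1 →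
          ∀ y, τ.a .mark y ≠ 0 ↔ ∃ u < G.n, ∃ v < G.n, (u < j ∨ u = j ∧ v < i + 1) ∧
            (G.lam v < G.lam u ∨ u = v) ∧ y = u * G.n + v := by
        intro τ hl hτ y
        rw [hτ, Function.update_apply]
        split_ifs with hy
        · simp only [ne_eq, one_ne_zero, not_false_eq_true, true_iff]
          exact ⟨j, hjn, i, hin, by omega, hl, hy⟩
        · rw [hM']
          constructor
          · rintro ⟨u, hu, v, hv, h1, h2, h3⟩
            exact ⟨u, hu, v, hv, by omega, h2, h3⟩
          · rintro ⟨u, hu, v, hv, h1, h2, h3⟩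
            refine ⟨u, hu, v, hv, ?_, h2, h3⟩
            by_contra h4
            obtain ⟨rfl, rfl⟩ : u = j ∧ v = i := by omega
            exact hy h3
      refine Tri.of_wp hB hw rfl (by decide) ?_
      simp only [push, Stm.wp, Stm.block, Cond.Ok, Cond.left, Cond.right, Cond.Holds, Ex.val_ld,
        Ex.val_var, Ex.ok_ld, Ex.ok_var, hi, hj', hL'.n, hL'.lam i hin, hL'.lam j hjn, Ex.ok_add,
        Ex.ok_mul, Ex.val_add, Ex.val_mul, Ex.val_ofNat, Ex.small_ofNat, true_and,
        Ex.ok_ofNat, St.setA_v, Ex.small_add]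
      have case : (G.lam i < G.lam j ∨ j = i) → ∀ τ : St, τ.v .ql = ρ'.v .ql + 1 →
          τ.a .mark = Function.update (ρ'.a .mark) (j * G.n + i) 1 →
          τ.a .queue = Function.update (ρ'.a .queue) (ρ'.v .ql) (j * G.n + i) →
          (Queue (G.n * G.n) τ ∧ ∀ y, τ.a .mark y ≠ 0 ↔ ∃ u < G.n, ∃ v < G.n,
            (u < j ∨ u = j ∧ v < i + 1) ∧ (G.lam v < G.lam u ∨ u = v) ∧ y = u * G.n + v) :=
        fun hl τ h1 h2 h3 => ⟨hQ'.push hp h0 h1 h2 h3, key τ hl h2⟩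
      and_intros
      all_goals try omega
      · intro hl
        and_intros
        all_goals try omega
        · refine (case (Or.inl hl) _ ?_ ?_ ?_).1 <;> simp
        · refine (case (Or.inl hl) _ ?_ ?_ ?_).2 <;> simp
      · intro hl
        and_intros
        · intro hji
          and_intros
          all_goals try omega
          · refine (case (Or.inr hji) _ ?_ ?_ ?_).1 <;> simp
          · refine (case (Or.inr hji) _ ?_ ?_ ?_).2 <;> simp
        · intro hji
          refine ⟨⟨hQ'.1, hQ'.2, hQ'.3, hQ'.4⟩, ?_⟩
          intro y
          refine (hM' y).trans ?_
          constructor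
          · rintro ⟨u, hu, v, hv, h1, h2, h3⟩
            exact ⟨u, hu, v, hv, by omega, h2, h3⟩
          · rintro ⟨u, hu, v, hv, h1, h2, h3⟩
            refine ⟨u, hu, v, hv, ?_, h2, h3⟩
            by_contra h4
            obtain ⟨rfl, rfl⟩ : u = j ∧ v = i := by omega
            omega
    · rintro τ hF' ⟨hQ', hM'⟩
      refine ⟨⟨hQ'.1, hQ'.2, hQ'.3, hQ'.4⟩, ?_⟩
      intro y
      refine (hM' y).trans ?_
      constructor
      · rintro ⟨u, hu, v, hv, h1, h2, h3⟩
        exact ⟨u, hu, v, hv, by omega, h2, h3⟩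
      · rintro ⟨u, hu, v, hv, h1, h2, h3⟩
        exact ⟨u, hu, v, hv, by omega, h2, h3⟩
  · rintro τ hF ⟨hQ, hM⟩
    refine ⟨hQ, fun y => (hM y).trans ?_⟩
    constructor
    · rintro ⟨u, hu, v, hv, h1, h2, h3⟩
      exact ⟨u, hu, v, hv, h2, h3⟩
    · rintro ⟨u, hu, v, hv, h2, h3⟩
      exact ⟨u, hu, v, hv, hu, h2, h3⟩

/-- The invariant of the search. -/
structure SearchInv (N K : ℕ) (P : ℕ → Prop) (σ τ : St) : Prop where
  queue : Queue N τ
  qi_le : τ.v .qi ≤ τ.v .ql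
  head : ∀ x, τ.a .head x ≠ 0 → τ.a .head x ≤ K ∧ σ.a .node (τ.a .head x) = x
  -- An arrow that has left the list of its source has been followed.
  used : ∀ a, 0 < a → a ≤ K → τ.a .head (σ.a .node a) < a → τ.a .mark (σ.a .tgt a) ≠ 0
  done : ∀ i < τ.v .qi, τ.a .head (τ.a .queue i) = 0
  sound : ∀ y, τ.a .mark y ≠ 0 → P y
  seed : ∀ y, σ.a .mark y ≠ 0 → τ.a .mark y ≠ 0

/-- Every round either finishes the node at the front of the queue or removes one arrow from a list,
so there are at most `N + K` rounds. At the end every marked node has been dequeued and has an empty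
list, so all its arrows have been followed and the marked set is closed. The property `P`, which is
closed under arrows, bounds the marked set from above. -/
theorem tri_search (hw : G.size ^ 16 ≤ 2 ^ w) {N K : ℕ} (hK : K ≤ G.m * G.m) (hN : N ≤ G.n * G.n)
    {P : ℕ → Prop} (hP : ∀ y, σ.a .mark y ≠ 0 → P y)
    (hstep : ∀ a, 0 < a → a ≤ K → P (σ.a .node a) → P (σ.a .tgt a))
    (htgt : ∀ a, 0 < a → a ≤ K → σ.a .tgt a < N)
    (hQ : Queue N σ) (hqi : σ.v .qi = 0) (hlist : Lists K (σ.a .node) (σ.a .prev))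
    (hh1 : ∀ a, 0 < a → a ≤ K → a ≤ σ.a .head (σ.a .node a))
    (hh2 : ∀ x, σ.a .head x ≠ 0 → σ.a .head x ≤ K ∧ σ.a .node (σ.a .head x) = x) :
    Tri w G.size search σ ((N + K) * 210 + 10)
      (fun τ => (∀ y, τ.a .mark y ≠ 0 → P y) ∧ (∀ y, σ.a .mark y ≠ 0 → τ.a .mark y ≠ 0) ∧
        ∀ a, 0 < a → a ≤ K → τ.a .mark (σ.a .node a) ≠ 0 → τ.a .mark (σ.a .tgt a) ≠ 0) := by
  have hB := G.le_size
  have hs := G.size_eq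
  refine (Tri.while_variant (T := 200) hB hw rfl (SearchInv N K P σ)
    -- The second summand counts the arrows still in the lists.
    (fun τ => (N - τ.v .qi) + ((Finset.Icc 1 K).filter
      fun a => a ≤ τ.a .head (σ.a .node a)).card) ?_ ?_ ?_).mono ?_ ?_
  · intro _ _
    exact ⟨trivial, trivial⟩
  · intro ρ hF hI hlt
    obtain ⟨hQ', hle, hhead, hused, hdone, hsound, hseed⟩ := hI
    have hnode : ρ.a .node = σ.a .node := hF.a _ rfl
    have htg : ρ.a .tgt = σ.a .tgt := hF.a _ rfl
    have hprev : ρ.a .prev = σ.a .prev := hF.a _ rfl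
    simp only [Cond.Holds, Ex.val_var] at hlt
    have hql := hQ'.ql_le
    have hx := hQ'.lt _ hlt
    have hxm := hQ'.marked _ hlt
    refine Tri.of_wp hB hw rfl (by decide) ?_
    set x := ρ.a .queue (ρ.v .qi) with hxdef
    set h := ρ.a .head x with hhdef
    have hh := hhead x
    simp [push, ← hxdef, ← hhdef, hprev, htg]
    and_intros
    all_goals try omega
    · intro h0
      and_intros
      all_goals try omega
      constructor
      · exact ⟨hQ'.1, hQ'.2, hQ'.3, hQ'.4⟩
      · simp; omega
      · exact hhead
      · exact hused
      · simp
        intro i hi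
        rcases Nat.lt_or_ge i (ρ.v .qi) with h1 | h1
        · exact hdone i h1
        · obtain rfl : i = ρ.v .qi := by omega
          exact h0
      · exact hsound
      · exact hseed
    · intro h0
      have hh' := hh h0
      have hnh : σ.a .node h = x := hh'.2
      have ht := htgt h (by omega) hh'.1
      have hPt : P (σ.a .tgt h) := hstep h (by omega) hh'.1 (hh'.2.symm ▸ hsound x hxm)
      have hlast := hlist.prev_lt h (by omega) hh'.1
      have hhead' : ∀ y, Function.update (ρ.a .head) x (σ.a .prev h) y ≠ 0 →
          Function.update (ρ.a .head) x (σ.a .prev h) y ≤ K ∧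
            σ.a .node (Function.update (ρ.a .head) x (σ.a .prev h) y) = y := by
        intro y
        rw [Function.update_apply]
        split_ifs with hy
        · intro h1
          have := hlist.prev_node h (by omega) hh'.1 h1
          exact ⟨by omega, by rw [this, hh'.2, hy]⟩
        · exact hhead y
      -- The queue has no repetitions, so the node being processed differs from the finished ones
      -- and their lists stay empty.
      have hdone' : ∀ i < ρ.v .qi, Function.update (ρ.a .head) x (σ.a .prev h) (ρ.a .queue i) = 0 := by
        intro i hi
        rw [Function.update_of_ne, hdone i hi]
        intro h1
        have := hQ'.inj i (by omega) _ hlt h1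
        omega
      have hused' : ∀ a, 0 < a → a ≤ K →
          Function.update (ρ.a .head) x (σ.a .prev h) (σ.a .node a) < a →
          a = h ∨ ρ.a .mark (σ.a .tgt a) ≠ 0 := by
        intro a ha haK
        rw [Function.update_apply]
        split_ifs with hy
        · intro h1
          by_cases h2 : a = h
          · exact Or.inl h2
          · refine Or.inr (hused a ha haK ?_)
            by_contra h3
            -- No arrow strictly between `prev h` and `h` leaves the same node, so `h` is the only
            -- arrow that has just been removed.
            refine hlist.prev_max h (by omega) hh'.1 a h1 ?_ (by rw [hy, hh'.2])
            rw [hy] at h3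
            omega
        · exact fun h1 => Or.inr (hused a ha haK h1)
      have hcard : ((Finset.Icc 1 K).filter
          fun a => a ≤ Function.update (ρ.a .head) x (σ.a .prev h) (σ.a .node a)).card <
          ((Finset.Icc 1 K).filter fun a => a ≤ ρ.a .head (σ.a .node a)).card := by
        refine Finset.card_lt_card (Finset.ssubset_iff_of_subset ?_ |>.2 ?_)
        · intro a
          simp only [Finset.mem_filter, Finset.mem_Icc, Function.update_apply]
          rintro ⟨h1, h2⟩
          refine ⟨h1, ?_⟩
          split_ifs at h2 with h3
          · rw [h3]; omega
          · exact h2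
        · refine ⟨h, ?_, ?_⟩
          · simp only [Finset.mem_filter, Finset.mem_Icc, hnh]
            omega
          · simp only [Finset.mem_filter, Finset.mem_Icc, hnh, Function.update_self]
            omega
      and_intros
      all_goals try omega
      · intro hm
        and_intros
        all_goals try omega
        have hmark : ∀ y, ρ.a .mark y ≠ 0 → Function.update (ρ.a .mark) (σ.a .tgt h) 1 y ≠ 0 := by
          intro y hy
          rw [Function.update_apply]
          split_ifs <;> omega
        constructor
        · refine hQ'.push ht hm ?_ ?_ ?_ <;> simp
        · simp; omega
        · simpa using hhead'
        · simp only [St.setV_a, St.setA_a, if_false, if_true, reduceCtorEq]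
          intro a ha haK h1
          rcases hused' a ha haK h1 with rfl | h2
          · simp
          · exact hmark _ h2
        · simp only [St.setV_a, St.setA_a, if_false, if_true, reduceCtorEq, St.setV_v, St.setA_v]
          intro i hi
          rw [Function.update_of_ne (a := i) (by omega)]
          exact hdone' i hi
        · simp only [St.setV_a, St.setA_a, if_false, if_true, reduceCtorEq]
          intro y
          rw [Function.update_apply]
          split_ifs with h1
          · rw [h1]; exact fun _ => hPt
          · exact hsound y
        · simp only [St.setV_a, St.setA_a, if_false, if_true, reduceCtorEq]
          exact fun y hy => hmark y (hseed y hy)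
      · intro hm
        refine ⟨?_, by omega⟩
        constructor
        · exact ⟨hQ'.1, hQ'.2, hQ'.3, hQ'.4⟩
        · simp; omega
        · simpa using hhead'
        · simp only [St.setV_a, St.setA_a, if_false, if_true, reduceCtorEq]
          intro a ha haK h1
          rcases hused' a ha haK h1 with rfl | h2
          · exact hm
          · exact h2
        · simp only [St.setV_a, St.setA_a, if_false, if_true, reduceCtorEq, St.setV_v, St.setA_v]
          exact hdone'
        · exact hsound
        · exact hseed
  · refine ⟨hQ, by omega, hh2, ?_, ?_, hP, fun _ h => h⟩
    · intro a ha haK h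
      have := hh1 a ha haK
      omega
    · intro i hi
      omega
  · have h1 : ((Finset.Icc 1 K).filter fun a => a ≤ σ.a .head (σ.a .node a)).card ≤ K :=
      (Finset.card_filter_le _ _).trans (by simp)
    have h2 := Nat.mul_le_mul_right (203) (Nat.add_le_add (Nat.sub_le N (σ.v .qi)) h1)
    simp only [Cond.cost, Cond.left, Cond.right, Ex.cost]
    omega
  · rintro τ hF ⟨hI, hb⟩
    refine ⟨hI.sound, hI.seed, ?_⟩
    intro a ha haK hm
    obtain ⟨i, hi, h1⟩ := hI.queue.mem _ hm
    simp only [Cond.Holds, Ex.val_var] at hb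
    have h2 := hI.done i (by omega)
    rw [h1] at h2
    exact hI.used a ha haK (by omega)

end Input
-- Interval orders and sorting by the number of predecessors
/-- A strict interval order on the numbers below `n`. -/
structure IntervalOrder (n : ℕ) (lt : ℕ → ℕ → Prop) : Prop where
  lt_left : ∀ u v, lt u v → u < n
  irrefl : ∀ u, ¬ lt u u
  trans : ∀ u v z, lt u v → lt v z → lt u z
  interval : ∀ u v x y, lt u v → lt x y → lt u y ∨ lt x v

open Classical in
/-- The number of predecessors. -/
noncomputable def numPreds (n : ℕ) (lt : ℕ → ℕ → Prop) (v : ℕ) : ℕ :=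
  ((Finset.range n).filter fun u => lt u v).card

namespace IntervalOrder

variable {n : ℕ} {lt : ℕ → ℕ → Prop} (h : IntervalOrder n lt)
include h

theorem numPreds_lt_of_lt {u v : ℕ} (huv : lt u v) : numPreds n lt u < numPreds n lt v := by
  classical
  unfold numPreds
  refine Finset.card_lt_card (Finset.ssubset_iff_of_subset ?_ |>.2 ⟨u, ?_, ?_⟩)
  · intro x
    simp only [Finset.mem_filter]
    exact fun hx => ⟨hx.1, h.trans _ _ _ hx.2 huv⟩
  · simpa [huv] using h.lt_left _ _ huv
  · simpa using fun _ => h.irrefl u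

/-- If `u` were not below `z`, the interval property would make every predecessor of `z` a
predecessor of `v`. As `u` is a further predecessor of `v`, the count for `v` would be strictly
larger. -/
theorem lt_of_numPreds_le {u v z : ℕ} (huv : lt u v) (hvz : numPreds n lt v ≤ numPreds n lt z) :
    lt u z := by
  classical
  by_contra huz
  refine absurd hvz (not_le.2 ?_)
  unfold numPreds
  refine Finset.card_lt_card (Finset.ssubset_iff_of_subset ?_ |>.2 ⟨u, ?_, ?_⟩)
  · intro x
    simp only [Finset.mem_filter]
    exact fun hx => ⟨hx.1, (h.interval _ _ _ _ hx.2 huv).resolve_right huz⟩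
  · simpa [huv] using h.lt_left _ _ huv
  · simpa using fun _ => huz

theorem numPreds_lt {v : ℕ} (hv : v < n) : numPreds n lt v < n := by
  classical
  have : numPreds n lt v < (Finset.range n).card := by
    unfold numPreds
    refine Finset.card_lt_card (Finset.ssubset_iff_of_subset (Finset.filter_subset _ _) |>.2
      ⟨v, by simpa using hv, ?_⟩)
    simpa using fun _ => h.irrefl v
  simpa using this

end IntervalOrder

/-- The first `k` values of `ord` are the numbers below `n` with the property `P`, ordered by
`R`. -/
structure Listing (n : ℕ) (R : ℕ → ℕ → Prop) (P : ℕ → Prop) (k : ℕ) (ord : ℕ → ℕ) : Prop where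
  ord_lt : ∀ i < k, ord i < n
  mono : ∀ i j, i < j → j < k → R (ord i) (ord j)
  mem : ∀ v < n, P v ↔ ∃ i < k, ord i = v

namespace Listing

variable {n k : ℕ} {R : ℕ → ℕ → Prop} {P : ℕ → Prop} {ord : ℕ → ℕ}

theorem inj (hR : ∀ u, ¬ R u u) (h : Listing n R P k ord) {i j : ℕ} (hi : i < k) (hj : j < k)
    (hij : ord i = ord j) : i = j := by
  rcases lt_trichotomy i j with h1 | h1 | h1
  · have := h.mono i j h1 hj
    rw [hij] at this
    exact absurd this (hR _)
  · exact h1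
  · have := h.mono j i h1 hi
    rw [hij] at this
    exact absurd this (hR _)

theorem le (hR : ∀ u, ¬ R u u) (h : Listing n R P k ord) : k ≤ n := by
  have := Finset.card_le_card_of_injOn (s := Finset.range k) (t := Finset.range n)
    ord (fun i hi => by simpa using h.ord_lt i (by simpa using hi))
    (fun i hi j hj hij => h.inj hR (by simpa using hi) (by simpa using hj) hij)
  simpa using this

theorem eq (hR : ∀ u, ¬ R u u) (h : Listing n R (fun _ => True) k ord) : k = n := by
  refine le_antisymm (h.le hR) ?_
  have := Finset.card_le_card_of_surjOn (s := Finset.range k) (t := Finset.range n) ord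
    (fun v hv => by
      obtain ⟨i, hi, h1⟩ := (h.mem v (by simpa using hv)).1 trivial
      exact ⟨i, by simpa using hi, h1⟩)
  simpa using this

theorem congr {P' : ℕ → Prop} (h : Listing n R P k ord) (hP : ∀ v < n, P' v ↔ P v) :
    Listing n R P' k ord :=
  ⟨h.ord_lt, h.mono, fun v hv => (hP v hv).trans (h.mem v hv)⟩

theorem snoc {P' : ℕ → Prop} (h : Listing n R P k ord) {v : ℕ} (hv : v < n)
    (hP : ∀ u < n, P' u ↔ P u ∨ u = v) (hm : ∀ u < n, P u → R u v) :
    Listing n R P' (k + 1) (Function.update ord k v) := by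
  constructor
  · intro i hi
    rw [Function.update_apply]
    split_ifs
    · exact hv
    · exact h.ord_lt i (by omega)
  · intro i j hij hj
    rw [Function.update_apply, Function.update_apply, if_neg (by omega)]
    split_ifs with h1
    · have hi := h.ord_lt i (by omega)
      exact hm _ hi ((h.mem _ hi).2 ⟨i, by omega, rfl⟩)
    · exact h.mono i j hij (by omega)
  · intro u hu
    rw [hP u hu, h.mem u hu]
    simp only [Function.update_apply]
    constructor
    · rintro (⟨i, hi, rfl⟩ | rfl)
      · exact ⟨i, by omega, if_neg (by omega)⟩
      · exact ⟨k, by omega, if_pos rfl⟩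
    · rintro ⟨i, hi, h1⟩
      split_ifs at h1 with h2
      · exact Or.inr h1.symm
      · exact Or.inl ⟨i, by omega, h1⟩

end Listing

/-- Comparison by the number of predecessors. -/
def PredLT (n : ℕ) (lt : ℕ → ℕ → Prop) (u v : ℕ) : Prop :=
  numPreds n lt u < numPreds n lt v ∨ (numPreds n lt u = numPreds n lt v ∧ u < v)

theorem PredLT.irrefl {n : ℕ} {lt : ℕ → ℕ → Prop} (u : ℕ) : ¬ PredLT n lt u u := by
  simp [PredLT]

/-- `ord` lists the numbers below `n` by increasing number of predecessors. -/
abbrev Sorted (n : ℕ) (lt : ℕ → ℕ → Prop) (ord : ℕ → ℕ) : Prop :=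
  Listing n (PredLT n lt) (fun _ => True) n ord

namespace Input

variable {G : Input} {w : ℕ} {σ : St} {lt : ℕ → ℕ → Prop}

theorem tri_count (hw : G.size ^ 16 ≤ 2 ^ w) (hn : σ.v .n = G.n)
    (hm : ∀ u < G.n, ∀ v < G.n, σ.a .mark (u * G.n + v) = 0 ↔ lt u v) :
    Tri w G.size count σ (G.n * (G.n * 210 + 220) + 10)
      (fun τ => ∀ v < G.n, τ.a .cnt v = numPreds G.n lt v) := by
  classical
  have hB := G.le_size
  have hs := G.size_eq
  have h2 : G.n ≤ G.n * G.n := Nat.le_mul_of_pos_left _ G.n_pos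
  refine Tri.forLoop_le hB hw G.n (G.n * 210 + 210) (fun j τ => ∀ v < j, τ.a .cnt v =
    numPreds G.n lt v) hn (by rw [add_assoc]) (by decide) rfl rfl ?_ ?_ ?_
  · simp
  · intro ρ j hF hj hjn hI
    refine Tri.seq_le 200 (G.n * 210 + 10) (fun τ => (∀ v < j, τ.a .cnt v =
      numPreds G.n lt v) ∧ τ.a .cnt j = 0) (by omega) (Tri.of_wp hB hw rfl (by decide) ?_) ?_
    · simp [hj, Function.update_apply]
      and_intros
      all_goals try omega
      intro v hv
      rw [if_neg (by omega), hI v hv]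
    · rintro ρ₁ hF₁ ⟨hI₁, h0⟩
      have hj₁ : ρ₁.v .v = j := (hF₁.v _ rfl).trans hj
      refine Tri.forLoop_le hB hw G.n 200 (fun i τ => (∀ v < j, τ.a .cnt v =
        numPreds G.n lt v) ∧ τ.a .cnt j = ((Finset.range i).filter fun u => lt u j).card)
        ((hF₁.v _ rfl).trans ((hF.v _ rfl).trans hn)) (by omega) (by decide) rfl rfl ?_ ?_ ?_
      · simpa [h0] using hI₁
      · rintro ρ₂ i hF₂ hi hin ⟨hI₂, hc⟩
        have hj₂ : ρ₂.v .v = j := (hF₂.v _ rfl).trans hj₁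
        have hn₂ : ρ₂.v .n = G.n :=
          (hF₂.v _ rfl).trans ((hF₁.v _ rfl).trans ((hF.v _ rfl).trans hn))
        have hmark : ρ₂.a .mark = σ.a .mark :=
          (hF₂.a _ rfl).trans ((hF₁.a _ rfl).trans (hF.a _ rfl))
        have hp := pair_lt hin hjn
        have hle : ((Finset.range i).filter fun u => lt u j).card ≤ i :=
          (Finset.card_filter_le _ _).trans (by simp)
        refine Tri.of_wp hB hw rfl (by decide) ?_
        simp [hi, hj₂, hn₂, hmark, hm i hin j hjn, hc, Function.update_apply, Finset.range_add_one,
          Finset.filter_insert]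
        and_intros
        all_goals try omega
        · intro h
          and_intros
          all_goals try omega
          · intro v hv
            rw [if_neg (by omega), hI₂ v hv]
          · simp [h]
        · intro h
          exact ⟨hI₂, by simp [h]⟩
      · rintro τ - ⟨hI₂, hc⟩ v hv
        rw [St.setV_a]
        by_cases h : v = j
        · subst h
          exact hc
        · exact hI₂ v (by omega)
  · exact fun τ _ h => h

theorem tri_sort (hw : G.size ^ 16 ≤ 2 ^ w) (hn : σ.v .n = G.n) (hlt : IntervalOrder G.n lt)
    (hc : ∀ v < G.n, σ.a .cnt v = numPreds G.n lt v) :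
    Tri w G.size sort σ (G.n * (G.n * 210 + 20) + 20)
      (fun τ => Sorted G.n lt (τ.a .ord)) := by
  have hB := G.le_size
  have hs := G.size_eq
  have h2 : G.n ≤ G.n * G.n := Nat.le_mul_of_pos_left _ G.n_pos
  refine Tri.seq_le 2 (G.n * (G.n * 210 + 20) + 10) (fun τ => τ.v .k = 0) (by omega)
    (Tri.of_wp hB hw rfl (by decide) (by simp; omega)) ?_
  intro σ₁ hF₁ hk
  have hn₁ : σ₁.v .n = G.n := (hF₁.v _ rfl).trans hn
  refine Tri.forLoop_le hB hw G.n (G.n * 210 + 10) (fun j τ => Listing G.n (PredLT G.n lt)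
    (fun v => numPreds G.n lt v < j) (τ.v .k) (τ.a .ord))
    hn₁ (by rw [add_assoc]) (by decide) rfl rfl ?_ ?_ ?_
  · constructor <;> simp [hk]
  · intro ρ j hF hj hjn hI
    refine Tri.forLoop_le hB hw G.n 200 (fun i τ => Listing G.n (PredLT G.n lt)
      (fun v => numPreds G.n lt v < j ∨ numPreds G.n lt v = j ∧ v < i) (τ.v .k) (τ.a .ord))
      ((hF.v _ rfl).trans hn₁) le_rfl (by decide) rfl rfl ?_ ?_ ?_
    · simpa using hI
    · intro ρ₁ i hF₂ hi hin hI₁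
      have hj₁ : ρ₁.v .d = j := (hF₂.v _ rfl).trans hj
      have hcnt : ρ₁.a .cnt = σ.a .cnt :=
        (hF₂.a _ rfl).trans ((hF.a _ rfl).trans (hF₁.a _ rfl))
      have hle := hI₁.le PredLT.irrefl
      refine Tri.of_wp hB hw rfl (by decide) ?_
      simp [hi, hj₁, hcnt, hc i hin]
      and_intros
      all_goals try omega
      · intro h
        and_intros
        all_goals try omega
        refine hI₁.snoc hin ?_ ?_
        · intro u hu
          constructor
          · intro h1; omega
          · rintro (h1 | rfl) <;> omega
        · intro u hu; unfold PredLT; omega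
      · intro h
        refine hI₁.congr ?_
        intro u hu
        constructor
        · rintro (h1 | ⟨h1, h3⟩)
          · exact Or.inl h1
          · rcases Nat.le_iff_lt_or_eq.1 h3 with h3 | rfl
            · exact Or.inr ⟨h1, h3⟩
            · exact absurd h1 h
        · omega
    · intro τ _ hI₁
      refine hI₁.congr ?_
      intro u hu
      omega
  · intro τ _ hI
    -- A state is not its own predecessor, so all counts are below n and the n passes collect every
    -- state.
    have := hI.congr (P' := fun _ => True) (fun v hv => by simpa using hlt.numPreds_lt hv)
    have h3 := this.eq PredLT.irrefl
    rwa [h3] at this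

end Input
-- Greedy chain decomposition
/-- The first `i` numbers in the list `ord` are distributed to the chains below `p`. -/
structure Chains (n : ℕ) (lt : ℕ → ℕ → Prop) (ord : ℕ → ℕ) (i p : ℕ) (chain : ℕ → ℕ) : Prop where
  p_le : p ≤ i
  chain_lt : ∀ j < i, chain (ord j) < p
  asc : ∀ j j', j < j' → j' < i → chain (ord j) = chain (ord j') → lt (ord j) (ord j')
  first : 0 < i → chain (ord 0) = 0
  surj : ∀ c < p, ∃ j < i, chain (ord j) = c
  -- The certificate of optimality: an antichain with as many elements as there are chains.
  antichain : ∃ f : ℕ → ℕ, (∀ c < p, f c < n) ∧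
    ∀ c < p, ∀ c' < p, c ≠ c' → f c ≠ f c' ∧ ¬ lt (f c) (f c')

/-- The values of `top` are the last elements of the chains. -/
def IsTop (ord : ℕ → ℕ) (i p : ℕ) (chain top : ℕ → ℕ) : Prop :=
  ∀ c < p, ∃ j < i, top c = ord j ∧ chain (ord j) = c ∧ ∀ j' < i, chain (ord j') = c → j' ≤ j

section

variable {n : ℕ} {lt : ℕ → ℕ → Prop} {ord chain top : ℕ → ℕ} {i p : ℕ}

/-- The new state lies above the last element of its chain, hence above the whole chain by
transitivity. The number of chains does not change, so the old antichain still serves. -/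
theorem Chains.append (hlt : IntervalOrder n lt) (hS : Sorted n lt ord)
    (hC : Chains n lt ord i p chain) (hT : IsTop ord i p chain top) (hi : i < n) {r : ℕ}
    (hr : r < p) (hrv : lt (top r) (ord i)) :
    Chains n lt ord (i + 1) p (Function.update chain (ord i) r) ∧
      IsTop ord (i + 1) p (Function.update chain (ord i) r) (Function.update top r (ord i)) := by
  have hne : ∀ j < i, ord j ≠ ord i := fun j hj h => by
    have := hS.inj PredLT.irrefl (by omega) hi h
    omega
  have hch : ∀ j < i, Function.update chain (ord i) r (ord j) = chain (ord j) := fun j hj =>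
    Function.update_of_ne (hne j hj) _ _
  refine ⟨⟨?_, ?_, ?_, ?_, ?_, hC.antichain⟩, ?_⟩
  · have := hC.p_le; omega
  · intro j hj
    rcases Nat.lt_succ_iff_lt_or_eq.1 hj with h | rfl
    · rw [hch j h]; exact hC.chain_lt j h
    · simpa using hr
  · intro j j' hj hj'
    rw [hch j (by omega)]
    rcases Nat.lt_succ_iff_lt_or_eq.1 hj' with h | rfl
    · rw [hch j' h]; exact hC.asc j j' hj h
    · rw [Function.update_self]
      intro hjr
      obtain ⟨t, ht, h1, h2, h3⟩ := hT r hr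
      rcases Nat.lt_or_eq_of_le (h3 j hj hjr) with h4 | rfl
      · exact hlt.trans _ _ _ (hC.asc j t h4 ht (by rw [hjr, h2])) (h1 ▸ hrv)
      · exact h1 ▸ hrv
  · intro _
    have := hC.p_le
    rw [hch 0 (by omega)]
    exact hC.first (by omega)
  · intro c hc
    obtain ⟨j, hj, h⟩ := hC.surj c hc
    exact ⟨j, by omega, by rw [hch j hj, h]⟩
  · intro c hc
    by_cases h : c = r
    · subst h
      exact ⟨i, by omega, by simp, by simp, by omega⟩
    · obtain ⟨j, hj, h1, h2, h3⟩ := hT c hc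
      refine ⟨j, by omega, by simp [h, h1], by rw [hch j hj, h2], ?_⟩
      intro j' hj' h4
      rcases Nat.lt_succ_iff_lt_or_eq.1 hj' with h5 | rfl
      · exact h3 j' h5 (by rwa [hch j' h5] at h4)
      · rw [Function.update_self] at h4
        exact absurd h4.symm h

/-- The last elements of all chains, the new one included, form an antichain. If one old top lay
below another, it would also lie below the new state, which has at least as many predecessors as the
other top; but no old top lies below the new state. Conversely, the new state cannot lie below an
old top, as it would then have strictly fewer predecessors, against the sorting. -/
theorem Chains.new (hlt : IntervalOrder n lt) (hS : Sorted n lt ord)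
    (hC : Chains n lt ord i p chain) (hT : IsTop ord i p chain top) (hi : i < n)
    (hv : ∀ c < p, ¬ lt (top c) (ord i)) :
    Chains n lt ord (i + 1) (p + 1) (Function.update chain (ord i) p) ∧
      IsTop ord (i + 1) (p + 1) (Function.update chain (ord i) p)
        (Function.update top p (ord i)) := by
  have hne : ∀ j < i, ord j ≠ ord i := fun j hj h => by
    have := hS.inj PredLT.irrefl (by omega) hi h
    omega
  have hch : ∀ j < i, Function.update chain (ord i) p (ord j) = chain (ord j) := fun j hj =>
    Function.update_of_ne (hne j hj) _ _
  have hle : ∀ j < i, numPreds n lt (ord j) ≤ numPreds n lt (ord i) := fun j hj => by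
    have := hS.mono j i hj hi
    unfold PredLT at this
    omega
  have hT' : IsTop ord (i + 1) (p + 1) (Function.update chain (ord i) p)
        (Function.update top p (ord i)) := by
    intro c hc
    rcases Nat.lt_succ_iff_lt_or_eq.1 hc with h | rfl
    · obtain ⟨j, hj, h1, h2, h3⟩ := hT c h
      refine ⟨j, by omega, by simp [h.ne, h1], by rw [hch j hj, h2], ?_⟩
      intro j' hj' h4
      rcases Nat.lt_succ_iff_lt_or_eq.1 hj' with h5 | rfl
      · exact h3 j' h5 (by rwa [hch j' h5] at h4)
      · rw [Function.update_self] at h4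
        omega
    · exact ⟨i, by omega, by simp, by simp, by omega⟩
  refine ⟨⟨?_, ?_, ?_, ?_, ?_, Function.update top p (ord i), ?_, ?_⟩, hT'⟩
  · have := hC.p_le; omega
  · intro j hj
    rcases Nat.lt_succ_iff_lt_or_eq.1 hj with h | rfl
    · rw [hch j h]
      have := hC.chain_lt j h
      omega
    · simp
  · intro j j' hj hj'
    rw [hch j (by omega)]
    rcases Nat.lt_succ_iff_lt_or_eq.1 hj' with h | rfl
    · rw [hch j' h]; exact hC.asc j j' hj h
    · rw [Function.update_self]
      have := hC.chain_lt j hj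
      omega
  · intro _
    have := hC.p_le
    rcases Nat.eq_zero_or_pos i with rfl | h
    · simp; omega
    · rw [hch 0 h]
      exact hC.first h
  · intro c hc
    obtain ⟨j, hj, -, h, -⟩ := hT' c hc
    exact ⟨j, hj, h⟩
  · intro c hc
    obtain ⟨j, hj, h, -, -⟩ := hT' c hc
    rw [h]
    exact hS.ord_lt j (by omega)
  · intro c hc c' hc' hcc
    obtain ⟨j, hj, h, h1, -⟩ := hT' c hc
    obtain ⟨j', hj', h', h1', -⟩ := hT' c' hc'
    refine ⟨fun h2 => ?_, fun h2 => ?_⟩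
    · rw [h, h'] at h2
      rw [h2] at h1
      omega
    · rcases Nat.lt_succ_iff_lt_or_eq.1 hc with h3 | rfl
      · refine hv c h3 ?_
        rw [Function.update_of_ne h3.ne] at h2
        refine hlt.lt_of_numPreds_le h2 ?_
        rw [h']
        rcases Nat.lt_succ_iff_lt_or_eq.1 hj' with h4 | rfl
        · exact hle j' h4
        · exact le_rfl
      · rw [h', Function.update_self] at h2
        have h5 := hlt.numPreds_lt_of_lt h2
        rcases Nat.lt_succ_iff_lt_or_eq.1 hj' with h4 | rfl
        · have := hle j' h4
          omega
        · omega

end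

namespace Input

variable {G : Input} {w : ℕ} {σ : St} {lt : ℕ → ℕ → Prop}

theorem tri_greedy (hw : G.size ^ 16 ≤ 2 ^ w) (hn : σ.v .n = G.n) (hp : σ.v .p = 0)
    (hlt : IntervalOrder G.n lt)
    (hm : ∀ u < G.n, ∀ v < G.n, σ.a .mark (u * G.n + v) = 0 ↔ lt u v)
    (hS : Sorted G.n lt (σ.a .ord)) :
    Tri w G.size greedy σ (G.n * (G.n * 210 + 420) + 20)
      (fun τ => Chains G.n lt (σ.a .ord) G.n (τ.v .p) (τ.a .chain)) := by
  have hB := G.le_size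
  have hs := G.size_eq
  have h2 : G.n ≤ G.n * G.n := Nat.le_mul_of_pos_left _ G.n_pos
  refine Tri.forLoop_le hB hw G.n (G.n * 210 + 410) (fun i τ =>
    Chains G.n lt (σ.a .ord) i (τ.v .p) (τ.a .chain) ∧
    IsTop (σ.a .ord) i (τ.v .p) (τ.a .chain) (τ.a .top)) hn (by
      rw [add_assoc]; omega) (by decide) rfl rfl ?_ ?_ ?_
  · refine ⟨⟨?_, ?_, ?_, ?_, ?_, fun _ => 0, ?_, ?_⟩, ?_⟩ <;> simp [hp, IsTop]
  · rintro ρ i hF hi hin ⟨hC, hT⟩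
    have hord : ρ.a .ord = σ.a .ord := hF.a _ rfl
    have hmark : ρ.a .mark = σ.a .mark := hF.a _ rfl
    have hn' : ρ.v .n = G.n := (hF.v _ rfl).trans hn
    have hpi := hC.p_le
    have hv := hS.ord_lt i hin
    have htop : ∀ c < ρ.v .p, ρ.a .top c < G.n := by
      intro c hc
      obtain ⟨j, hj, h, -, -⟩ := hT c hc
      rw [h]
      exact hS.ord_lt j (by omega)
    refine Tri.seq_le 100 (G.n * 210 + 310) (fun τ => τ.v .v = σ.a .ord i ∧ τ.v .r = ρ.v .p)
      (by omega) (Tri.of_wp hB hw rfl (by decide) ?_) ?_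
    · simp [hi, hord]
      omega
    · rintro ρ₁ hF₁ ⟨hv₁, hr₁⟩
      have hp₁ : ρ₁.v .p = ρ.v .p := hF₁.v _ rfl
      have htop₁ : ρ₁.a .top = ρ.a .top := hF₁.a _ rfl
      have hn₁ : ρ₁.v .n = G.n := (hF₁.v _ rfl).trans hn'
      have hmark₁ : ρ₁.a .mark = σ.a .mark := (hF₁.a _ rfl).trans hmark
      -- The variable `r` starts as the number of chains, which means that none fits. The loop does
      -- not stop at the first suitable chain and may overwrite `r`, but every suitable chain is
      -- equally good.
      refine Tri.seq_le (G.n * 210 + 10) 100 (fun τ =>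
        (τ.v .r = ρ.v .p ∧ ∀ c < ρ.v .p, ¬ lt (ρ.a .top c) (σ.a .ord i)) ∨
        (τ.v .r < ρ.v .p ∧ lt (ρ.a .top (τ.v .r)) (σ.a .ord i)))
        (by omega) ?_ ?_
      · refine Tri.forLoop_le hB hw (ρ.v .p) 200 (fun c τ =>
          (τ.v .r = ρ.v .p ∧ ∀ c' < c, ¬ lt (ρ.a .top c') (σ.a .ord i)) ∨
          (τ.v .r < ρ.v .p ∧ lt (ρ.a .top (τ.v .r)) (σ.a .ord i))) hp₁ ?_ (by decide) rfl rfl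
          ?_ ?_ ?_
        · have : ρ.v .p * 210 ≤ G.n * 210 := Nat.mul_le_mul_right _ (by omega)
          omega
        · simp [hr₁]
        · intro ρ₂ c hF₂ hc hcp hI
          have htop₂ : ρ₂.a .top = ρ.a .top := (hF₂.a _ rfl).trans htop₁
          have hn₂ : ρ₂.v .n = G.n := (hF₂.v _ rfl).trans hn₁
          have hv₂ : ρ₂.v .v = σ.a .ord i := (hF₂.v _ rfl).trans hv₁
          have hmark₂ : ρ₂.a .mark = σ.a .mark := (hF₂.a _ rfl).trans hmark₁
          have ht := htop c hcp
          have hpair := pair_lt ht hv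
          refine Tri.of_wp hB hw rfl (by decide) ?_
          simp [hc, htop₂, hn₂, hv₂, hmark₂, hm _ ht _ hv]
          and_intros
          all_goals try omega
          · exact fun h => Or.inr ⟨hcp, h⟩
          · intro h
            rcases hI with ⟨h1, h2⟩ | h1
            · refine Or.inl ⟨h1, fun c' hc' => ?_⟩
              rcases Nat.le_iff_lt_or_eq.1 hc' with h3 | rfl
              · exact h2 c' h3
              · exact h
            · exact Or.inr h1
        · exact fun τ _ h => h
      · intro ρ₂ hF₂ hr
        have hp₂ : ρ₂.v .p = ρ.v .p := (hF₂.v _ rfl).trans hp₁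
        have hv₂ : ρ₂.v .v = σ.a .ord i := (hF₂.v _ rfl).trans hv₁
        have htop₂ : ρ₂.a .top = ρ.a .top := (hF₂.a _ rfl).trans htop₁
        have hchain₂ : ρ₂.a .chain = ρ.a .chain := (hF₂.a _ rfl).trans (hF₁.a _ rfl)
        refine Tri.of_wp hB hw rfl (by decide) ?_
        simp [hp₂, hv₂, htop₂, hchain₂]
        refine ⟨by omega, by omega, fun h => ⟨by omega, ?_⟩, fun h => ?_⟩
        · rw [h]
          refine hC.new hlt hS hT hin ?_
          exact (hr.resolve_right fun h' => h'.1.ne h).2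
        · have := hr.resolve_left fun h' => h h'.1
          exact hC.append hlt hS hT hin this.1 this.2
  · exact fun τ _ h => h.1

end Input
end CoLex

namespace CoLex
namespace Input

variable {G : Input} {w : ℕ} {σ : St} {lt : ℕ → ℕ → Prop}

/-- The pairs of states, coded as numbers, that are reached by the search. -/
inductive Marked (G : Input) : ℕ → Prop
  | lam {u v : ℕ} : u < G.n → v < G.n → G.lam v < G.lam u → Marked G (u * G.n + v)
  | diag {u : ℕ} : u < G.n → Marked G (u * G.n + u)
  | step {e f : ℕ} : e < G.m → f < G.m → G.lam (G.dst e) = G.lam (G.dst f) →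
      Marked G (G.src e * G.n + G.src f) → Marked G (G.dst e * G.n + G.dst f)

/-- The state after the order and the chains have been computed. -/
structure Solved (G : Input) (lt : ℕ → ℕ → Prop) (σ : St) : Prop where
  loaded : G.Loaded σ
  mark : ∀ u < G.n, ∀ v < G.n, σ.a .mark (u * G.n + v) = 0 ↔ lt u v
  sorted : Sorted G.n lt (σ.a .ord)
  chains : Chains G.n lt (σ.a .ord) G.n (σ.v .p) (σ.a .chain)

theorem tri_solve (hw : G.size ^ 16 ≤ 2 ^ w) (hσ : G.Start σ) (hlt : IntervalOrder G.n lt)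
    (hM : ∀ u < G.n, ∀ v < G.n, lt u v ↔ ¬ G.Marked (u * G.n + v)) :
    Tri w G.size solve σ (3000 * (G.m * G.m + G.n * G.n)) (G.Solved lt) := by
  have h1 : G.m ≤ G.m * G.m := Nat.le_mul_self _
  have h2 : G.n ≤ G.n * G.n := Nat.le_mul_self _
  have h3 := G.n_pos
  have a1 : G.m * (G.m * 210 + 20) = 210 * (G.m * G.m) + 20 * G.m := by ring
  have a2 : G.n * (G.n * 210 + 20) = 210 * (G.n * G.n) + 20 * G.n := by ring
  have a3 : G.n * (G.n * 210 + 220) = 210 * (G.n * G.n) + 220 * G.n := by ring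
  have a4 : G.n * (G.n * 210 + 420) = 210 * (G.n * G.n) + 420 * G.n := by ring
  have vz : ∀ x, σ.v x = 0 := hσ.v
  refine Tri.seq_le (300 * (G.m + 1)) (1200 * (G.m * G.m) + 2400 * (G.n * G.n)) G.Loaded
    (by omega) (tri_load hw hσ) ?_
  intro σ₁ F₁ L₁
  refine Tri.seq_le _ (900 * (G.m * G.m) + 2300 * (G.n * G.n)) _ ?_
    (tri_arrows hw L₁ ((F₁.v _ rfl).trans (vz _))) ?_
  · omega
  rintro σ₂ F₂ ⟨hA, hk⟩
  have L₂ := L₁.of_frame F₂ (by decide) (by decide)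
  have hpair : ∀ a, 0 < a → a ≤ σ₂.v .k → σ₂.a .node a < G.n * G.n ∧ σ₂.a .tgt a < G.n * G.n := by
    intro a ha hak
    obtain ⟨e, he, f, hf, -, h4, h5⟩ := hA.sound a ha hak
    rw [h4, h5]
    exact ⟨pair_lt (G.src_lt e he) (G.src_lt f hf), pair_lt (G.dst_lt e he) (G.dst_lt f hf)⟩
  refine Tri.seq_le _ (600 * (G.m * G.m) + 2200 * (G.n * G.n)) _ ?_
    (tri_link hw _ rfl hk (fun a ha hak => (hpair a ha hak).1)
      (fun x => by rw [F₂.a _ rfl, F₁.a _ rfl, hσ.a _ (by decide)])) ?_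
  · omega
  rintro σ₃ F₃ ⟨hlist, hh1, hh2⟩
  have L₃ := L₂.of_frame F₃ (by decide) (by decide)
  refine Tri.seq_le _ (600 * (G.m * G.m) + 1900 * (G.n * G.n)) _ ?_
    (tri_seed hw L₃ ?_ ?_) ?_
  · omega
  · rw [F₃.v _ rfl, F₂.v _ rfl, F₁.v _ rfl, vz]
  · intro y
    rw [F₃.a _ rfl, F₂.a _ rfl, F₁.a _ rfl, hσ.a _ (by decide)]
  rintro σ₄ F₄ ⟨hQ, hseed⟩
  have L₄ := L₃.of_frame F₄ (by decide) (by decide)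
  have hnode : σ₄.a .node = σ₂.a .node := (F₄.a _ rfl).trans (F₃.a _ rfl)
  have htgt : σ₄.a .tgt = σ₂.a .tgt := (F₄.a _ rfl).trans (F₃.a _ rfl)
  have hhead : σ₄.a .head = σ₃.a .head := F₄.a _ rfl
  have hprev : σ₄.a .prev = σ₃.a .prev := F₄.a _ rfl
  refine Tri.seq_le _ (1600 * (G.n * G.n)) _ ?_
    (tri_search hw hk le_rfl (P := G.Marked) ?_ ?_ ?_ hQ ?_ ?_ ?_ ?_) ?_
  · have : (G.n * G.n + σ₂.v .k) * 210 ≤ (G.n * G.n + G.m * G.m) * 210 :=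
      Nat.mul_le_mul_right _ (by omega)
    omega
  · intro y hy
    obtain ⟨u, hu, v, hv, h | rfl, rfl⟩ := (hseed y).1 hy
    · exact .lam hu hv h
    · exact .diag hu
  · intro a ha hak
    obtain ⟨e, he, f, hf, h4, h5, h6⟩ := hA.sound a ha hak
    rw [hnode, htgt, h5, h6]
    exact .step he hf h4
  · intro a ha hak
    rw [htgt]
    exact (hpair a ha hak).2
  · rw [F₄.v _ rfl, F₃.v _ rfl, F₂.v _ rfl, F₁.v _ rfl, vz]
  · rwa [hnode, hprev]
  · rwa [hnode, hhead]
  · rwa [hnode, hhead]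
  rintro σ₅ F₅ ⟨hs1, hs2, hs3⟩
  have L₅ := L₄.of_frame F₅ (by decide) (by decide)
  have hmark : ∀ u < G.n, ∀ v < G.n, σ₅.a .mark (u * G.n + v) = 0 ↔ lt u v := by
    intro u hu v hv
    rw [hM u hu v hv, ← not_iff_not, not_not]
    -- Marked nodes are bad by the upper bound of the search. Conversely, bad nodes are marked
    -- because the marked set contains the seeds and is closed under arrows.
    refine ⟨hs1 _, fun h => ?_⟩
    generalize u * G.n + v = y at h
    induction h with
    | lam hu hv h => exact hs2 _ ((hseed _).2 ⟨_, hu, _, hv, Or.inl h, rfl⟩)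
    | diag hu => exact hs2 _ ((hseed _).2 ⟨_, hu, _, hu, Or.inr rfl, rfl⟩)
    | step he hf h _ ih =>
      obtain ⟨a, ha, hak, h5, h6⟩ := hA.complete _ he _ hf trivial h
      have := hs3 a ha hak
      rw [hnode, htgt, h5, h6] at this
      exact this ih
  refine Tri.seq_le _ (1100 * (G.n * G.n)) _ ?_ (tri_count hw L₅.n hmark) ?_
  · omega
  intro σ₆ F₆ hcnt
  have L₆ := L₅.of_frame F₆ (by decide) (by decide)
  have hmark₆ : σ₆.a .mark = σ₅.a .mark := F₆.a _ rfl
  rw [← hmark₆] at hmark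
  refine Tri.seq_le _ (700 * (G.n * G.n)) _ ?_ (tri_sort hw L₆.n hlt hcnt) ?_
  · omega
  intro σ₇ F₇ hS
  have L₇ := L₆.of_frame F₇ (by decide) (by decide)
  have hmark₇ : σ₇.a .mark = σ₆.a .mark := F₇.a _ rfl
  rw [← hmark₇] at hmark
  refine (tri_greedy hw L₇.n ?_ hlt hmark hS).mono ?_ ?_
  · rw [F₇.v _ rfl, F₆.v _ rfl, F₅.v _ rfl, F₄.v _ rfl, F₃.v _ rfl, F₂.v _ rfl, F₁.v _ rfl, vz]
  · omega
  · intro τ F hC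
    refine ⟨L₇.of_frame F (by decide) (by decide), ?_, ?_, ?_⟩
    · rwa [F.a .mark rfl]
    · rwa [F.a .ord rfl]
    · rwa [F.a .ord rfl]

end Input
-- Writing the order and the chains
/-- The list `l` has been written to the memory from the address `b` on; the memory before is as
in `σ₀`. -/
structure Emitted (b : ℕ) (σ₀ : St) (l : List ℕ) (σ : St) : Prop where
  o : σ.v .o = b + l.length
  io : ∀ i < l.length, σ.a .io (b + i) = l.getD i 0
  low : ∀ i < b, σ.a .io i = σ₀.a .io i

namespace Emitted

variable {b : ℕ} {σ₀ σ τ : St} {l : List ℕ}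

theorem congr (h : Emitted b σ₀ l σ) (ho : τ.v .o = σ.v .o) (hio : τ.a .io = σ.a .io) :
    Emitted b σ₀ l τ :=
  ⟨ho.trans h.o, by rw [hio]; exact h.io, by rw [hio]; exact h.low⟩

theorem snoc (h : Emitted b σ₀ l σ) {x : ℕ} (ho : τ.v .o = σ.v .o + 1)
    (hio : τ.a .io = Function.update (σ.a .io) (σ.v .o) x) : Emitted b σ₀ (l ++ [x]) τ := by
  have h0 := h.o
  constructor
  · simp; omega
  · intro i hi
    rw [hio, Function.update_apply]
    simp only [List.length_append, List.length_cons, List.length_nil] at hi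
    split_ifs with h1
    · obtain rfl : i = l.length := by omega
      simp
    · rw [h.io i (by omega), List.getD_append _ _ _ _ (by omega)]
  · intro i hi
    rw [hio, Function.update_of_ne (by omega)]
    exact h.low i hi

theorem tri_emit {w B : ℕ} (hB : 17 ≤ B) (hw : B ^ 16 ≤ 2 ^ w) (h : Emitted b σ₀ l σ) {a : Ex}
    {x : ℕ} (hl : b + l.length + 1 < B) (hsize : a.size ≤ 16) (hcost : a.cost ≤ 100)
    (hok : a.Ok B σ) (hs : a.Small B σ) (hx : a.val σ = x) :
    Tri w B (emit a) σ 150 (Emitted b σ₀ (l ++ [x])) := by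
  have ho := h.o
  refine Tri.of_wp hB hw ?_ ?_ ?_
  · simp only [emit, Stm.block, Stm.fits, hsize]
    rfl
  · simp only [emit, Stm.block, Stm.cost, Ex.cost]
    have : (Ex.var Var.o + 1).cost = 3 := rfl
    omega
  · simp [emit]
    refine ⟨by omega, hok, hs, by omega, ?_⟩
    refine h.snoc ?_ ?_ <;> simp [hx]

/-- A loop that appends the list `g j` in round `j`. -/
theorem tri_loop {w B : ℕ} (hB : 17 ≤ B) (hw : B ^ 16 ≤ 2 ^ w) (h : Emitted b σ₀ l σ) {x N : Var}
    {S : Stm} (K T K' : ℕ) (g : ℕ → List ℕ) (hg : ∀ j < K, (g j).length ≤ K')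
    (hl : b + l.length + K * K' < B)
    (hN : σ.v N = K) (hx : Var.o ≠ x)
    (hxN : N ≠ x) (hxS : S.writesV x = false) (hNS : S.writesV N = false)
    (hS : ∀ σ' j l', Frame (.forLoop x N S) σ σ' → σ'.v x = j → j < K → Emitted b σ₀ l' σ' →
      b + l'.length + K' < B →
      Tri w B S σ' T (Emitted b σ₀ (l' ++ g j))) :
    Tri w B (.forLoop x N S) σ (K * (T + 10) + 10)
      (Emitted b σ₀ (l ++ (List.range K).flatMap g)) := by
  refine Tri.forLoop_le hB hw K T (fun j τ =>
    Emitted b σ₀ (l ++ (List.range j).flatMap g) τ) hN le_rfl hxN hxS hNS ?_ ?_ ?_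
  · have := h.congr (τ := σ.setV x 0) (by simp [hx]) rfl
    simpa using this
  · intro σ' j hF hj hjK hE
    refine (hS σ' j _ hF hj hjK hE ?_).mono le_rfl ?_
    · have h1 : ((List.range j).flatMap g).length ≤ j * K' := by
        rw [List.length_flatMap]
        refine (List.sum_le_card_nsmul _ K' ?_).trans (by simp)
        simp only [List.mem_map, List.mem_range, forall_exists_index, and_imp]
        rintro _ i hi rfl
        exact hg i (by omega)
      have h2 : (j + 1) * K' ≤ K * K' := Nat.mul_le_mul_right _ hjK
      rw [add_mul] at h2
      rw [List.length_append]
      omega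
    · intro τ _ hE
      rw [List.range_succ, List.flatMap_append, ← List.append_assoc]
      have := hE.congr (τ := τ.setV x (j + 1)) (by simp [hx]) rfl
      simpa using this
  · exact fun τ _ h => h

end Emitted

namespace Input

variable {G : Input} {w : ℕ} {σ : St} {lt : ℕ → ℕ → Prop}

open Classical in
/-- The first output. -/
noncomputable def orderList (G : Input) (lt : ℕ → ℕ → Prop) (p : ℕ) (chain : ℕ → ℕ) : List ℕ :=
  ((List.range G.n).flatMap fun u => (List.range G.n).flatMap fun v =>
    [if u = v ∨ lt u v then 1 else 0]) ++ [p] ++ (List.range G.n).flatMap fun v => [chain v]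

theorem tri_emitOrder (hw : G.size ^ 16 ≤ 2 ^ w) (hσ : G.Solved lt σ) :
    Tri w G.size emitOrder σ (4000 * (G.m * G.m + G.n * G.n))
      (fun τ => τ.v .out = σ.v .out ∧
        Emitted (4 + 3 * G.m + G.n) σ (G.orderList lt (σ.v .p) (σ.a .chain)) τ) := by
  classical
  have hB := G.le_size
  have hs := G.size_eq
  have h1 : G.m ≤ G.m * G.m := Nat.le_mul_self _
  have h2 : G.n ≤ G.n * G.n := Nat.le_mul_self _
  have h3 := G.n_pos
  have a1 : G.n * (G.n * 320 + 10 + 10) = 320 * (G.n * G.n) + 20 * G.n := by ring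
  have hL := hσ.loaded
  have hout : (emitOrder).writesV .out = false := rfl
  refine (?_ : Tri w G.size emitOrder σ (4000 * (G.m * G.m + G.n * G.n))
    (Emitted (4 + 3 * G.m + G.n) σ (G.orderList lt (σ.v .p) (σ.a .chain)))).mono le_rfl
    (fun τ hF h => ⟨hF.v _ hout, h⟩)
  refine Tri.seq_le 10 (3000 * (G.n * G.n)) (Emitted (4 + 3 * G.m + G.n) σ []) (by omega)
    (Tri.of_wp hB hw rfl (by decide) ?_) ?_
  · simp [hL.out]
    constructor <;> simp
  intro σ₁ F₁ E₁
  have hn₁ : σ₁.v .n = G.n := (F₁.v _ rfl).trans hL.n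
  refine Tri.seq_le _ (1000 * (G.n * G.n)) _ ?_ (E₁.tri_loop hB hw G.n (G.n * 320 + 10) G.n
    (fun u => (List.range G.n).flatMap fun v => [if u = v ∨ lt u v then 1 else 0]) ?_ ?_ hn₁
    (by decide) (by decide) rfl rfl ?_) ?_
  · omega
  · simp [List.length_flatMap]
  · simp; omega
  · intro σ₂ u l' F₂ hu hun E₂ hlen
    have hn₂ : σ₂.v .n = G.n := (F₂.v _ rfl).trans hn₁
    refine E₂.tri_loop hB hw G.n 310 1 (fun v => [if u = v ∨ lt u v then 1 else 0]) (by simp)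
      (by omega) hn₂ (by decide) (by decide) rfl rfl ?_
    intro σ₃ v l'' F₃ hv hvn E₃ hlen'
    have hn₃ : σ₃.v .n = G.n := (F₃.v _ rfl).trans hn₂
    have hu₃ : σ₃.v .u = u := (F₃.v _ rfl).trans hu
    have hm₃ : σ₃.a .mark = σ.a .mark :=
      (F₃.a _ rfl).trans ((F₂.a _ rfl).trans (F₁.a _ rfl))
    have hp := pair_lt hun hvn
    have ho := E₃.o
    refine Tri.of_wp hB hw rfl (by decide) ?_
    simp [emit, hv, hu₃, hn₃, hm₃, hσ.mark u hun v hvn]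
    refine ⟨?_, fun hne => ⟨by omega, ?_, ?_⟩⟩
    · intro h
      refine ⟨by omega, by omega, by omega, ?_⟩
      refine E₃.snoc ?_ ?_ <;> simp [h]
    · intro h
      refine ⟨by omega, by omega, by omega, ?_⟩
      refine E₃.snoc ?_ ?_ <;> simp [h]
    · intro h
      refine ⟨by omega, by omega, by omega, ?_⟩
      refine E₃.snoc ?_ ?_ <;> simp [h, hne]
  intro σ₂ F₂ E₂
  have hp₂ : σ₂.v .p = σ.v .p := (F₂.v _ rfl).trans (F₁.v _ rfl)
  have hn₂ : σ₂.v .n = G.n := (F₂.v _ rfl).trans hn₁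
  have hpn := hσ.chains.p_le
  refine Tri.seq_le _ (800 * (G.n * G.n)) _ ?_ (E₂.tri_emit hB hw (x := σ.v .p)
    ?_ (by decide) (by decide) trivial trivial hp₂) ?_
  · omega
  · simp [List.length_flatMap]; omega
  intro σ₃ F₃ E₃
  have hn₃ : σ₃.v .n = G.n := (F₃.v _ rfl).trans hn₂
  refine (E₃.tri_loop hB hw G.n 150 1 (fun v => [σ.a .chain v]) (by simp) ?_ hn₃
    (by decide) (by decide) rfl rfl ?_).mono ?_ ?_
  · simp [List.length_flatMap]; omega
  · intro σ₄ v l' F₄ hv hvn E₄ hlen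
    have hc₄ : σ₄.a .chain = σ.a .chain :=
      (F₄.a _ rfl).trans ((F₃.a _ rfl).trans ((F₂.a _ rfl).trans (F₁.a _ rfl)))
    exact E₄.tri_emit hB hw (by omega) (by decide) (by decide) (by simp [hv]; omega) trivial
      (by simp [hv, hc₄])
  · omega
  · intro τ _ h
    simpa [orderList] using h

end Input
-- Listing the states by chain and writing the transform
theorem flatMap_filter {α β : Type*} (l : List α) (q : α → Bool) (g : α → List β) :
    (l.filter q).flatMap g = l.flatMap fun x => if q x then g x else [] := by
  induction l with
  | nil => rfl
  | cons x l ih =>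
    by_cases h : q x <;> simp [h, ih]

namespace Input

variable {G : Input} {w : ℕ} {σ : St} {lt : ℕ → ℕ → Prop}

/-- The order of the states in the index. -/
def ChainLT (lt : ℕ → ℕ → Prop) (chain : ℕ → ℕ) (u v : ℕ) : Prop :=
  chain u < chain v ∨ (chain u = chain v ∧ lt u v)

/-- The greedy algorithm fills each chain in increasing order along `ord`. One pass over `ord` per
chain therefore lists the chain in the right order without further sorting. -/
theorem tri_listStates (hw : G.size ^ 16 ≤ 2 ^ w) (hlt : IntervalOrder G.n lt)
    (hσ : G.Solved lt σ) :
    Tri w G.size listStates σ (1000 * (G.n * G.n))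
      (fun τ => Listing G.n (ChainLT lt (σ.a .chain)) (fun _ => True) G.n (τ.a .lst)) := by
  have hB := G.le_size
  have hs := G.size_eq
  have h2 : G.n ≤ G.n * G.n := Nat.le_mul_of_pos_left _ G.n_pos
  have h3 := G.n_pos
  have a1 : G.n * (G.n * 210 + 10 + 10) = 210 * (G.n * G.n) + 20 * G.n := by ring
  have hpn := hσ.chains.p_le
  have hR : ∀ u, ¬ ChainLT lt (σ.a .chain) u u := fun u => by simp [ChainLT, hlt.irrefl]
  have hp : ∀ v < G.n, σ.a .chain v < σ.v .p := by
    intro v hv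
    obtain ⟨i, hi, rfl⟩ := (hσ.sorted.mem v hv).1 trivial
    exact hσ.chains.chain_lt i hi
  refine Tri.seq_le 2 (600 * (G.n * G.n)) (fun τ => τ.v .k = 0) (by omega)
    (Tri.of_wp hB hw rfl (by decide) (by simp; omega)) ?_
  intro σ₁ hF₁ hk
  have hn₁ : σ₁.v .n = G.n := (hF₁.v _ rfl).trans hσ.loaded.n
  have hp₁ : σ₁.v .p = σ.v .p := hF₁.v _ rfl
  refine Tri.forLoop_le hB hw (σ.v .p) (G.n * 210 + 10) (fun j τ =>
    Listing G.n (ChainLT lt (σ.a .chain)) (fun v => σ.a .chain v < j) (τ.v .k) (τ.a .lst))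
    hp₁ ?_ (by decide) rfl rfl ?_ ?_ ?_
  · have := Nat.mul_le_mul_right (G.n * 210 + 10 + 10) hpn
    omega
  · constructor <;> simp [hk]
  · intro ρ j hF hj hjn hI
    refine Tri.forLoop_le hB hw G.n 200 (fun i τ =>
      Listing G.n (ChainLT lt (σ.a .chain)) (fun v => σ.a .chain v < j ∨
        σ.a .chain v = j ∧ ∃ i' < i, σ.a .ord i' = v) (τ.v .k) (τ.a .lst))
      ((hF.v _ rfl).trans hn₁) le_rfl (by decide) rfl rfl ?_ ?_ ?_
    · simpa using hI
    · intro ρ₁ i hF₂ hi hin hI₁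
      have hj₁ : ρ₁.v .c = j := (hF₂.v _ rfl).trans hj
      have hchain : ρ₁.a .chain = σ.a .chain :=
        (hF₂.a _ rfl).trans ((hF.a _ rfl).trans (hF₁.a _ rfl))
      have hord : ρ₁.a .ord = σ.a .ord :=
        (hF₂.a _ rfl).trans ((hF.a _ rfl).trans (hF₁.a _ rfl))
      have hle := hI₁.le hR
      have hoi := hσ.sorted.ord_lt i hin
      refine Tri.of_wp hB hw rfl (by decide) ?_
      simp [hi, hj₁, hchain, hord]
      and_intros
      all_goals try omega
      · intro h
        and_intros
        all_goals try omega
        refine hI₁.snoc hoi ?_ ?_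
        · intro u hu
          constructor
          · rintro (h1 | ⟨h1, i', hi', rfl⟩)
            · exact Or.inl (Or.inl h1)
            · rcases Nat.le_iff_lt_or_eq.1 hi' with h4 | rfl
              · exact Or.inl (Or.inr ⟨h1, i', h4, rfl⟩)
              · exact Or.inr rfl
          · rintro ((h1 | ⟨h1, i', hi', rfl⟩) | rfl)
            · exact Or.inl h1
            · exact Or.inr ⟨h1, i', by omega, rfl⟩
            · exact Or.inr ⟨h, i, by omega, rfl⟩
        · rintro u hu (h1 | ⟨h1, i', hi', rfl⟩)
          · exact Or.inl (by omega)
          · exact Or.inr ⟨by omega, hσ.chains.asc i' i hi' hin (by omega)⟩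
      · intro h
        refine hI₁.congr ?_
        intro u hu
        constructor
        · rintro (h1 | ⟨h1, i', hi', rfl⟩)
          · exact Or.inl h1
          · rcases Nat.le_iff_lt_or_eq.1 hi' with h4 | rfl
            · exact Or.inr ⟨h1, i', h4, rfl⟩
            · exact absurd h1 h
        · rintro (h1 | ⟨h1, i', hi', rfl⟩)
          · exact Or.inl h1
          · exact Or.inr ⟨h1, i', by omega, rfl⟩
    · intro τ _ hI₁
      refine hI₁.congr ?_
      intro u hu
      obtain ⟨i, hi, h⟩ := (hσ.sorted.mem u hu).1 trivial
      constructor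
      · intro h1
        rcases Nat.lt_succ_iff_lt_or_eq.1 h1 with h1 | h1
        · exact Or.inl h1
        · exact Or.inr ⟨h1, i, hi, h⟩
      · rintro (h1 | ⟨h1, -⟩) <;> omega
  · intro τ _ hI
    have := hI.congr (P' := fun _ => True) (fun v hv => by simpa using hp v hv)
    have h3 := this.eq hR
    rwa [h3] at this

/-- For every state in the list `lst` the number of edges with this state as their `key`, followed
by the data `g` of these edges. -/
def listsOf (G : Input) (lst key : ℕ → ℕ) (g : ℕ → List ℕ) : List ℕ :=
  (List.range G.n).flatMap fun i =>
    ((List.range G.m).filter fun e => key e = lst i).length ::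
      ((List.range G.m).filter fun e => key e = lst i).flatMap g

theorem length_entry_le (lst key : ℕ → ℕ) {g : ℕ → List ℕ} (hg : ∀ e < G.m, (g e).length ≤ 2)
    (i : ℕ) : (((List.range G.m).filter fun e => key e = lst i).length ::
      ((List.range G.m).filter fun e => key e = lst i).flatMap g).length ≤ 1 + G.m * 2 := by
  rw [List.length_cons, List.length_flatMap, add_comm]
  refine Nat.add_le_add_left ((List.sum_le_card_nsmul _ 2 ?_).trans ?_) 1
  · simp only [List.mem_map, List.mem_filter, List.mem_range]
    rintro _ ⟨e, ⟨he, -⟩, rfl⟩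
    exact hg e he
  · have := List.length_filter_le (fun e => decide (key e = lst i)) (List.range G.m)
    simp only [List.length_map, List.length_range, smul_eq_mul] at this ⊢
    omega

theorem length_listsOf_le (lst key : ℕ → ℕ) {g : ℕ → List ℕ}
    (hg : ∀ e < G.m, (g e).length ≤ 2) :
    (G.listsOf lst key g).length ≤ G.n + 2 * (G.n * G.m) := by
  have : (G.listsOf lst key g).length ≤ G.n * (1 + G.m * 2) := by
    unfold listsOf
    rw [List.length_flatMap]
    refine (List.sum_le_card_nsmul _ (1 + G.m * 2) ?_).trans (by simp)
    simp only [List.mem_map, List.mem_range, forall_exists_index, and_imp]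
    rintro _ i hi rfl
    exact length_entry_le lst key hg i
  refine this.trans (le_of_eq (by ring))

/-- For each state the edges are scanned twice, once to count the matching ones and once to write
their data. The writer `a` is arbitrary, except that it changes only the output array and the output
position. -/
theorem tri_emitLists (hw : G.size ^ 16 ≤ 2 ^ w) {b : ℕ} {σ₀ : St} {l : List ℕ}
    (hE : Emitted b σ₀ l σ) {A : Arr} {a : Stm} {key : ℕ → ℕ} {g : ℕ → List ℕ} (hA : A ≠ .io)
    (hav : ∀ x, a.writesV x = decide (x = .o)) (haA : ∀ X, a.writesA X = decide (X = .io))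
    (hn : σ.v .n = G.n) (hm : σ.v .m = G.m)
    (hkey : ∀ e < G.m, σ.a A e = key e) (hg : ∀ e < G.m, (g e).length ≤ 2)
    (hl : b + l.length + (G.n + 2 * (G.n * G.m)) < G.size)
    (ha : ∀ τ l' e, τ.v .e = e → e < G.m → (∀ X, X ≠ .io → τ.a X = σ.a X) →
      Emitted b σ₀ l' τ → b + l'.length + 2 < G.size →
      Tri w G.size a τ 310 (Emitted b σ₀ (l' ++ g e))) :
    Tri w G.size (emitLists A a) σ (1000 * (G.n * G.m) + 1000 * G.n)
      (Emitted b σ₀ (l ++ G.listsOf (σ.a .lst) key g)) := by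
  have hB := G.le_size
  have hs := G.size_eq
  have h2 : G.n ≤ G.n * G.n := Nat.le_mul_of_pos_left _ G.n_pos
  have h1 : G.m ≤ G.n * G.m := Nat.le_mul_of_pos_left _ G.n_pos
  have h3 := G.n_pos
  have a1 : G.n * (G.m * 600 + 300 + 10) = 600 * (G.n * G.m) + 310 * G.n := by ring
  have a2 : G.n * (1 + G.m * 2) = G.n + 2 * (G.n * G.m) := by ring
  refine (hE.tri_loop hB hw G.n (G.m * 600 + 300) (1 + G.m * 2) (fun i =>
    ((List.range G.m).filter fun e => key e = σ.a .lst i).length ::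
      ((List.range G.m).filter fun e => key e = σ.a .lst i).flatMap g)
    (fun i _ => length_entry_le _ _ hg i) (by omega) hn (by decide)
    (by decide) ?_ ?_ ?_).mono (by omega) (fun τ _ h => h)
  · simp [Stm.forLoop, Stm.writesV, hav, emit]
  · simp [Stm.forLoop, Stm.writesV, hav, emit]
  intro σ₁ i l₁ F₁ hi hin E₁ hlen
  have A₁ : ∀ X, X ≠ .io → σ₁.a X = σ.a X := fun X hX => F₁.a X (by
    simp [Stm.forLoop, Stm.writesA, haA, emit, hX])
  have m₁ : σ₁.v .m = G.m := (F₁.v _ (by simp [Stm.forLoop, Stm.writesV, hav, emit])).trans hm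
  refine Tri.seq_le 50 (G.m * 600 + 250) (fun τ => τ.v .v = σ.a .lst i ∧ τ.v .k = 0 ∧
    Emitted b σ₀ l₁ τ) (by omega) (Tri.of_wp hB hw rfl (by decide) ?_) ?_
  · simp [hi, A₁]
    exact ⟨by omega, by omega, E₁.congr (by simp) rfl⟩
  rintro σ₂ F₂ ⟨v₂, k₂, E₂⟩
  have A₂ : ∀ X, X ≠ .io → σ₂.a X = σ.a X := fun X hX => (F₂.a X rfl).trans (A₁ X hX)
  have m₂ : σ₂.v .m = G.m := (F₂.v _ rfl).trans m₁
  refine Tri.seq_le (G.m * 110 + 10) (G.m * 400 + 200) (fun τ =>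
    τ.v .k = ((List.range G.m).filter fun e => key e = σ.a .lst i).length ∧
    Emitted b σ₀ l₁ τ) (by omega) ?_ ?_
  · refine Tri.forLoop_le hB hw G.m 100 (fun j τ =>
      τ.v .k = ((List.range j).filter fun e => key e = σ.a .lst i).length ∧
      Emitted b σ₀ l₁ τ) m₂ (by omega) (by decide) rfl rfl ?_ ?_ ?_
    · exact ⟨by simpa using k₂, E₂.congr (by simp) rfl⟩
    · rintro σ₃ j F₃ hj hjm ⟨k₃, E₃⟩
      have hAj : σ₃.a A j = key j := by rw [F₃.a _ rfl, A₂ _ hA, hkey j hjm]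
      have v₃ : σ₃.v .v = σ.a .lst i := (F₃.v _ rfl).trans v₂
      have hle := List.length_filter_le (fun e => decide (key e = σ.a .lst i)) (List.range j)
      rw [List.length_range] at hle
      refine Tri.of_wp hB hw rfl (Nat.le_of_ble_eq_true rfl) ?_
      simp [hj, hAj, v₃, k₃, List.range_succ, List.filter_append, List.filter_cons]
      refine ⟨by omega, fun h => ⟨by omega, by simp [h], E₃.congr (by simp) rfl⟩,
        fun h => ⟨by simp [h], E₃.congr (by simp) rfl⟩⟩
    · exact fun τ _ h => h
  rintro σ₃ F₃ ⟨k₃, E₃⟩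
  have A₃ : ∀ X, X ≠ .io → σ₃.a X = σ.a X := fun X hX => (F₃.a X rfl).trans (A₂ X hX)
  have m₃ : σ₃.v .m = G.m := (F₃.v _ rfl).trans m₂
  have v₃ : σ₃.v .v = σ.a .lst i := (F₃.v _ rfl).trans v₂
  refine Tri.seq_le 150 (G.m * 400 + 50) _ (by omega) (E₃.tri_emit hB hw (by omega) (by decide)
    (by decide) trivial trivial k₃) ?_
  intro σ₄ F₄ E₄
  have A₄ : ∀ X, X ≠ .io → σ₄.a X = σ.a X := fun X hX =>
    (F₄.a X (by simp [emit, Stm.writesA, hX])).trans (A₃ X hX)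
  have m₄ : σ₄.v .m = G.m := (F₄.v _ rfl).trans m₃
  have v₄ : σ₄.v .v = σ.a .lst i := (F₄.v _ rfl).trans v₃
  refine (E₄.tri_loop hB hw G.m 390 2 (fun e => if key e = σ.a .lst i then g e else []) ?_ ?_ m₄
    (by decide) (by decide) ?_ ?_ ?_).mono (by omega) ?_
  · intro e he
    split_ifs
    · exact hg e he
    · simp
  · rw [List.length_append, List.length_singleton]; omega
  · simp [Stm.writesV, hav]
  · simp [Stm.writesV, hav]
  · intro σ₅ e l₅ F₅ he hem E₅ hlen₅
    have A₅ : ∀ X, X ≠ .io → σ₅.a X = σ.a X := fun X hX =>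
      (F₅.a X (by simp [Stm.forLoop, Stm.writesA, haA, hX])).trans (A₄ X hX)
    have v₅ : σ₅.v .v = σ.a .lst i :=
      (F₅.v _ (by simp [Stm.forLoop, Stm.writesV, hav])).trans v₄
    have hAe : σ₅.a A e = key e := by rw [A₅ _ hA, hkey e hem]
    refine (Tri.ite (T := 310) (T' := 1) hB hw rfl ?_ ?_ ?_).mono (Nat.le_of_ble_eq_true rfl)
      (fun _ _ h => h)
    · simp [he]; omega
    · intro h
      simp [he, hAe, v₅] at h
      rw [if_pos h]
      exact ha σ₅ l₅ e he hem A₅ E₅ hlen₅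
    · intro h
      simp [he, hAe, v₅] at h
      rw [if_neg h]
      exact Tri.skip (by simpa using E₅)
  · intro τ _ h
    simpa [flatMap_filter] using h

/-- The second output. -/
def indexList (G : Input) (p : ℕ) (chain lst : ℕ → ℕ) : List ℕ :=
  [p] ++ G.listsOf lst G.src (fun e => [chain (G.dst e), G.lab e]) ++
    G.listsOf lst G.dst (fun e => [chain (G.src e)]) ++
    (List.range G.n).flatMap fun i => [G.fin (lst i)]

theorem tri_emitIndex (hw : G.size ^ 16 ≤ 2 ^ w) (hL : G.Loaded σ)
    (hlst : ∀ i < G.n, σ.a .lst i < G.n) :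
    Tri w G.size emitIndex σ (4000 * (G.n * G.m + G.n))
      (fun τ => τ.v .out = σ.v .out ∧
        Emitted (4 + 3 * G.m + G.n) σ (G.indexList (σ.v .p) (σ.a .chain) (σ.a .lst)) τ) := by
  have hB := G.le_size
  have hs := G.size_eq
  have h1 : G.m ≤ G.n * G.m := Nat.le_mul_of_pos_left _ G.n_pos
  have h2 : G.n ≤ G.n * G.n := Nat.le_mul_self _
  have h3 := G.n_pos
  have hout : emitIndex.writesV .out = false := rfl
  refine (?_ : Tri w G.size emitIndex σ (4000 * (G.n * G.m + G.n))
    (Emitted (4 + 3 * G.m + G.n) σ (G.indexList (σ.v .p) (σ.a .chain) (σ.a .lst)))).mono le_rfl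
    (fun τ hF h => ⟨hF.v _ hout, h⟩)
  have hlen₁ := G.length_listsOf_le (σ.a .lst) G.src
    (g := fun e => [σ.a .chain (G.dst e), G.lab e]) (by simp)
  have hlen₂ := G.length_listsOf_le (σ.a .lst) G.dst
    (g := fun e => [σ.a .chain (G.src e)]) (by simp)
  refine Tri.seq_le 10 (4000 * (G.n * G.m) + 3000 * G.n) (Emitted (4 + 3 * G.m + G.n) σ [])
    (by omega) (Tri.of_wp hB hw rfl (by decide) ?_) ?_
  · simp [hL.out]
    constructor <;> simp
  intro σ₁ F₁ E₁
  refine Tri.seq_le 150 (4000 * (G.n * G.m) + 2500 * G.n) _ (by omega)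
    (E₁.tri_emit hB hw (x := σ.v .p) (by simp; omega) (by decide) (by decide) trivial trivial
      (F₁.v _ rfl)) ?_
  intro σ₂ F₂ E₂
  have A₂ : ∀ X, X ≠ .io → σ₂.a X = σ.a X := fun X hX =>
    (F₂.a X (by simp [emit, Stm.writesA, hX])).trans (F₁.a X rfl)
  have n₂ : σ₂.v .n = G.n := (F₂.v _ rfl).trans ((F₁.v _ rfl).trans hL.n)
  have m₂ : σ₂.v .m = G.m := (F₂.v _ rfl).trans ((F₁.v _ rfl).trans hL.m)
  refine Tri.seq_le _ (3000 * (G.n * G.m) + 1500 * G.n) _ ?_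
    (tri_emitLists hw E₂ (A := .src) (key := G.src)
      (g := fun e => [σ.a .chain (G.dst e), G.lab e]) (by decide) ?_ ?_ n₂ m₂ ?_ (by simp) ?_ ?_) ?_
  · omega
  · intro x; cases x <;> rfl
  · intro x; cases x <;> rfl
  · intro e he
    rw [A₂ _ (by decide), hL.src e he]
  · simp; omega
  · intro τ l e he hem A hE hl
    have hd := G.dst_lt e hem
    have hd' : τ.a .dst e = G.dst e := by rw [A _ (by decide), A₂ _ (by decide), hL.dst e hem]
    refine Tri.seq_le 150 150 _ (by omega) (hE.tri_emit hB hw (x := σ.a .chain (G.dst e))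
      (by omega) (by decide) (by decide) ?_ trivial ?_) ?_
    · simp [he, hd']; omega
    · simp [he, hd', A, A₂]
    intro τ' F E'
    have he' : τ'.v .e = e := (F.v _ rfl).trans he
    refine (E'.tri_emit hB hw (x := G.lab e) (by simp; omega) (by decide) (by decide) ?_ ?_
      ?_).mono le_rfl ?_
    · simp [he']; omega
    · trivial
    · simp only [Ex.val_ld, Ex.val_var, he']
      rw [F.a _ rfl, A _ (by decide), A₂ _ (by decide), hL.lab e hem]
    · intro _ _ h
      simpa using h
  intro σ₃ F₃ E₃
  rw [A₂ _ (by decide)] at E₃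
  have A₃ : ∀ X, X ≠ .io → σ₃.a X = σ.a X := fun X hX =>
    (F₃.a X (by cases X <;> first | rfl | exact absurd rfl hX)).trans (A₂ X hX)
  have n₃ : σ₃.v .n = G.n := (F₃.v _ rfl).trans n₂
  have m₃ : σ₃.v .m = G.m := (F₃.v _ rfl).trans m₂
  refine Tri.seq_le _ (2000 * (G.n * G.m) + 500 * G.n) _ ?_
    (tri_emitLists hw E₃ (A := .dst) (key := G.dst)
      (g := fun e => [σ.a .chain (G.src e)]) (by decide) ?_ ?_ n₃ m₃ ?_ (by simp) ?_ ?_) ?_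
  · omega
  · intro x; cases x <;> rfl
  · intro x; cases x <;> rfl
  · intro e he
    rw [A₃ _ (by decide), hL.dst e he]
  · simp; omega
  · intro τ l e he hem A hE hl
    have hd := G.src_lt e hem
    have hd' : τ.a .src e = G.src e := by rw [A _ (by decide), A₃ _ (by decide), hL.src e hem]
    refine (hE.tri_emit hB hw (x := σ.a .chain (G.src e))
      (by omega) (by decide) (by decide) ?_ ?_ ?_).mono (by omega) (fun _ _ h => h)
    · simp [he, hd']; omega
    · trivial
    · simp [he, hd', A, A₃]
  intro σ₄ F₄ E₄
  rw [A₃ _ (by decide)] at E₄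
  have A₄ : ∀ X, X ≠ .io → σ₄.a X = σ.a X := fun X hX =>
    (F₄.a X (by cases X <;> first | rfl | exact absurd rfl hX)).trans (A₃ X hX)
  have n₄ : σ₄.v .n = G.n := (F₄.v _ rfl).trans n₃
  have m₄ : σ₄.v .m = G.m := (F₄.v _ rfl).trans m₃
  refine (E₄.tri_loop hB hw G.n 150 1 (fun i => [G.fin (σ.a .lst i)]) (by simp) ?_ n₄
    (by decide) (by decide) rfl rfl ?_).mono (by omega) ?_
  · simp; omega
  · intro τ i l F hi hin hE hl
    have hlsti := hlst i hin
    have hli : τ.a .lst i = σ.a .lst i := by rw [F.a _ rfl, A₄ _ (by decide)]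
    have mτ : τ.v .m = G.m := (F.v _ rfl).trans m₄
    refine hE.tri_emit hB hw (by omega) (by decide) (by decide) ?_ ?_ ?_
    · simp [hi, hli, mτ]; omega
    · trivial
    · simp only [Ex.val_ld, Ex.val_add, Ex.val_mul, Ex.val_var, Ex.val_ofNat, hi, hli, mτ]
      -- The output starts right behind the input, so the bits for the final states can still be
      -- read there.
      rw [hE.low _ (by omega), hL.fin _ hlsti]
  · intro τ _ h
    simpa [indexList] using h

end Input
/- ## The maximal order -/

namespace Automaton

variable {Q α : Type*} {M : Automaton Q α}

theorem IsStandard.lam_eq (hM : M.IsStandard) {u v : Q} {a : α} (h : (u, v, a) ∈ M.E) :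
    M.lam v = a := by
  have hex : ∃ a u, (u, v, a) ∈ M.E := ⟨a, u, h⟩
  obtain ⟨u', hu'⟩ := hex.choose_spec
  rw [lam, dif_pos hex, hM.input_consistent _ _ _ _ _ hu' h]

theorem IsStandard.lam_s (hM : M.IsStandard) : M.lam M.s = ⊥ := by
  rw [lam, dif_neg]
  rintro ⟨a, u, h⟩
  exact hM.no_incoming u ⟨a, h⟩

theorem IsStandard.exists_edge (hM : M.IsStandard) {v : Q} (hv : v ≠ M.s) : ∃ u, M.Edge u v := by
  rcases Relation.ReflTransGen.cases_tail (hM.reachable v) with h | ⟨u, -, h⟩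
  · exact absurd h hv
  · exact ⟨u, h⟩

/-- Only the initial state has label ⊥, so a state that shares its label with a target of an edge is
not initial. This permits stepping back from two states in parallel. -/
theorem IsStandard.exists_edge_of_lam (hM : M.IsStandard) {u u' v : Q} (h : M.Edge u' u)
    (huv : M.lam u = M.lam v) : ∃ v', M.Edge v' v := by
  refine hM.exists_edge ?_
  rintro rfl
  obtain ⟨a, ha⟩ := h
  rw [hM.lam_s, hM.lam_eq ha] at huv
  exact WithBot.coe_ne_bot huv

theorem IsStandard.lam_s_lt [LinearOrder α] (hM : M.IsStandard) {v : Q} (hv : v ≠ M.s) :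
    M.lam M.s < M.lam v := by
  obtain ⟨u, a, h⟩ := hM.exists_edge hv
  rw [hM.lam_s, hM.lam_eq h]
  exact WithBot.bot_lt_coe a

section Order

variable [LinearOrder α]

/-- The pairs of states that are not strictly ordered by any co-lexicographic order. -/
inductive NotBelow (M : Automaton Q α) : Q → Q → Prop
  | refl (u : Q) : NotBelow M u u
  | lam {u v : Q} : M.lam v < M.lam u → NotBelow M u v
  | step {u' u v' v : Q} : M.Edge u' u → M.Edge v' v → M.lam u = M.lam v →
      NotBelow M u' v' → NotBelow M u v

/-- The maximal co-lexicographic order. -/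
def maxOrder (M : Automaton Q α) (u v : Q) : Prop := u = v ∨ ¬ M.NotBelow u v

theorem NotBelow.lam_le {u v : Q} (h : M.NotBelow u v) : M.lam v ≤ M.lam u := by
  cases h with
  | refl => exact le_rfl
  | lam h => exact h.le
  | step _ _ h _ => exact h.ge

/-- Induct along a path from the initial state to `u`, stepping back from `v` in parallel for as
long as the labels agree. At the initial state the labels decide. -/
theorem NotBelow.total (hM : M.IsStandard) (u v : Q) : M.NotBelow u v ∨ M.NotBelow v u := by
  induction hM.reachable u generalizing v with
  | refl =>
    by_cases hv : v = M.s
    · exact Or.inl (hv ▸ .refl _)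
    · exact Or.inr (.lam (hM.lam_s_lt hv))
  | @tail u' u _ hu ih =>
    rcases lt_trichotomy (M.lam u) (M.lam v) with h | h | h
    · exact Or.inr (.lam h)
    · obtain ⟨v', hv⟩ := hM.exists_edge_of_lam hu h
      rcases ih v' with h1 | h1
      · exact Or.inl (.step hu hv h h1)
      · exact Or.inr (.step hv hu h.symm h1)
    · exact Or.inl (.lam h)

/-- The contrapositive is transitivity of the strict order. -/
theorem NotBelow.trans (hM : M.IsStandard) {u z : Q} (h : M.NotBelow u z) (v : Q) :
    M.NotBelow u v ∨ M.NotBelow v z := by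
  induction h generalizing v with
  | refl u => exact NotBelow.total hM u v
  | @lam u z h =>
    rcases lt_or_ge (M.lam v) (M.lam u) with h1 | h1
    · exact Or.inl (.lam h1)
    · exact Or.inr (.lam (h.trans_le h1))
  | @step u' u z' z hu hz h _ ih =>
    rcases lt_trichotomy (M.lam u) (M.lam v) with h1 | h1 | h1
    · exact Or.inr (.lam (h ▸ h1))
    · obtain ⟨v', hv⟩ := hM.exists_edge_of_lam hu h1
      rcases ih v' with h2 | h2
      · exact Or.inl (.step hu hv h1 h2)
      · exact Or.inr (.step hv hz (h1.symm.trans h) h2)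
    · exact Or.inl (.lam h1)

/-- In words: let α ≥ β reach `u` and `y`, and let γ ≥ δ reach `x` and `v`. If α ≥ δ, then (u, v) is
bad; otherwise γ ≥ δ > α ≥ β, so (x, y) is bad. The induction walks back from all four states at
once. -/
theorem NotBelow.interval (hM : M.IsStandard) {u y : Q} (h : M.NotBelow u y) {x v : Q}
    (h' : M.NotBelow x v) : M.NotBelow u v ∨ M.NotBelow x y := by
  induction h generalizing x v with
  | refl u => exact (h'.trans hM u).symm
  | @lam u y h =>
    rcases lt_or_ge (M.lam v) (M.lam u) with h1 | h1
    · exact Or.inl (.lam h1)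
    · exact Or.inr (.lam (h.trans_le (h1.trans h'.lam_le)))
  | @step u' u y' y hu hy h h1 ih =>
    rcases lt_or_ge (M.lam v) (M.lam u) with h2 | h2
    · exact Or.inl (.lam h2)
    rcases lt_or_ge (M.lam y) (M.lam x) with h3 | h3
    · exact Or.inr (.lam h3)
    -- If no label settles the claim, then λ(u) ≤ λ(v) ≤ λ(x) ≤ λ(y) = λ(u), and all four labels
    -- coincide.
    have h4 : M.lam u = M.lam v := le_antisymm h2 (h'.lam_le.trans (h3.trans h.ge))
    have h5 : M.lam x = M.lam y := le_antisymm h3 (h ▸ h2.trans h'.lam_le)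
    cases h' with
    | refl => exact (NotBelow.step hu hy h h1).trans hM x
    | lam h6 => exact absurd h6 (not_lt.2 (h3.trans (h ▸ h2)))
    | @step x' _ v' _ hx hv h6 h7 =>
      rcases ih h7 with h8 | h8
      · exact Or.inl (.step hu hv h4 h8)
      · exact Or.inr (.step hx hy h5 h8)

theorem maxOrder_antisymm (hM : M.IsStandard) {u v : Q} (h : M.maxOrder u v)
    (h' : M.maxOrder v u) : u = v := by
  by_contra hne
  exact (NotBelow.total hM u v).elim (h.resolve_left hne) (h'.resolve_left (Ne.symm hne))

theorem maxOrder_isCoLex (hM : M.IsStandard) : M.IsCoLex M.maxOrder where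
  refl u := Or.inl rfl
  antisymm u v := maxOrder_antisymm hM
  trans u v z := by
    rintro (rfl | h) (rfl | h')
    · exact Or.inl rfl
    · exact Or.inr h'
    · exact Or.inr h
    · exact Or.inr fun h1 => (h1.trans hM v).elim h h'
  axiom_one u v h := ⟨Or.inr fun h' => absurd h'.lam_le (not_le.2 h), fun h' => h.ne (h' ▸ rfl)⟩
  axiom_two u₁ u v₁ v hu hv hl h hne := Or.inr fun h' => h.resolve_left hne (.step hu hv hl h')

/-- A strict inequality on a bad pair would propagate back along the two edges by the second axiom,
until it contradicts the first axiom or irreflexivity. -/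
theorem IsCoLex.le_maxOrder (hM : M.IsStandard) (hD : M.IsDeterministic) {le : Q → Q → Prop}
    (h : M.IsCoLex le) {u v : Q} (huv : le u v) : M.maxOrder u v := by
  by_cases hne : u = v
  · exact Or.inl hne
  · refine Or.inr fun hb => ?_
    induction hb with
    | refl => exact hne rfl
    | lam h1 => exact hne (h.antisymm _ _ huv (h.axiom_one _ _ h1).1)
    | step hu hv hl _ ih =>
      refine ih (h.axiom_two _ _ _ _ hu hv hl huv hne) ?_
      -- The second axiom yields only a weak inequality between the sources. If the sources
      -- coincide, determinism makes the targets equal, because their labels agree.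
      rintro rfl
      obtain ⟨a, ha⟩ := hu
      obtain ⟨b, hb⟩ := hv
      rw [hM.lam_eq ha, hM.lam_eq hb, WithBot.coe_inj] at hl
      exact hne (hD _ _ _ _ ha (hl ▸ hb))

theorem maxOrder_isMaximal (hM : M.IsStandard) (hD : M.IsDeterministic) :
    M.IsMaximalCoLex M.maxOrder ∧ ∀ le, M.IsMaximalCoLex le → le = M.maxOrder := by
  refine ⟨⟨maxOrder_isCoLex hM, fun le h h' => ?_⟩, fun le h => ?_⟩
  · ext u v
    exact ⟨h.le_maxOrder hM hD, h' u v⟩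
  · exact (h.2 _ (maxOrder_isCoLex hM) fun u v => h.1.le_maxOrder hM hD).symm

/-- The antichain `f` meets every chain at most once, so p is a lower bound for decompositions of
the maximal order. A chain for any co-lexicographic order is a chain for the maximal one, which
extends the bound to the width. -/
theorem width_eq (hM : M.IsStandard) (hD : M.IsDeterministic) {p : ℕ} {chain : Q → Fin p}
    (hC : IsChainDecomposition M.maxOrder chain) (f : Fin p → Q)
    (hf : ∀ i j, i ≠ j → f i ≠ f j ∧ ¬ M.maxOrder (f i) (f j)) :
    M.width = p ∧ IsSmallestChainDecomposition M.maxOrder chain := by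
  have key : ∀ (r : ℕ) (chain₁ : Q → Fin r), IsChainDecomposition M.maxOrder chain₁ → p ≤ r := by
    intro r chain₁ h₁
    have hinj : Function.Injective (chain₁ ∘ f) := by
      intro i j hij
      by_contra hne
      rcases h₁.2 (chain₁ (f i)) rfl hij.symm (hf i j hne).1 with h | h
      · exact (hf i j hne).2 h
      · exact (hf j i (Ne.symm hne)).2 h
    simpa using Fintype.card_le_of_injective _ hinj
  refine ⟨le_antisymm (Nat.sInf_le ⟨_, maxOrder_isCoLex hM, chain, hC⟩) ?_, hC, key⟩
  refine le_csInf ⟨p, _, maxOrder_isCoLex hM, chain, hC⟩ ?_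
  rintro r ⟨le, hle, chain₁, h₁, h₂⟩
  refine key r chain₁ ⟨h₁, fun i => ?_⟩
  intro u hu v hv huv
  exact (h₂ i hu hv huv).imp (hle.le_maxOrder hM hD) (hle.le_maxOrder hM hD)

end Order

end Automaton

/- ## Runs from the initial state of the machine -/

/-- Put `(2 * (|Q| + |E| + 4)) ^ 2` into register `1`. -/
def prologue : Prog :=
  -- Register 5 still contains 0, the address of the number of states.
  .seq (.instr (.load 3 5)) (.seq (.instr (.const 7 1)) (.seq (.instr (.load 7 7))
    (.seq (.instr (.bin .add 3 3 7)) (.seq (.instr (.const 7 4)) (.seq (.instr (.bin .add 3 3 7))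
      (.seq (.instr (.bin .add 3 3 3)) (.instr (.bin .mul 1 3 3))))))))

theorem exec_prologue {w B n m : ℕ} (hB : 17 ≤ B) (hw : B ^ 16 ≤ 2 ^ w) {input : List ℕ}
    (hn : input.getD 0 0 = n) (hm : input.getD 1 0 = m) (hBnm : B = (2 * (n + m + 4)) ^ 2)
    (hlen : input.length ≤ B) (hlt : ∀ i, input.getD i 0 < B) :
    ∃ c, Exec prologue (State.init w input) 8 c ∧
      Abs B c ⟨fun _ => 0, fun A i => if A = .io then input.getD i 0 else 0⟩ := by
  have hBw : B < 2 ^ w := lt_of_lt_of_le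
    (by calc B = B ^ 1 := (pow_one B).symm
          _ < B ^ 16 := Nat.pow_lt_pow_right (by omega) (by omega)) hw
  have h4 : 2 * (n + m + 4) < 2 ^ w := lt_of_le_of_lt (hBnm ▸ Nat.le_self_pow (by omega) _) hBw
  refine ⟨_, .seq (.instr _ _) (.seq (.instr _ _) (.seq (.instr _ _) (.seq (.instr _ _)
    (.seq (.instr _ _) (.seq (.instr _ _) (.seq (.instr _ _) (.instr _ _))))))), ?_⟩
  have hone : 1 % 2 ^ w = 1 := Nat.mod_eq_of_lt (by omega)
  constructor
  · intro x
    simp only [Instr.exec]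
    repeat rw [Function.update_of_ne (by omega)]
    rfl
  · rw [List.getD_eq_getElem?_getD] at hn hm
    simp [Instr.exec, Op.eval, State.init, BitVec.toNat_add, BitVec.toNat_mul, hone, hm, hn]
    rw [Nat.mod_eq_of_lt]
    · rw [hBnm]; ring
    · have : n + m + 4 + (n + m + 4) = 2 * (n + m + 4) := by ring
      rw [this, ← sq, ← hBnm]
      exact hBw
  · intro A i hi
    have hadr := Arr.address_lt hB hw A hi
    simp only [Instr.exec, State.init, BitVec.toNat_ofNat, Nat.mod_eq_of_lt hadr]
    split_ifs with h
    · subst h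
      rw [Nat.mod_eq_of_lt ((hlt _).trans hBw)]
      simp [Arr.idx]
    -- All arrays other than `io` begin at address `B` or later, behind the input, so they are
    -- initially 0.
    · have : 1 ≤ A.idx := by
        cases A <;> first | exact absurd rfl h | decide
      have : B ≤ A.idx * B := Nat.le_mul_of_pos_left _ this
      rw [List.getD_eq_default _ _ (by omega)]
      simp
  · intro x
    simp only
    omega
  · intro A i
    simp only
    split_ifs
    · exact hlt i
    · omega

theorem computes_of_tri {w B n m : ℕ} (hB : 17 ≤ B) (hw : B ^ 16 ≤ 2 ^ w) {input : List ℕ}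
    (hn : input.getD 0 0 = n) (hm : input.getD 1 0 = m) (hBnm : B = (2 * (n + m + 4)) ^ 2)
    (hlen : input.length ≤ B) (hlt : ∀ i, input.getD i 0 < B) {S : Stm} {T b : ℕ}
    {Post : St → List ℕ → Prop}
    (h : Tri w B S ⟨fun _ => 0, fun A i => if A = .io then input.getD i 0 else 0⟩ T
      (fun τ => ∃ l, Post τ l ∧ τ.v .out = b ∧ ∃ σ₀, Emitted b σ₀ l τ)) :
    ∃ t τ l, Post τ l ∧ (Prog.seq prologue S.code).Computes w input t l ∧ t ≤ T + 8 := by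
  obtain ⟨c, hx, hc⟩ := exec_prologue hB hw hn hm hBnm hlen hlt
  obtain ⟨t, c', τ, hx', ht, ha, -, l, hP, ho, σ₀, hE⟩ := h c hc
  have hreg : (c'.reg 0).toNat = b := (ha.v .out).trans ho
  have hlB : b + l.length < B := hE.o ▸ ha.v_lt .o
  have hBw : B < 2 ^ w := lt_of_lt_of_le
    (by calc B = B ^ 1 := (pow_one B).symm
          _ < B ^ 16 := Nat.pow_lt_pow_right (by omega) (by omega)) hw
  refine ⟨_, τ, l, hP, ⟨c', .seq hx hx', ?_, ?_⟩, by omega⟩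
  · omega
  · intro i hi
    have := ha.a .io (b + i) (by omega)
    rw [hreg]
    simp only [Arr.idx, zero_mul, zero_add] at this
    rw [this, hE.io i hi, List.getD_eq_getElem _ _ hi]

/- ## From automata to numbers -/

theorem getD_flatMap_triple (l : List (ℕ × ℕ × ℕ)) {e : ℕ} (he : e < l.length) {j : ℕ}
    (hj : j < 3) (r : List ℕ) :
    (l.flatMap (fun t => [t.1, t.2.1, t.2.2]) ++ r).getD (3 * e + j) 0 =
      [(l.getD e 0).1, (l.getD e 0).2.1, (l.getD e 0).2.2].getD j 0 := by
  induction l generalizing e with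
  | nil => simp at he
  | cons t l ih =>
    cases e with
    | zero => interval_cases j <;> simp
    | succ e =>
      have := ih (e := e) (by simpa using he)
      rw [show 3 * (e + 1) + j = 3 * e + j + 3 by ring]
      simpa using this

section

variable {Q α : Type*} [Fintype Q] [Fintype α] [LinearOrder α] {M : Automaton Q α}

theorem rank_lt_rank {a b : α} (h : a < b) : rank a < rank b := by
  refine Finset.card_lt_card (Finset.ssubset_iff_of_subset ?_ |>.2 ⟨a, ?_, ?_⟩)
  · intro c
    simp only [Finset.mem_filter, Finset.mem_univ, true_and]
    exact fun hc => hc.trans h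
  · simpa using h
  · simp

theorem rank_lt_card (a : α) : rank a < Fintype.card α := by
  refine Finset.card_lt_card (Finset.ssubset_iff_of_subset (Finset.filter_subset _ _) |>.2
    ⟨a, Finset.mem_univ a, by simp⟩)

/-- The number that represents a label in the array of labels. -/
def labelRank : WithBot α → ℕ
  | ⊥ => 0
  | (a : α) => rank a + 1

theorem labelRank_lt {x y : WithBot α} : labelRank x < labelRank y ↔ x < y := by
  have mono : StrictMono (labelRank : WithBot α → ℕ) := by
    intro x y h
    induction x using WithBot.recBotCoe with
    | bot =>
      induction y using WithBot.recBotCoe with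
      | bot => exact absurd h (lt_irrefl _)
      | coe b => exact Nat.succ_pos _
    | coe a =>
      induction y using WithBot.recBotCoe with
      | bot => exact absurd h not_lt_bot
      | coe b => exact Nat.succ_lt_succ (rank_lt_rank (WithBot.coe_lt_coe.1 h))
  exact mono.lt_iff_lt

theorem labelRank_inj {x y : WithBot α} : labelRank x = labelRank y ↔ x = y := by
  rcases lt_trichotomy x y with h | h | h
  · exact iff_of_false (labelRank_lt.2 h).ne h.ne
  · simp [h]
  · exact iff_of_false (labelRank_lt.2 h).ne' h.ne'

namespace Automaton

omit [Fintype Q] [LinearOrder α] in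
-- Every character labels an edge, so ranks are bounded by the number of edges and fit into the
-- arrays.
theorem IsStandard.card_alphabet_le (hM : M.IsStandard) : Fintype.card α ≤ M.E.card := by
  choose f g h using hM.effective
  have := Finset.card_le_card_of_injOn (s := (Finset.univ : Finset α)) (t := M.E)
    (fun a => (f a, g a, a)) (fun a _ => h a) (fun a _ b _ hab => by simpa using (by simpa using hab : _ ∧ _ ∧ _).2.2)
  simpa using this

omit [Fintype α] [LinearOrder α] in
-- The label of an edge is determined by its target. Hence |E| ≤ |Q|², and a word length logarithmic
-- in |Q| alone suffices.
theorem IsStandard.card_edges_le (hM : M.IsStandard) :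
    M.E.card ≤ Fintype.card Q * Fintype.card Q := by
  have := Finset.card_le_card_of_injOn (s := M.E) (t := (Finset.univ : Finset (Q × Q)))
    (fun e => (e.1, e.2.1)) (fun a _ => Finset.mem_univ _) ?_
  · simpa using this
  · rintro ⟨u, v, a⟩ h ⟨u', v', a'⟩ h' h1
    simp only [Prod.mk.injEq] at h1
    obtain ⟨rfl, rfl⟩ := h1
    rw [hM.input_consistent u u v a a' h h']

end Automaton

namespace Presentation

variable (D : Presentation M)

omit [Fintype α] [LinearOrder α] in
theorem coe_edges : (D.edges : Multiset (Q × Q × α)) = M.E.val :=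
  (Multiset.Nodup.ext (Multiset.coe_nodup.2 D.nodup) M.E.nodup).2 fun e => by simpa using D.mem_edges e

omit [Fintype α] [LinearOrder α] in
theorem length_edges : D.edges.length = M.E.card := by
  rw [Finset.card_def, ← D.coe_edges, Multiset.coe_card]

/-- The edges in numbers. -/
def triple (e : Q × Q × α) : ℕ × ℕ × ℕ := (D.idx e.1, D.idx e.2.1, rank e.2.2)

def triples : List (ℕ × ℕ × ℕ) := D.edges.map D.triple

theorem length_triples : D.triples.length = M.E.card := by
  rw [triples, List.length_map, D.length_edges]

theorem exists_triple {e : ℕ} (he : e < M.E.card) :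
    ∃ u v a, (u, v, a) ∈ M.E ∧ D.triples.getD e 0 = D.triple (u, v, a) := by
  have h : e < D.edges.length := by rwa [D.length_edges]
  refine ⟨D.edges[e].1, D.edges[e].2.1, D.edges[e].2.2, (D.mem_edges _).1 (List.getElem_mem h), ?_⟩
  rw [List.getD_eq_getElem _ _ (by rwa [D.length_triples])]
  simp [triples]

theorem exists_index {u v : Q} {a : α} (h : (u, v, a) ∈ M.E) :
    ∃ e < M.E.card, D.triples.getD e 0 = D.triple (u, v, a) := by
  obtain ⟨e, he, h1⟩ := List.getElem_of_mem ((D.mem_edges _).2 h)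
  refine ⟨e, by rwa [← D.length_edges], ?_⟩
  rw [List.getD_eq_getElem _ _ (by rwa [triples, List.length_map])]
  simp [triples, h1]

/-- The state with a given number. -/
def state (u : ℕ) (hu : u < Fintype.card Q) : Q := D.idx.symm ⟨u, hu⟩

omit [Fintype α] [LinearOrder α] in
@[simp] theorem state_idx (v : Q) : D.state (D.idx v) (D.idx v).2 = v := by simp [state]

omit [Fintype α] [LinearOrder α] in
@[simp] theorem idx_state {u : ℕ} (hu : u < Fintype.card Q) : (D.idx (D.state u hu) : ℕ) = u := by
  simp [state]

open Classical in
/-- The input as a family of functions on the numbers. -/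
noncomputable def input (hM : M.IsStandard) : Input where
  n := Fintype.card Q
  m := M.E.card
  src e := (D.triples.getD e 0).1
  dst e := (D.triples.getD e 0).2.1
  lab e := (D.triples.getD e 0).2.2
  lam v := if hv : v < Fintype.card Q then labelRank (M.lam (D.state v hv)) else 0
  fin v := if hv : v < Fintype.card Q then if D.state v hv ∈ M.F then 1 else 0 else 0
  n_pos := Fintype.card_pos_iff.2 ⟨M.s⟩
  src_lt e he := by
    obtain ⟨u, v, a, -, h⟩ := D.exists_triple he
    rw [h]
    exact (D.idx u).2
  dst_lt e he := by
    obtain ⟨u, v, a, -, h⟩ := D.exists_triple he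
    rw [h]
    exact (D.idx v).2
  lab_lt e he := by
    obtain ⟨u, v, a, -, h⟩ := D.exists_triple he
    rw [h]
    exact (rank_lt_card a).trans_le hM.card_alphabet_le
  lam_dst e he := by
    obtain ⟨u, v, a, h1, h⟩ := D.exists_triple he
    rw [h]
    simp [triple, hM.lam_eq h1, labelRank]
  lam_eq_zero v hv h := by
    rw [dif_pos hv]
    by_cases hs : D.state v hv = M.s
    · rw [hs, hM.lam_s]; rfl
    · obtain ⟨u, a, h1⟩ := hM.exists_edge hs
      obtain ⟨e, he, h2⟩ := D.exists_index h1
      refine absurd ?_ (h e he)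
      rw [h2]
      simp [triple]

variable (hM : M.IsStandard)

theorem code_eq : ∃ r : List ℕ, D.code = Fintype.card Q :: M.E.card :: Fintype.card α ::
    (D.idx M.s : ℕ) :: (D.triples.flatMap (fun t => [t.1, t.2.1, t.2.2]) ++ r) ∧
    r.length = Fintype.card Q ∧ ∀ v < Fintype.card Q, r.getD v 0 = (D.input hM).fin v := by
  classical
  refine ⟨List.ofFn (fun i => if D.idx.symm i ∈ M.F then 1 else 0), ?_, by simp, ?_⟩
  · simp [Presentation.code, triples, triple, List.flatMap_map]
  · intro v hv
    rw [List.getD_eq_getElem _ _ (by simpa using hv)]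
    simp only [List.getElem_ofFn, input, hv, dif_pos, state]
    congr

theorem start : (D.input hM).Start
    ⟨fun _ => 0, fun A i => if A = .io then D.code.getD i 0 else 0⟩ := by
  obtain ⟨r, h, hr, hr'⟩ := D.code_eq hM
  have hlen : (D.triples.flatMap (fun t => [t.1, t.2.1, t.2.2])).length = 3 * M.E.card := by
    simp [List.length_flatMap, D.length_triples, mul_comm]
  have key : ∀ i, D.code.getD (4 + i) 0 =
      (D.triples.flatMap (fun t => [t.1, t.2.1, t.2.2]) ++ r).getD i 0 := by
    intro i
    rw [h, add_comm]
    simp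
  constructor
  · simp [h, input]
  · simp [h, input]
  · intro e he
    have := getD_flatMap_triple D.triples (e := e) (by rwa [D.length_triples])
      (show 0 < 3 by omega) r
    simp only [if_true, key]
    simpa [input] using this
  · intro e he
    have := getD_flatMap_triple D.triples (e := e) (by rwa [D.length_triples])
      (show 1 < 3 by omega) r
    simp only [if_true, show 5 + 3 * e = 4 + (3 * e + 1) by ring, key]
    simpa [input] using this
  · intro e he
    have := getD_flatMap_triple D.triples (e := e) (by rwa [D.length_triples])
      (show 2 < 3 by omega) r
    simp only [if_true, show 6 + 3 * e = 4 + (3 * e + 2) by ring, key]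
    simpa [input] using this
  · intro v hv
    have hm : (D.input hM).m = M.E.card := rfl
    simp only [if_true, add_assoc, key]
    rw [List.getD_append_right _ _ _ _ (by rw [hlen, hm]; omega), hlen, hm,
      Nat.add_sub_cancel_left, hr' v hv]
  · exact fun _ => rfl
  · intro A hA i
    simp [hA]

theorem length_code : D.code.length ≤ (D.input hM).size := by
  obtain ⟨r, h, hr, -⟩ := D.code_eq hM
  have hlen : (D.triples.flatMap (fun t => [t.1, t.2.1, t.2.2])).length = 3 * M.E.card := by
    simp [List.length_flatMap, D.length_triples, mul_comm]
  have hs := (D.input hM).size_eq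
  have hn : (D.input hM).n = Fintype.card Q := rfl
  have hm : (D.input hM).m = M.E.card := rfl
  rw [h]
  simp only [List.length_cons, List.length_append, hlen, hr]
  omega

theorem code_lt (i : ℕ) : D.code.getD i 0 < (D.input hM).size := by
  classical
  have hs := (D.input hM).size_eq
  have hn : (D.input hM).n = Fintype.card Q := rfl
  have hm : (D.input hM).m = M.E.card := rfl
  have ha := hM.card_alphabet_le
  by_cases hi : i < D.code.length
  · rw [List.getD_eq_getElem _ _ hi]
    have := List.getElem_mem hi
    revert this
    generalize D.code[i] = x
    simp only [Presentation.code, List.mem_append, List.mem_cons, List.not_mem_nil, or_false,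
      List.mem_flatMap, List.mem_ofFn]
    rintro (((rfl | rfl | rfl | rfl) | ⟨e, he, (rfl | rfl | rfl)⟩) | ⟨j, rfl⟩)
    · omega
    · omega
    · omega
    · have := (D.idx M.s).2; omega
    · have := (D.idx e.1).2; omega
    · have := (D.idx e.2.1).2; omega
    · have := rank_lt_card e.2.2; omega
    · split_ifs <;> omega
  · rw [List.getD_eq_default _ _ (by omega)]
    omega

theorem two_mul_le_pow {n m : ℕ} (hn : 0 < n) (hm : m ≤ n * n) :
    2 * (n + m + 4) ≤ (n + 1) ^ 5 := by
  have : 2 * (n + n * n + 4) ≤ (n + 1) ^ 5 := by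
    obtain ⟨k, rfl⟩ : ∃ k, n = k + 1 := ⟨n - 1, by omega⟩
    ring_nf
    nlinarith [sq_nonneg k, Nat.zero_le (k ^ 3), Nat.zero_le (k ^ 4), Nat.zero_le (k ^ 5)]
  omega

/-- The word-size constant is 160 = 5 · 2 · 16: the base of the square `size` is at most (|Q| + 1)⁵,
and expressions stay below the 16th power of `size`. -/
theorem size_pow_le {w : ℕ} (hw : 160 * (Nat.log 2 (Fintype.card Q) + 1) ≤ w) :
    (D.input hM).size ^ 16 ≤ 2 ^ w := by
  have hn : (D.input hM).n = Fintype.card Q := rfl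
  have hm : (D.input hM).m = M.E.card := rfl
  have hE := hM.card_edges_le
  have hpos : 0 < Fintype.card Q := Fintype.card_pos_iff.2 ⟨M.s⟩
  set n := Fintype.card Q
  have h1 : n + 1 ≤ 2 ^ (Nat.log 2 n + 1) := Nat.lt_pow_succ_log_self (by omega) n
  have h2 : 2 * (n + M.E.card + 4) ≤ (n + 1) ^ 5 := two_mul_le_pow hpos hE
  calc (D.input hM).size ^ 16 = ((2 * (n + M.E.card + 4)) ^ 2) ^ 16 := rfl
    _ ≤ (((n + 1) ^ 5) ^ 2) ^ 16 := by gcongr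
    _ = (n + 1) ^ 160 := by ring
    _ ≤ (2 ^ (Nat.log 2 n + 1)) ^ 160 := by gcongr
    _ = 2 ^ (160 * (Nat.log 2 n + 1)) := by rw [← pow_mul, mul_comm]
    _ ≤ 2 ^ w := Nat.pow_le_pow_right (by omega) hw

/-- The strict order on the numbers of the states. -/
def below (u v : ℕ) : Prop :=
  ∃ (hu : u < Fintype.card Q) (hv : v < Fintype.card Q), ¬ M.NotBelow (D.state u hu) (D.state v hv)

omit [Fintype α] in
theorem below_idx (u v : Q) : D.below (D.idx u) (D.idx v) ↔ ¬ M.NotBelow u v := by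
  constructor
  · rintro ⟨_, _, h⟩
    simpa using h
  · intro h
    exact ⟨(D.idx u).2, (D.idx v).2, by simpa using h⟩

include hM in
omit [Fintype α] in
theorem intervalOrder : IntervalOrder (Fintype.card Q) D.below where
  lt_left _ _ h := h.1
  irrefl u := fun ⟨_, _, h⟩ => h (.refl _)
  trans u v z := by
    rintro ⟨hu, hv, h⟩ ⟨_, hz, h'⟩
    exact ⟨hu, hz, fun h1 => (h1.trans hM _).elim h h'⟩
  interval u v x y := by
    rintro ⟨hu, hv, h⟩ ⟨hx, hy, h'⟩
    by_contra hc
    rw [not_or] at hc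
    have h1 : M.NotBelow (D.state u hu) (D.state y hy) := by
      by_contra h1
      exact hc.1 ⟨hu, hy, h1⟩
    have h2 : M.NotBelow (D.state x hx) (D.state v hv) := by
      by_contra h2
      exact hc.2 ⟨hx, hv, h2⟩
    exact (h1.interval hM h2).elim h h'

theorem lam_input (v : Q) : (D.input hM).lam (D.idx v) = labelRank (M.lam v) := by
  simp [input]

theorem below_iff {u v : ℕ} (hu : u < Fintype.card Q) (hv : v < Fintype.card Q) :
    D.below u v ↔ ¬ (D.input hM).Marked (u * Fintype.card Q + v) := by
  have h1 : D.below u v ↔ ¬ M.NotBelow (D.state u hu) (D.state v hv) :=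
    ⟨fun ⟨_, _, h⟩ => h, fun h => ⟨hu, hv, h⟩⟩
  rw [h1, not_iff_not]
  constructor
  · have key : ∀ {x y : Q}, M.NotBelow x y →
        (D.input hM).Marked (D.idx x * Fintype.card Q + D.idx y) := by
      intro x y h
      induction h with
      | refl x => exact .diag (D.idx x).2
      | @lam x y h =>
        refine .lam (D.idx x).2 (D.idx y).2 ?_
        rw [lam_input, lam_input]
        exact labelRank_lt.2 h
      | @step x' x y' y hx hy h _ ih =>
        obtain ⟨a, ha⟩ := hx
        obtain ⟨b, hb⟩ := hy
        obtain ⟨e, he, h2⟩ := D.exists_index ha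
        obtain ⟨f, hf, h3⟩ := D.exists_index hb
        have e1 : (D.input hM).src e = D.idx x' := congrArg Prod.fst h2
        have e2 : (D.input hM).dst e = D.idx x := congrArg (·.2.1) h2
        have f1 : (D.input hM).src f = D.idx y' := congrArg Prod.fst h3
        have f2 : (D.input hM).dst f = D.idx y := congrArg (·.2.1) h3
        rw [← e1, ← f1] at ih
        rw [← e2, ← f2]
        refine .step he hf ?_ ih
        rw [e2, f2, lam_input, lam_input, h]
    intro h
    simpa using key h
  -- The induction runs over codes of pairs, so the code is kept as a variable and decoded in each
  -- case by injectivity of u * n + v.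
  · have key : ∀ {z : ℕ}, (D.input hM).Marked z → ∀ x y : Q,
        z = D.idx x * Fintype.card Q + D.idx y → M.NotBelow x y := by
      intro z h
      induction h with
      | @lam u v hu hv h =>
        intro x y hxy
        obtain ⟨rfl, rfl⟩ := Input.pair_inj hv (D.idx y).2 hxy
        rw [lam_input, lam_input] at h
        exact .lam (labelRank_lt.1 h)
      | @diag u hu =>
        intro x y hxy
        obtain ⟨h1, h2⟩ := Input.pair_inj hu (D.idx y).2 hxy
        have : x = y := D.idx.injective (Fin.ext (h1.symm.trans h2))
        exact this ▸ .refl _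
      | @step e f he hf h _ ih =>
        intro x y hxy
        obtain ⟨h1, h2⟩ := Input.pair_inj ((D.input hM).dst_lt f hf) (D.idx y).2 hxy
        obtain ⟨u, v, a, hE, h3⟩ := D.exists_triple he
        obtain ⟨u', v', a', hE', h4⟩ := D.exists_triple hf
        have e1 : (D.input hM).src e = D.idx u := congrArg Prod.fst h3
        have e2 : (D.input hM).dst e = D.idx v := congrArg (·.2.1) h3
        have f1 : (D.input hM).src f = D.idx u' := congrArg Prod.fst h4
        have f2 : (D.input hM).dst f = D.idx v' := congrArg (·.2.1) h4
        obtain rfl : v = x := D.idx.injective (Fin.ext (e2.symm.trans h1))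
        obtain rfl : v' = y := D.idx.injective (Fin.ext (f2.symm.trans h2))
        rw [e2, f2, lam_input, lam_input, labelRank_inj] at h
        refine .step ⟨a, hE⟩ ⟨a', hE'⟩ h (ih u u' ?_)
        rw [e1, f1]
        rfl
    intro h
    exact key h _ _ (by simp)

end Presentation

end

/-! ### The lists written by the programs as codes of the required objects -/

section

variable {Q α : Type*} [Fintype Q] [Fintype α] [LinearOrder α] {M : Automaton Q α}

namespace Presentation

variable (D : Presentation M) (hM : M.IsStandard)

omit [Fintype α] in
theorem maxOrder_iff (u v : Q) :
    M.maxOrder u v ↔ ((D.idx u : ℕ) = D.idx v ∨ D.below (D.idx u) (D.idx v)) := by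
  rw [below_idx, Automaton.maxOrder, Fin.val_inj, D.idx.apply_eq_iff_eq]

include hM in
omit [Fintype α] in
-- The label ⊥ puts the initial state below all others, so it alone has the fewest predecessors.
-- Being first, it opens chain 0.
theorem ord_zero {ord : ℕ → ℕ} (hS : Sorted (Fintype.card Q) D.below ord) :
    ord 0 = D.idx M.s := by
  obtain ⟨j, hj, h⟩ := (hS.mem _ (D.idx M.s).2).1 trivial
  rcases Nat.eq_zero_or_pos j with rfl | hj0
  · exact h
  have h0 := hS.ord_lt 0 (by omega)
  have hlt := hS.mono 0 j hj0 hj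
  by_contra hne
  have hbelow : D.below (D.idx M.s) (ord 0) := by
    refine ⟨(D.idx M.s).2, h0, fun hb => ?_⟩
    rw [state_idx] at hb
    refine absurd hb.lam_le (not_le.2 (hM.lam_s_lt ?_))
    intro h1
    have := congrArg (fun v => (D.idx v : ℕ)) h1
    simp only [idx_state] at this
    exact hne this
  have := (D.intervalOrder hM).numPreds_lt_of_lt hbelow
  rw [h] at hlt
  unfold PredLT at hlt
  omega

omit [Fintype α] in
theorem exists_chain (hM : M.IsStandard) (hD : M.IsDeterministic) {p : ℕ} {ord chain : ℕ → ℕ}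
    (hS : Sorted (Fintype.card Q) D.below ord)
    (hC : Chains (Fintype.card Q) D.below ord (Fintype.card Q) p chain) :
    ∃ chain' : Q → Fin M.width, IsSmallestChainDecomposition M.maxOrder chain' ∧ p = M.width ∧
      (∀ v, chain (D.idx v) = chain' v) ∧ (chain' M.s : ℕ) = 0 := by
  have hp : ∀ u < Fintype.card Q, chain u < p := by
    intro u hu
    obtain ⟨i, hi, rfl⟩ := (hS.mem u hu).1 trivial
    exact hC.chain_lt i hi
  obtain ⟨f, hf, hanti⟩ := hC.antichain
  have hdec : IsChainDecomposition M.maxOrder fun v => (⟨chain (D.idx v), hp _ (D.idx v).2⟩ : Fin p) := by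
    constructor
    · rintro ⟨c, hc⟩
      obtain ⟨j, hj, h⟩ := hC.surj c hc
      exact ⟨D.state (ord j) (hS.ord_lt j hj), by simp [h]⟩
    · intro c u hu v hv huv
      simp only [Set.mem_ofPred_eq] at hu hv
      have h := congrArg Fin.val (hu.trans hv.symm)
      simp only at h
      obtain ⟨i, hi, h1⟩ := (hS.mem _ (D.idx u).2).1 trivial
      obtain ⟨j, hj, h2⟩ := (hS.mem _ (D.idx v).2).1 trivial
      rw [maxOrder_iff D, maxOrder_iff D, ← h1, ← h2]
      rw [← h1, ← h2] at h
      rcases lt_trichotomy i j with h3 | rfl | h3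
      · exact Or.inl (Or.inr (hC.asc i j h3 hj h))
      · exact Or.inl (Or.inl rfl)
      · exact Or.inr (Or.inr (hC.asc j i h3 hi h.symm))
  obtain ⟨hw, hsm⟩ := Automaton.width_eq hM hD hdec (fun c => D.state (f c) (hf c c.2)) (by
    intro c c' hcc
    obtain ⟨h1, h2⟩ := hanti c c.2 c' c'.2 (fun h => hcc (Fin.ext h))
    constructor
    · intro h
      have := congrArg (fun v => (D.idx v : ℕ)) h
      simp only [idx_state] at this
      exact h1 this
    · rw [maxOrder_iff D]
      simp only [idx_state]
      exact fun h => h.elim h1 h2)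
  rw [hw]
  refine ⟨_, hsm, rfl, fun v => rfl, ?_⟩
  have := hC.first (Fintype.card_pos_iff.2 ⟨M.s⟩)
  rwa [D.ord_zero hM hS] at this

theorem range_flatMap {β : Type*} (n : ℕ) (g : ℕ → List β) :
    (List.range n).flatMap g = (List.finRange n).flatMap fun i : Fin n => g (i : ℕ) := by
  rw [← List.map_coe_finRange_eq_range]
  exact List.flatMap_map _ _ _

theorem orderList_eq {p : ℕ} {chain : ℕ → ℕ} {chain' : Q → Fin p}
    (h : ∀ v, chain (D.idx v) = chain' v) :
    (D.input hM).orderList D.below p chain = D.codeRel M.maxOrder ++ D.codeChain chain' := by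
  classical
  have hn : (D.input hM).n = Fintype.card Q := rfl
  have h1 : ∀ i : Fin (Fintype.card Q), (i : ℕ) = D.idx (D.idx.symm i) := by simp
  unfold Input.orderList codeRel codeChain
  rw [hn, List.append_assoc]
  congr 1
  · rw [range_flatMap, List.ofFn_eq_map, ← List.flatMap_def]
    congr 1
    funext i
    rw [range_flatMap, List.ofFn_eq_map, ← List.map_eq_flatMap]
    congr 1
    funext j
    have := D.maxOrder_iff (D.idx.symm i) (D.idx.symm j)
    simp only [← h1] at this
    congr 1
    exact propext this.symm
  · rw [range_flatMap, List.ofFn_eq_map, ← List.map_eq_flatMap, List.singleton_append]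
    congr 2
    funext i
    rw [← h, ← h1]

theorem map_getD (l : List (ℕ × ℕ × ℕ)) : (List.range l.length).map (fun e => l.getD e 0) = l := by
  apply List.ext_getElem
  · simp
  · intro i h1 h2
    simp [h2]

/-- The functions `k` and `d` on numerical triples mediate between edge indices (`key`, `g`) and
edges (`key'`, `g'`). Filtering commutes with the passage from edges to triples. -/
theorem listsOf_eq {lst : ℕ → ℕ} {v : Fin (Fintype.card Q) → Q} (hv : ∀ i : Fin (Fintype.card Q), lst (i : ℕ) = (D.idx (v i) : ℕ))
    {key : ℕ → ℕ} {g : ℕ → List ℕ} (key' : Q × Q × α → Q) (g' : Q × Q × α → List ℕ)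
    (k : ℕ × ℕ × ℕ → ℕ) (d : ℕ × ℕ × ℕ → List ℕ)
    (hkey : ∀ e, key e = k (D.triples.getD e 0)) (hg : ∀ e, g e = d (D.triples.getD e 0))
    (hk : ∀ e, k (D.triple e) = D.idx (key' e)) (hd : ∀ e, d (D.triple e) = g' e) :
    (D.input hM).listsOf lst key g = (List.finRange (Fintype.card Q)).flatMap fun i : Fin (Fintype.card Q) =>
      (D.edges.filter fun e => decide (D.idx (key' e) = D.idx (v i))).length ::
        (D.edges.filter fun e => decide (D.idx (key' e) = D.idx (v i))).flatMap g' := by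
  have hn : (D.input hM).n = Fintype.card Q := rfl
  have hm : (D.input hM).m = D.triples.length := D.length_triples.symm
  unfold Input.listsOf
  rw [hn, range_flatMap]
  congr 1
  funext i
  have h1 : ((List.range (D.input hM).m).filter fun e => key e = lst i).map
      (fun e => D.triples.getD e 0) = (D.edges.filter fun e =>
        decide (D.idx (key' e) = D.idx (v i))).map D.triple := by
    have h2 : (D.triples.filter fun t => decide (k t = lst i)) =
        ((List.range (D.input hM).m).filter fun e => key e = lst i).map
      (fun e => D.triples.getD e 0) := by
      conv_lhs => rw [← map_getD D.triples, List.filter_map, ← hm]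
      congr 2
      funext e
      simp [hkey]
    rw [← h2, triples, List.filter_map]
    congr 2
    funext e
    simp [hk, hv, Fin.val_inj]
  have h3 := congrArg List.length h1
  rw [List.length_map, List.length_map] at h3
  have h4 := congrArg (List.flatMap d) h1
  rw [List.flatMap_map, List.flatMap_map] at h4
  simp only [hd, ← hg] at h4
  rw [h3]
  congr 1

open Classical in
/-- The Burrows-Wheeler transform for a given list of the states. -/
noncomputable def bwt {p : ℕ} (chain : Q → Fin p) (v : Fin (Fintype.card Q) → Q) :
    BWT (Fintype.card Q) p α where
  outs i := (D.edges.filter fun e => decide (D.idx e.1 = D.idx (v i))).map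
    fun e => (chain e.2.1, e.2.2)
  ins i := (D.edges.filter fun e => decide (D.idx e.2.1 = D.idx (v i))).map fun e => chain e.1
  final i := decide (v i ∈ M.F)

omit [Fintype α] in
theorem bwt_isOf {p : ℕ} {chain : Q → Fin p} {v : Fin (Fintype.card Q) → Q}
    (hv : Function.Injective v)
    (hs : ∀ i j, i < j → chain (v i) < chain (v j) ∨
      (chain (v i) = chain (v j) ∧ M.maxOrder (v i) (v j) ∧ v i ≠ v j)) :
    (D.bwt chain v).IsOf M M.maxOrder chain := by
  classical
  refine ⟨Equiv.ofBijective v ((Fintype.bijective_iff_injective_and_card v).2 ⟨hv, by simp⟩),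
    hs, fun i => ⟨?_, ?_, ?_⟩⟩
  · rw [Finset.filter_val, ← D.coe_edges, Multiset.filter_coe, Multiset.map_coe]
    simp only [bwt, D.idx.apply_eq_iff_eq, Equiv.ofBijective_apply]
  · rw [Finset.filter_val, ← D.coe_edges, Multiset.filter_coe, Multiset.map_coe]
    simp only [bwt, D.idx.apply_eq_iff_eq, Equiv.ofBijective_apply]
  · simp [bwt]

theorem indexList_eq {p : ℕ} {chain lst : ℕ → ℕ} {chain' : Q → Fin p}
    (h : ∀ v, chain (D.idx v) = chain' v) {v : Fin (Fintype.card Q) → Q}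
    (hv : ∀ i : Fin (Fintype.card Q), lst (i : ℕ) = (D.idx (v i) : ℕ)) :
    (D.input hM).indexList p chain lst = (D.bwt chain' v).code := by
  classical
  have hn : (D.input hM).n = Fintype.card Q := rfl
  unfold Input.indexList BWT.code
  rw [D.listsOf_eq hM (key := (D.input hM).src)
    (g := fun e => [chain ((D.input hM).dst e), (D.input hM).lab e]) hv
    (fun e => e.1) (fun e => [(chain' e.2.1 : ℕ), rank e.2.2]) (fun t => t.1) (fun t => [chain t.2.1, t.2.2]) (fun _ => rfl) (fun _ => rfl) (fun _ => rfl)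
    (fun e => by simp [triple, h]),
    D.listsOf_eq hM (key := (D.input hM).dst) (g := fun e => [chain ((D.input hM).src e)]) hv
    (fun e => e.2.1) (fun e => [(chain' e.1 : ℕ)])
    (fun t => t.2.1) (fun t => [chain t.1]) (fun _ => rfl) (fun _ => rfl) (fun _ => rfl)
    (fun e => by simp [triple, h]), hn, range_flatMap]
  simp only [List.ofFn_eq_map, List.flatMap_map, bwt, List.length_map, List.nil_append,
    List.cons_append, List.append_assoc]
  refine congrArg (List.cons p) (congrArg₂ _ rfl (congrArg₂ _ ?_ ?_))
  · congr 1
    funext i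
    simp [List.map_eq_flatMap, List.flatMap_assoc]
  · rw [← List.map_eq_flatMap]
    congr 1
    funext i
    simp only [input, hv, (D.idx (v i)).2, dif_pos, state_idx]
    by_cases hF : v i ∈ M.F <;> simp [hF]

end Presentation

end

/-! ### The two programs and their running times -/

section

variable {Q α : Type*} [Fintype Q] [Fintype α] [LinearOrder α] {M : Automaton Q α}

namespace Presentation

variable (D : Presentation M)

theorem computes {w : ℕ} (hM : M.IsStandard) (hw : 160 * (Nat.log 2 (Fintype.card Q) + 1) ≤ w)
    {S : Stm} {T : ℕ} {Post : St → List ℕ → Prop}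
    (h : ∀ σ, (D.input hM).Start σ → Tri w (D.input hM).size S σ T (fun τ => ∃ l, Post τ l ∧
      τ.v .out = 4 + 3 * M.E.card + Fintype.card Q ∧
      ∃ σ₀, Emitted (4 + 3 * M.E.card + Fintype.card Q) σ₀ l τ)) :
    ∃ t τ l, Post τ l ∧ (Prog.seq prologue S.code).Computes w D.code t l ∧ t ≤ T + 8 := by
  obtain ⟨r, hr, -⟩ := D.code_eq hM
  exact computes_of_tri (D.input hM).le_size (D.size_pow_le hM hw)
    (n := Fintype.card Q) (m := M.E.card) (by simp [hr]) (by simp [hr]) rfl (D.length_code hM)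
    (D.code_lt hM) (h _ (D.start hM))

theorem computes_order (hM : M.IsStandard) (hD : M.IsDeterministic) {w : ℕ}
    (hw : 160 * (Nat.log 2 (Fintype.card Q) + 1) ≤ w) :
    ∃ (t : ℕ) (chain : Q → Fin M.width), IsSmallestChainDecomposition M.maxOrder chain ∧
      (Prog.seq prologue (Stm.seq solve emitOrder).code).Computes w D.code t
        (D.codeRel M.maxOrder ++ D.codeChain chain) ∧
      t ≤ 7000 * (M.E.card * M.E.card + Fintype.card Q * Fintype.card Q) + 8 := by
  obtain ⟨t, τ, l, ⟨chain, hc, rfl⟩, hx, ht⟩ := D.computes hM hw (S := .seq solve emitOrder)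
    (T := 7000 * (M.E.card * M.E.card + Fintype.card Q * Fintype.card Q))
    (Post := fun _ l => ∃ chain : Q → Fin M.width,
      IsSmallestChainDecomposition M.maxOrder chain ∧
        l = D.codeRel M.maxOrder ++ D.codeChain chain) (by
    intro σ hσ
    have hw' := D.size_pow_le hM hw
    refine Tri.seq_le _ (4000 * (M.E.card * M.E.card + Fintype.card Q * Fintype.card Q)) _ ?_
      (Input.tri_solve hw' hσ (D.intervalOrder hM) fun u hu v hv => D.below_iff hM hu hv) ?_
    · have h1 : (D.input hM).n = Fintype.card Q := rfl
      have h2 : (D.input hM).m = M.E.card := rfl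
      rw [h1, h2]
      omega
    intro σ₁ _ h₁
    refine (Input.tri_emitOrder hw' h₁).mono le_rfl ?_
    rintro τ - ⟨h3, h4⟩
    obtain ⟨chain, hc, hp, hch, -⟩ := D.exists_chain hM hD h₁.sorted h₁.chains
    rw [hp, D.orderList_eq hM hch] at h4
    exact ⟨_, ⟨chain, hc, rfl⟩, h3.trans h₁.loaded.out, σ₁, h4⟩)
  exact ⟨t, chain, hc, hx, ht⟩

theorem computes_index (hM : M.IsStandard) (hD : M.IsDeterministic) {w : ℕ}
    (hw : 160 * (Nat.log 2 (Fintype.card Q) + 1) ≤ w) :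
    ∃ (t : ℕ) (chain : Q → Fin M.width) (B : BWT (Fintype.card Q) M.width α),
      IsSmallestChainDecomposition M.maxOrder chain ∧ (chain M.s : ℕ) = 0 ∧
      B.IsOf M M.maxOrder chain ∧
      (Prog.seq prologue (Stm.seq solve (Stm.seq listStates emitIndex)).code).Computes
        w D.code t B.code ∧
      t ≤ 12000 * (Fintype.card Q + M.E.card) ^ 2 + 8 := by
  obtain ⟨t, τ, l, ⟨chain, B, hc, hs, hB, rfl⟩, hx, ht⟩ := D.computes hM hw
    (S := .seq solve (.seq listStates emitIndex))
    (T := 12000 * (Fintype.card Q + M.E.card) ^ 2)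
    (Post := fun _ l => ∃ (chain : Q → Fin M.width) (B : BWT (Fintype.card Q) M.width α),
      IsSmallestChainDecomposition M.maxOrder chain ∧ (chain M.s : ℕ) = 0 ∧
      B.IsOf M M.maxOrder chain ∧ l = B.code) (by
    intro σ hσ
    have hw' := D.size_pow_le hM hw
    have hlt := D.intervalOrder hM
    have h1 : (D.input hM).n = Fintype.card Q := rfl
    have h2 : (D.input hM).m = M.E.card := rfl
    have h3 := (D.input hM).n_pos
    have h4 : Fintype.card Q ≤ Fintype.card Q * Fintype.card Q := Nat.le_mul_self _
    have h5 : (Fintype.card Q + M.E.card) ^ 2 = Fintype.card Q * Fintype.card Q +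
      2 * (Fintype.card Q * M.E.card) + M.E.card * M.E.card := by ring
    refine Tri.seq_le _ (1000 * (Fintype.card Q * Fintype.card Q) +
      (4000 * (Fintype.card Q * M.E.card + Fintype.card Q) + 10)) _ ?_
      (Input.tri_solve hw' hσ hlt fun u hu v hv => D.below_iff hM hu hv) ?_
    · rw [h1, h2, h5]
      rw [h1] at h3
      omega
    intro σ₁ _ h₁
    refine Tri.seq_le _ (4000 * (Fintype.card Q * M.E.card + Fintype.card Q)) _ ?_
      (Input.tri_listStates hw' hlt h₁) ?_
    · rw [h1]
      omega
    intro σ₂ F₂ hL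
    have L₂ := h₁.loaded.of_frame F₂ (by decide) (by decide)
    have hp₂ : σ₂.v .p = σ₁.v .p := F₂.v _ rfl
    have hc₂ : σ₂.a .chain = σ₁.a .chain := F₂.a _ rfl
    refine (Input.tri_emitIndex hw' L₂ hL.ord_lt).mono le_rfl ?_
    rintro τ - ⟨h6, h7⟩
    obtain ⟨chain, hc, hp, hch, hs⟩ := D.exists_chain hM hD h₁.sorted h₁.chains
    have hlst : ∀ i < Fintype.card Q, σ₂.a .lst i < Fintype.card Q := hL.ord_lt
    have hv : ∀ i : Fin (Fintype.card Q),
        σ₂.a .lst (i : ℕ) = (D.idx (D.state (σ₂.a .lst i) (hlst i i.2)) : ℕ) :=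
      fun i => (D.idx_state _).symm
    rw [hp₂, hc₂, hp, D.indexList_eq hM hch hv] at h7
    refine ⟨_, ⟨chain, _, hc, hs, D.bwt_isOf ?_ ?_, rfl⟩, h6.trans L₂.out, σ₂, h7⟩
    · intro i j hij
      have h8 := congrArg (fun u => (D.idx u : ℕ)) hij
      simp only [← hv] at h8
      exact Fin.ext (hL.inj (fun u => by simp [Input.ChainLT, hlt.irrefl]) i.2 j.2 h8)
    · intro i j hij
      have h8 := hL.mono i j hij j.2
      rw [Input.ChainLT, hv i, hv j, hch, hch] at h8
      refine h8.imp (fun h => h) fun h => ⟨Fin.ext h.1, (D.maxOrder_iff _ _).2 (Or.inr h.2), ?_⟩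
      intro h9
      rw [h9] at h
      exact hlt.irrefl _ h.2)
  exact ⟨t, chain, B, hc, hs, hB, hx, ht⟩

end Presentation

end

/-- The greedy decomposition costs only O(|Q|²), which is weakened here to the exponent 5/2. -/
theorem sq_le_rpow {n : ℕ} (hn : 0 < n) : (n : ℝ) ^ 2 ≤ (n : ℝ) ^ (5 / 2 : ℝ) := by
  rw [← Real.rpow_natCast]
  exact Real.rpow_le_rpow_of_exponent_le (by exact_mod_cast hn) (by norm_num)

end CoLex

theorem mainTheorem8 :
    -- the maximal order and a smallest chain decomposition, in time `O(|E|² + |Q|^{5/2})`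
    (∃ (P : CoLex.Prog) (C : ℝ) (κ : ℕ),
      ∀ (Q α : Type*) [Fintype Q] [Fintype α] [LinearOrder α] (M : CoLex.Automaton Q α),
        M.IsStandard → M.IsDeterministic →
        ∃ le : Q → Q → Prop,
          (M.IsMaximalCoLex le ∧ ∀ le₁ : Q → Q → Prop, M.IsMaximalCoLex le₁ → le₁ = le) ∧
          ∀ (D : CoLex.Presentation M) (w : ℕ), κ * (Nat.log 2 (Fintype.card Q) + 1) ≤ w →
            ∃ (t : ℕ) (chain : Q → Fin M.width),
              CoLex.IsSmallestChainDecomposition le chain ∧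
              P.Computes w D.code t (D.codeRel le ++ D.codeChain chain) ∧
              (t : ℝ) ≤ C * ((M.E.card : ℝ) ^ 2 + (Fintype.card Q : ℝ) ^ (5 / 2 : ℝ))) ∧
    -- the index with optimal width, in polynomial time
    (∃ (P : CoLex.Prog) (C k κ : ℕ),
      ∀ (Q α : Type*) [Fintype Q] [Fintype α] [LinearOrder α] (M : CoLex.Automaton Q α),
        M.IsStandard → M.IsDeterministic →
        ∀ (D : CoLex.Presentation M) (w : ℕ), κ * (Nat.log 2 (Fintype.card Q) + 1) ≤ w →
          ∃ (le : Q → Q → Prop) (t : ℕ) (chain : Q → Fin M.width)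
            (B : CoLex.BWT (Fintype.card Q) M.width α),
            M.IsMaximalCoLex le ∧ CoLex.IsSmallestChainDecomposition le chain ∧
            (chain M.s : ℕ) = 0 ∧ B.IsOf M le chain ∧
            P.Computes w D.code t B.code ∧
            t ≤ C * (Fintype.card Q + M.E.card) ^ k) := by

  constructor
  -- The constant 7008 absorbs the 8 steps of the prologue, since |Q| ≥ 1; 12008 arises below in the
  -- same way.
  · refine ⟨.seq CoLex.prologue (CoLex.Stm.seq CoLex.solve CoLex.emitOrder).code, 7008, 160, ?_⟩
    intro Q α _ _ _ M hM hD
    refine ⟨M.maxOrder, CoLex.Automaton.maxOrder_isMaximal hM hD, fun D w hw => ?_⟩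
    obtain ⟨t, chain, hc, hx, ht⟩ := D.computes_order hM hD hw
    refine ⟨t, chain, hc, hx, ?_⟩
    have hn : 0 < Fintype.card Q := Fintype.card_pos_iff.2 ⟨M.s⟩
    have h1 := CoLex.sq_le_rpow hn
    have h2 : (t : ℝ) ≤ 7000 * ((M.E.card : ℝ) * M.E.card + (Fintype.card Q : ℝ) * Fintype.card Q)
      + 8 := by exact_mod_cast ht
    have h3 : (1 : ℝ) ≤ (Fintype.card Q : ℝ) ^ 2 := one_le_pow₀ (by exact_mod_cast hn)
    have h4 : (0 : ℝ) ≤ (M.E.card : ℝ) ^ 2 := sq_nonneg _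
    linarith
  · refine ⟨.seq CoLex.prologue
      (CoLex.Stm.seq CoLex.solve (CoLex.Stm.seq CoLex.listStates CoLex.emitIndex)).code,
      12008, 2, 160, ?_⟩
    intro Q α _ _ _ M hM hD D w hw
    obtain ⟨t, chain, B, hc, hs, hB, hx, ht⟩ := D.computes_index hM hD hw
    refine ⟨M.maxOrder, t, chain, B, (CoLex.Automaton.maxOrder_isMaximal hM hD).1, hc, hs, hB, hx,
      ht.trans ?_⟩
    have hn : 0 < Fintype.card Q := Fintype.card_pos_iff.2 ⟨M.s⟩
    have : 0 < (Fintype.card Q + M.E.card) ^ 2 := pow_pos (by omega) 2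
    omega
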